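/- Let $P$ be a finite set of processes and $A$ a finite set of labels. A *message sequence chart* (MSC) over $P$ and $A$ consists of words $w_p\in A^*$ $(p\in P)$, not all empty, and a relation $\lhd$ on the set $E=\bigcup_{p} E_p$ of events, where $E_p=\{p\}\times\{1,\dots,|w_p|\}$. Write $(p,i)\to(p,i+1)$ for successive events of one process. It is required that $e\lhd f$ holds only between events of distinct processes; that $\to\cup\lhd$ is acyclic; that each event belongs to at most one edge of $\lhd$; and that for all $e\lhd f$ and $e'\lhd f'$ with $e,e'\in E_p$ and $f,f'\in E_q$, $e\to^* e'$ iff $f\to^* f'$ (FIFO). Channels are unbounded. The order of the MSC is ${\le}=(\to\cup\lhd)^*$. A *communicating finite-state machine* (CFM) over $P$ and $A$ consists of a finite set $\mathit{Msg}$ of messages; for each $p\in P$, a finite set $S_p$ of states, an initial state $\iota_p\in S_p$ and a set $\Delta_p$ of transitions $(s,\alpha,s')$ with $s,s'\in S_p$, where $\alpha$ is an internal action $a\in A$, a send action $(a,!,m,q)$ or a receive action $(a,?,m,q)$ with $a\in A$, $m\in\mathit{Msg}$, $q\in P\setminus\{p\}$; and a set $\mathit{Acc}\subseteq\prod_p S_p$.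 A run on an MSC assigns to each event $e\in E_p$ a transition in $\Delta_p$ that carries the label of $e$, such that the first transition of each process starts in $\iota_p$; the target of the transition at $e$ is the source of that at $f$ whenever $e\to f$; events on no message edge get internal transitions; and if $e\lhd f$ with $e\in E_p$, $f\in E_q$, then $e$ sends some message $m$ to $q$ and $f$ receives the same $m$ from $p$. It is accepting if the tuple of the last states of the processes (which is $\iota_p$ if $E_p=\emptyset$) lies in $\mathit{Acc}$. $L(\mathcal A)$ is the set of MSCs on which $\mathcal A$ has an accepting run. $\mathrm{EMSO}^2[\to,\lhd,\le]$ is the set of sentences $\exists X_1\dots\exists X_n.\,\varphi$, with set variables $X_i$, where $\varphi$ is built from the atomic formulas $p(x)$ (for $p\in P$: "$x$ is on process $p$"), $a(x)$ (for $a\in A$: "$x$ has label $a$"), $x\in X_i$, $x=y$, $x\to y$, $x\lhd y$, $x\le y$ by Boolean connectives and first-order quantification over events, using only two first-order variables (which may be requantified). $L(\varphi)$ is the set of MSCs that satisfy $\varphi$. **Theorem.** CFMs and $\mathrm{EMSO}^2[\to,\lhd,\le]$ are expressively equivalent, effectively: for every CFM $\mathcal A$ there is a sentence $\varphi\in\mathrm{EMSO}^2[\to,\lhd,\le]$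 with $L(\mathcal A)=L(\varphi)$, and for every sentence $\varphi\in\mathrm{EMSO}^2[\to,\lhd,\le]$ there is a CFM $\mathcal A$ with $L(\mathcal A)=L(\varphi)$. Moreover, for fixed $P$ and $A$, there are computable functions, one producing such a $\varphi$ from (a finite description of) $\mathcal A$ and one producing (a finite description of) such an $\mathcal A$ from $\varphi$. -/

import Mathlib

universe u v

/-! ### Message sequence charts -/

/-- The events of a family of words `w`: pairs of a process and a position (counted from `0`) in
the word of that process. -/
abbrev Event {P : Type u} {A : Type v} (w : P → List A) : Type u :=
  (p : P) × Fin (w p).length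

/-- The process-edge relation: `f` is the immediate successor of `e` on the same process. -/
def ProcEdge {P : Type u} {A : Type v} {w : P → List A} (e f : Event w) : Prop :=
  e.1 = f.1 ∧ (e.2 : ℕ) + 1 = (f.2 : ℕ)

/-- Message sequence charts over the processes `P` and the labels `A`. -/
structure MSC (P : Type u) (A : Type v) where
  /-- the word of labels of each process -/
  word : P → List A
  /-- at least one word is non-empty -/
  word_ne : ∃ p, word p ≠ []
  /-- the message edges -/
  msg : Event word → Event word → Prop
  /-- message edges connect distinct processes -/
  msg_ne : ∀ e f, msg e f → e.1 ≠ f.1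
  /-- process edges and message edges together are acyclic -/
  acyclic : ∀ e, ¬ Relation.TransGen (fun e f => ProcEdge e f ∨ msg e f) e e
  /-- each event is part of at most one message edge -/
  msg_unique : ∀ e f e' f', msg e f → msg e' f' →
    (e = e' ∨ e = f' ∨ f = e' ∨ f = f') → e = e' ∧ f = f'
  /-- FIFO behaviour of every channel -/
  fifo : ∀ e f e' f', msg e f → msg e' f' → e.1 = e'.1 → f.1 = f'.1 →
    (Relation.ReflTransGen ProcEdge e e' ↔ Relation.ReflTransGen ProcEdge f f')

namespace MSC

variable {P : Type u} {A : Type v}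

/-- The events of an MSC. -/
abbrev E (M : MSC P A) : Type u := Event M.word

/-- The label of an event. -/
def label (M : MSC P A) (e : M.E) : A := (M.word e.1).get e.2

/-- The partial order of an MSC: the reflexive-transitive closure of process and message edges. -/
def le (M : MSC P A) : M.E → M.E → Prop :=
  Relation.ReflTransGen (fun e f => ProcEdge e f ∨ M.msg e f)

/-- An event is internal if it belongs to no message edge. -/
def IsInternal (M : MSC P A) (e : M.E) : Prop :=
  ∀ f, ¬ M.msg e f ∧ ¬ M.msg f e

end MSC

/-! ### Communicating finite-state machines -/

/-- The actions of process `p`: internal ones, sending a message to a process `q ≠ p`, and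
receiving a message from a process `q ≠ p`. Each carries a label from `A`. -/
inductive Act (P : Type u) (A : Type v) (Msg : Type) (p : P) : Type (max u v)
  | internal (a : A)
  | send (a : A) (m : Msg) (q : {q : P // q ≠ p})
  | recv (a : A) (m : Msg) (q : {q : P // q ≠ p})

namespace Act

variable {P : Type u} {A : Type v} {Msg : Type} {p : P}

/-- The label of an action. -/
def label : Act P A Msg p → A
  | internal a => a
  | send a _ _ => a
  | recv a _ _ => a

/-- The action is internal. -/
def IsInternal : Act P A Msg p → Prop
  | internal _ => True
  | send _ _ _ => False
  | recv _ _ _ => False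

/-- The action sends message `m` to process `q`. -/
def IsSend (m : Msg) (q : P) : Act P A Msg p → Prop
  | internal _ => False
  | send _ m' q' => m' = m ∧ (q' : P) = q
  | recv _ _ _ => False

/-- The action receives message `m` from process `q`. -/
def IsRecv (m : Msg) (q : P) : Act P A Msg p → Prop
  | internal _ => False
  | send _ _ _ => False
  | recv _ m' q' => m' = m ∧ (q' : P) = q

end Act

/-- A transition of process `p`: source state, action, target state. -/
structure CFMTrans (P : Type u) (A : Type v) (Msg : Type) (S : Type) (p : P) : Type (max u v) where
  source : S
  act : Act P A Msg p
  target : S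

/-- Communicating finite-state machines over the processes `P` and the labels `A`. -/
structure CFM (P : Type u) (A : Type v) where
  /-- the messages -/
  Msg : Type
  finite_msg : Finite Msg
  /-- the local states of each process -/
  S : P → Type
  finite_state : ∀ p, Finite (S p)
  /-- the initial state of each process -/
  init : ∀ p, S p
  /-- the transition relation of each process -/
  Δ : ∀ p, Set (CFMTrans P A Msg (S p) p)
  /-- the global accepting states -/
  Acc : Set (∀ p, S p)

namespace CFM

variable {P : Type u} {A : Type v}

/-- `ρ` is a run of `C` on `M`. -/
structure IsRun (C : CFM P A) (M : MSC P A)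
    (ρ : ∀ e : M.E, CFMTrans P A C.Msg (C.S e.1) e.1) : Prop where
  mem : ∀ e, ρ e ∈ C.Δ e.1
  label : ∀ e, (ρ e).act.label = M.label e
  init : ∀ (p : P) (i : Fin (M.word p).length), (i : ℕ) = 0 → (ρ ⟨p, i⟩).source = C.init p
  step : ∀ (p : P) (i j : Fin (M.word p).length),
    ProcEdge (⟨p, i⟩ : M.E) ⟨p, j⟩ → (ρ ⟨p, i⟩).target = (ρ ⟨p, j⟩).source
  internal : ∀ e, M.IsInternal e → (ρ e).act.IsInternal
  message : ∀ e f, M.msg e f → ∃ m : C.Msg, (ρ e).act.IsSend m f.1 ∧ (ρ f).act.IsRecv m e.1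

/-- The last state of process `p`: the target of its last transition, or the initial state if
`p` executes no event. -/
def lastState (C : CFM P A) (M : MSC P A)
    (ρ : ∀ e : M.E, CFMTrans P A C.Msg (C.S e.1) e.1) (p : P) : C.S p :=
  if h : 0 < (M.word p).length then
    (ρ ⟨p, ⟨(M.word p).length - 1, Nat.sub_lt h Nat.one_pos⟩⟩).target
  else C.init p

/-- The language of a CFM: the MSCs on which it has an accepting run. -/
def language (C : CFM P A) : Set (MSC P A) :=
  {M | ∃ ρ, C.IsRun M ρ ∧ C.lastState M ρ ∈ C.Acc}

end CFM

/-! ### Existential MSO logic with two first-order variables -/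

/-- First-order formulas over process edges, message edges and the order, with the two first-order
variables `0, 1 : Fin 2` (for `x` and `y`) and the free set variables `X i`, `i : Fin n`. -/
inductive FO2 (P : Type u) (A : Type v) (n : ℕ) : Type (max u v)
  | proc (p : P) (x : Fin 2)
  | label (a : A) (x : Fin 2)
  | mem (x : Fin 2) (X : Fin n)
  | eq (x y : Fin 2)
  | procEdge (x y : Fin 2)
  | msg (x y : Fin 2)
  | le (x y : Fin 2)
  | or (φ ψ : FO2 P A n)
  | not (φ : FO2 P A n)
  | ex (x : Fin 2) (φ : FO2 P A n)

namespace FO2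

variable {P : Type u} {A : Type v} {n : ℕ}

/-- The free first-order variables of a formula. -/
def freeVars : FO2 P A n → Finset (Fin 2)
  | proc _ x => {x}
  | label _ x => {x}
  | mem x _ => {x}
  | eq x y => {x, y}
  | procEdge x y => {x, y}
  | msg x y => {x, y}
  | le x y => {x, y}
  | or φ ψ => φ.freeVars ∪ ψ.freeVars
  | not φ => φ.freeVars
  | ex x φ => φ.freeVars.erase x

/-- Satisfaction in the MSC `M`, for an interpretation `X` of the set variables and `v` of the
first-order variables. -/
def Sat (M : MSC P A) (X : Fin n → Set M.E) : (Fin 2 → M.E) → FO2 P A n → Prop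
  | v, proc p x => (v x).1 = p
  | v, label a x => M.label (v x) = a
  | v, mem x i => v x ∈ X i
  | v, eq x y => v x = v y
  | v, procEdge x y => ProcEdge (v x) (v y)
  | v, msg x y => M.msg (v x) (v y)
  | v, le x y => M.le (v x) (v y)
  | v, or φ ψ => Sat M X v φ ∨ Sat M X v ψ
  | v, not φ => ¬ Sat M X v φ
  | v, ex x φ => ∃ e : M.E, Sat M X (Function.update v x e) φ

/-- A formula written in Polish (prefix) notation, as a string of symbols. A symbol is a triple of
natural numbers: the first says which atomic formula, connective or quantifier is meant, the others
give the numbers of the process, label or variables that occur in it (`0` where unused). -/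
def toSymbols {k l : ℕ} (numP : P ≃ Fin k) (numA : A ≃ Fin l) : FO2 P A n → List (ℕ × ℕ × ℕ)
  | proc p x => [(0, (numP p : ℕ), (x : ℕ))]
  | label a x => [(1, (numA a : ℕ), (x : ℕ))]
  | mem x i => [(2, (x : ℕ), (i : ℕ))]
  | eq x y => [(3, (x : ℕ), (y : ℕ))]
  | procEdge x y => [(4, (x : ℕ), (y : ℕ))]
  | msg x y => [(5, (x : ℕ), (y : ℕ))]
  | le x y => [(6, (x : ℕ), (y : ℕ))]
  | or φ ψ => (7, 0, 0) :: (φ.toSymbols numP numA ++ ψ.toSymbols numP numA)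
  | not φ => (8, 0, 0) :: φ.toSymbols numP numA
  | ex x φ => (9, (x : ℕ), 0) :: φ.toSymbols numP numA

end FO2

/-- Sentences `∃ X₀ … ∃ Xₙ₋₁, φ` of existential MSO logic with two first-order variables over
process edges, message edges and the order. -/
structure EMSO2 (P : Type u) (A : Type v) : Type (max u v) where
  /-- the number of existentially quantified set variables -/
  n : ℕ
  /-- the first-order kernel -/
  kernel : FO2 P A n
  /-- no first-order variable occurs free -/
  closed : kernel.freeVars = ∅

namespace EMSO2

variable {P : Type u} {A : Type v}

/-- The MSC language of a sentence. As the kernel has no free first-order variable and MSCs are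
non-empty, the interpretation `v` of the first-order variables is immaterial. -/
def language (φ : EMSO2 P A) : Set (MSC P A) :=
  {M | ∃ X : Fin φ.n → Set M.E, ∀ v : Fin 2 → M.E, φ.kernel.Sat M X v}

/-- The code of a sentence: the number of set variables and the kernel as a string of symbols. -/
def code {k l : ℕ} (numP : P ≃ Fin k) (numA : A ≃ Fin l) (φ : EMSO2 P A) :
    ℕ × List (ℕ × ℕ × ℕ) :=
  (φ.n, φ.kernel.toSymbols numP numA)

end EMSO2

/-! ### Finite descriptions of CFMs -/

/-- Description of an action, for `k` processes and `l` labels: `inl a` is the internal action with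
label `a`, and `inr (a, true, m, q)` and `inr (a, false, m, q)` are the actions with label `a` that
send message `m` to process `q`, respectively receive `m` from `q`. -/
abbrev ActCode (k l : ℕ) : Type := Fin l ⊕ (Fin l × Bool × ℕ × Fin k)

/-- Finite descriptions `(s, m, Δ, F)` of CFMs with `k` processes and `l` labels: process `i` has the
states `0, …, s i` with initial state `0`, the messages are `0, …, m - 1`, and `Δ i` lists
the transitions of process `i`, and `F` the global accepting states (entries with a state or a
message out of range are disregarded). -/
abbrev CFMCode (k l : ℕ) : Type :=
  (Fin k → ℕ) × ℕ × (Fin k → List (ℕ × ActCode k l × ℕ)) × List (Fin k → ℕ)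

/-- The description of an action over the messages `0, …, m - 1`. -/
def Act.code {P : Type u} {A : Type v} {k l m : ℕ} (numP : P ≃ Fin k) (numA : A ≃ Fin l) {p : P} :
    Act P A (Fin m) p → ActCode k l
  | .internal a => .inl (numA a)
  | .send a b q => .inr (numA a, true, (b : ℕ), numP q)
  | .recv a b q => .inr (numA a, false, (b : ℕ), numP q)

/-- The CFM that a description denotes, for given numberings of the processes and labels. -/
def CFMCode.toCFM {P : Type u} {A : Type v} {k l : ℕ} (numP : P ≃ Fin k) (numA : A ≃ Fin l)
    (c : CFMCode k l) : CFM P A where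
  Msg := Fin c.2.1
  finite_msg := inferInstance
  S p := Fin (c.1 (numP p) + 1)
  finite_state _ := inferInstance
  init _ := 0
  Δ p := {t | ((t.source : ℕ), t.act.code numP numA, (t.target : ℕ)) ∈ c.2.2.1 (numP p)}
  Acc := {s | ∃ g ∈ c.2.2.2, ∀ p, (s p : ℕ) = g (numP p)}

/-!
The easy direction describes a run of a machine by sets of events, one for each transition: that
they form an accepting run is a property of neighbouring events and of last events, and two
first-order variables suffice to state it (`CFMCode.exists_sentence`).

For the converse, the basic notion is that of a relation on labelled MSCs which is recognizable,
that is, the projection of a finite set of local constraints, a `Tiling`. Machines check local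
constraints by guessing labels, so recognizable relations may be used freely, and functions between
labellings with recognizable graph (`IsTransduction`) may be composed. The heart of the proof is
that, given a set `X` of marked events, each event can be told in which of the eight relative
positions of `MSC.Kind` it sees marked events (`IsTransduction.kinds`).

* Whether some marked event lies above or below follows by recursion along the order. If edges are
  to be excluded, the last two (or first two) marked events of each process decide, as an event has
  at most one neighbour by an edge on each process, in either direction (`IsTransduction.far`).
* Incomparability is the hard case. For processes `p` and `q`, let an event of `p` go back to `q`
  along a path of messages, always taking the latest message, then forward to the next event of
  `X`, and back to `p` along another path. This loop map is monotone on the events of `p`, and an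
  event is concurrent to no event of `X` on `q` if and only if one of the finitely many loop maps
  along short paths does not move it strictly downwards (`MSC.exists_concurrent_iff`). The sign of
  a loop map at all events of `p` is certified by finitely many labels: besides the sign itself, a
  colour which alternates along the fixed points and along the orbits (`SignCert.sign_of_check`,
  `SignCert.exists_check`). Wrong signs would give rise to an infinite orbit or to two events which
  contradict monotonicity.

Thus the relative positions are computed by one fixed tiling (`exists_kindTiling`). A machine for a
sentence guesses the sets and, for each event, the truth values of the subformulas which begin with
a quantifier. As there are only two variables, such a subformula is a property of a single event,
and the events have finitely many letters, consisting of process, label and truth values. One copy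
of the fixed tiling for each letter tells every event which letters it sees in which positions, and
this determines whether its truth values are correct (`Polish.exists_accepts_iff`).

All constructions are carried out on strings and lists of numbers, so that they are primitive
recursive by their shape: formulas are evaluated in Polish notation with a stack, and the
transitions of the machine for a system of constraints (`Blueprint.code`) are obtained by filtering
a list. Machines with arbitrary states and messages are reduced to such descriptions by renaming
(`CFM.exists_code`).
-/

namespace MSC

variable {P : Type u} {A : Type v}

/-! ### The order of a message sequence chart -/

theorem event_ext {w : P → List A} {e f : Event w} (h : e.1 = f.1) (h' : (e.2 : ℕ) = f.2) :
    e = f := by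
  obtain ⟨p, i⟩ := e
  obtain ⟨q, j⟩ := f
  obtain rfl : p = q := h
  obtain rfl : i = j := Fin.ext h'
  rfl

/-- The edges of an MSC: process edges and message edges. -/
def Edge (M : MSC P A) (e f : M.E) : Prop := ProcEdge e f ∨ M.msg e f

/-- The strict order of an MSC. -/
def lt (M : MSC P A) : M.E → M.E → Prop := Relation.TransGen M.Edge

/-- The event `e` strictly precedes `f` on the same process. -/
def Before {w : P → List A} (e f : Event w) : Prop := e.1 = f.1 ∧ (e.2 : ℕ) < f.2

theorem lt_irrefl (M : MSC P A) (e : M.E) : ¬ M.lt e e := M.acyclic e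

theorem lt_trans (M : MSC P A) {e f g : M.E} (h : M.lt e f) (h' : M.lt f g) : M.lt e g :=
  Relation.TransGen.trans h h'

theorem le_iff (M : MSC P A) {e f : M.E} : M.le e f ↔ e = f ∨ M.lt e f := by
  unfold le lt
  rw [Relation.reflTransGen_iff_eq_or_transGen, eq_comm]
  rfl

theorem le_refl (M : MSC P A) (e : M.E) : M.le e e := Relation.ReflTransGen.refl

theorem lt.le {M : MSC P A} {e f : M.E} (h : M.lt e f) : M.le e f := M.le_iff.2 (Or.inr h)

theorem le_trans (M : MSC P A) {e f g : M.E} (h : M.le e f) (h' : M.le f g) : M.le e g :=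
  Relation.ReflTransGen.trans h h'

theorem lt_of_lt_of_le (M : MSC P A) {e f g : M.E} (h : M.lt e f) (h' : M.le f g) : M.lt e g :=
  Relation.TransGen.trans_left h h'

theorem lt_of_le_of_lt (M : MSC P A) {e f g : M.E} (h : M.le e f) (h' : M.lt f g) : M.lt e g :=
  Relation.TransGen.trans_right h h'

theorem not_le_of_lt (M : MSC P A) {e f : M.E} (h : M.lt e f) : ¬ M.le f e :=
  fun h' => M.lt_irrefl e (M.lt_of_lt_of_le h h')

theorem lt_of_msg (M : MSC P A) {e f : M.E} (h : M.msg e f) : M.lt e f :=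
  Relation.TransGen.single (Or.inr h)

theorem transGen_procEdge {w : P → List A} {e f : Event w} :
    Relation.TransGen ProcEdge e f ↔ Before e f := by
  constructor
  · intro h
    induction h with
    | single h => exact ⟨h.1, by have := h.2; omega⟩
    | tail _ h ih => exact ⟨ih.1.trans h.1, by have := h.2; have := ih.2; omega⟩
  · obtain ⟨p, i, hi⟩ := e
    obtain ⟨q, j, hj⟩ := f
    rintro ⟨rfl : p = q, h⟩
    simp only at h
    induction j with
    | zero => omega
    | succ j ih =>
      have hs : ProcEdge (⟨p, ⟨j, by omega⟩⟩ : Event w) ⟨p, ⟨j + 1, hj⟩⟩ := ⟨rfl, rfl⟩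
      rcases Nat.lt_succ_iff_lt_or_eq.1 h with h | rfl
      · exact (ih (by omega) h).tail hs
      · exact .single hs

theorem reflTransGen_procEdge {w : P → List A} {e f : Event w} :
    Relation.ReflTransGen ProcEdge e f ↔ e.1 = f.1 ∧ (e.2 : ℕ) ≤ f.2 := by
  rw [Relation.reflTransGen_iff_eq_or_transGen, transGen_procEdge]
  constructor
  · rintro (rfl | h)
    · exact ⟨rfl, _root_.le_refl _⟩
    · exact ⟨h.1, h.2.le⟩
  · rintro ⟨h, h'⟩
    rcases h'.lt_or_eq with h' | h'
    · exact Or.inr ⟨h, h'⟩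
    · exact Or.inl (event_ext h h').symm

theorem Before.lt {M : MSC P A} {e f : M.E} (h : Before e f) : M.lt e f :=
  Relation.TransGen.mono (fun _ _ => Or.inl) _ _ (transGen_procEdge.2 h)

theorem le_of_pos (M : MSC P A) {e f : M.E} (h : e.1 = f.1) (h' : (e.2 : ℕ) ≤ f.2) : M.le e f := by
  rcases h'.lt_or_eq with h' | h'
  · exact lt.le (Before.lt ⟨h, h'⟩)
  · exact M.le_iff.2 (Or.inl (event_ext h h'))

theorem pos_le_of_le (M : MSC P A) {e f : M.E} (h : e.1 = f.1) (h' : M.le e f) :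
    (e.2 : ℕ) ≤ f.2 := by
  by_contra hc
  exact M.not_le_of_lt (Before.lt ⟨h.symm, not_le.1 hc⟩) h'

theorem pos_lt_of_lt (M : MSC P A) {e f : M.E} (h : e.1 = f.1) (h' : M.lt e f) :
    (e.2 : ℕ) < f.2 := by
  by_contra hc
  exact M.not_le_of_lt h' (M.le_of_pos h.symm (not_lt.1 hc))

theorem before_trichotomy {w : P → List A} {e f : Event w} (h : e.1 = f.1) :
    Before e f ∨ e = f ∨ Before f e := by
  rcases Nat.lt_trichotomy (e.2 : ℕ) f.2 with h' | h' | h'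
  · exact Or.inl ⟨h, h'⟩
  · exact Or.inr (Or.inl (event_ext h h'))
  · exact Or.inr (Or.inr ⟨h.symm, h'⟩)

theorem wf_lt (M : MSC P A) [Finite P] : WellFounded M.lt :=
  haveI : IsTrans M.E M.lt := ⟨fun _ _ _ => M.lt_trans⟩
  haveI : Std.Irrefl M.lt := ⟨M.lt_irrefl⟩
  Finite.wellFounded_of_trans_of_irrefl _

theorem wf_gt (M : MSC P A) [Finite P] : WellFounded (Function.swap M.lt) :=
  haveI : IsTrans M.E (Function.swap M.lt) := ⟨fun _ _ _ h h' => M.lt_trans h' h⟩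
  haveI : Std.Irrefl (Function.swap M.lt) := ⟨M.lt_irrefl⟩
  Finite.wellFounded_of_trans_of_irrefl _

/-! ### Neighbours of an event -/

/-- The partial function whose graph is `R`, for a functional relation `R`. -/
noncomputable def pfun {α β : Type*} (R : α → β → Prop) (a : α) : Option β :=
  open Classical in if h : ∃ b, R a b then some h.choose else none

theorem pfun_eq_some {α β : Type*} {R : α → β → Prop} (hR : ∀ a b c, R a b → R a c → b = c)
    {a : α} {b : β} : pfun R a = some b ↔ R a b := by
  by_cases h : ∃ b, R a b
  all_goals simp only [pfun, h, dite_true, dite_false]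
  · rw [Option.some_inj]
    exact ⟨fun hb => hb ▸ h.choose_spec, fun hb => hR _ _ _ h.choose_spec hb⟩
  · exact ⟨fun hc => (by cases hc), fun hb => absurd ⟨b, hb⟩ h⟩

/-- The successor of an event on its process. -/
noncomputable def next (M : MSC P A) : M.E → Option M.E := pfun ProcEdge

/-- The predecessor of an event on its process. -/
noncomputable def prev (M : MSC P A) : M.E → Option M.E := pfun (Function.swap ProcEdge)

/-- The receive event that matches a send event. -/
noncomputable def snd (M : MSC P A) : M.E → Option M.E := pfun M.msg

/-- The send event that matches a receive event. -/
noncomputable def rcv (M : MSC P A) : M.E → Option M.E := pfun (Function.swap M.msg)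

/-- The first event of process `q`. -/
noncomputable def firstOn (M : MSC P A) (q : P) : Option M.E :=
  pfun (fun (_ : Unit) (f : M.E) => f.1 = q ∧ (f.2 : ℕ) = 0) ()

variable {M : MSC P A} {e f : M.E}

theorem next_eq_some : M.next e = some f ↔ ProcEdge e f :=
  pfun_eq_some fun _ _ _ h h' => event_ext (h.1.symm.trans h'.1) (h.2.symm.trans h'.2)

theorem prev_eq_some : M.prev e = some f ↔ ProcEdge f e :=
  pfun_eq_some fun _ _ _ h h' => event_ext (h.1.trans h'.1.symm)
    (Nat.add_right_cancel (h.2.trans h'.2.symm))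

theorem snd_eq_some : M.snd e = some f ↔ M.msg e f :=
  pfun_eq_some (R := M.msg) fun _ _ _ h h' => (M.msg_unique _ _ _ _ h h' (Or.inl rfl)).2

theorem rcv_eq_some : M.rcv e = some f ↔ M.msg f e :=
  pfun_eq_some (R := Function.swap M.msg) fun _ _ _ h h' =>
    (M.msg_unique _ _ _ _ h h' (Or.inr (Or.inr (Or.inr rfl)))).1

theorem firstOn_eq_some {q : P} : M.firstOn q = some f ↔ f.1 = q ∧ (f.2 : ℕ) = 0 :=
  pfun_eq_some fun _ _ _ h h' => event_ext (h.1.trans h'.1.symm) (h.2.trans h'.2.symm)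

theorem next_eq_none : M.next e = none ↔ (e.2 : ℕ) + 1 = (M.word e.1).length := by
  rw [Option.eq_none_iff_forall_ne_some]
  constructor
  · intro h
    by_contra hc
    have hlt : (e.2 : ℕ) + 1 < (M.word e.1).length := by have := e.2.2; omega
    exact h ⟨e.1, ⟨_, hlt⟩⟩ (next_eq_some.2 ⟨rfl, rfl⟩)
  · rintro h ⟨q, j⟩ hf
    obtain ⟨h1, h2⟩ := next_eq_some.1 hf
    obtain rfl : e.1 = q := h1
    have := j.2
    simp only at h2
    omega

theorem prev_eq_none : M.prev e = none ↔ (e.2 : ℕ) = 0 := by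
  rw [Option.eq_none_iff_forall_ne_some]
  constructor
  · intro h
    by_contra hc
    exact h ⟨e.1, ⟨e.2 - 1, by have := e.2.2; omega⟩⟩
      (prev_eq_some.2 ⟨rfl, by simp only; omega⟩)
  · rintro h f hf
    have := (prev_eq_some.1 hf).2
    omega

theorem firstOn_eq_none {q : P} : M.firstOn q = none ↔ M.word q = [] := by
  rw [Option.eq_none_iff_forall_ne_some]
  constructor
  · intro h
    by_contra hc
    exact h ⟨q, ⟨0, List.length_pos_iff.2 hc⟩⟩ (firstOn_eq_some.2 ⟨rfl, rfl⟩)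
  · rintro h ⟨r, j⟩ hf
    obtain rfl : r = q := (firstOn_eq_some.1 hf).1
    have := j.2
    simp [h] at this

/-- A labelling determined by the labels of the preceding events is unique. -/
theorem eq_of_past_rec [Finite P] {Δ : Type*} (H : M.E → Option Δ → Option Δ → Δ)
    {φ ψ : M.E → Δ} (hφ : ∀ e, φ e = H e ((M.prev e).map φ) ((M.rcv e).map φ))
    (hψ : ∀ e, ψ e = H e ((M.prev e).map ψ) ((M.rcv e).map ψ)) : φ = ψ := by
  funext e
  induction e using M.wf_lt.induction with
  | _ e ih =>
    rw [hφ, hψ]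
    congr 1
    · refine Option.map_congr fun f hf => ih f ?_
      exact Relation.TransGen.single (Or.inl (prev_eq_some.1 hf))
    · refine Option.map_congr fun f hf => ih f ?_
      exact Relation.TransGen.single (Or.inr (rcv_eq_some.1 hf))

/-- A labelling determined by the labels of the following events is unique. -/
theorem eq_of_future_rec [Finite P] {Δ : Type*} (H : M.E → Option Δ → Option Δ → Δ)
    {φ ψ : M.E → Δ} (hφ : ∀ e, φ e = H e ((M.next e).map φ) ((M.snd e).map φ))
    (hψ : ∀ e, ψ e = H e ((M.next e).map ψ) ((M.snd e).map ψ)) : φ = ψ := by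
  funext e
  induction e using M.wf_gt.induction with
  | _ e ih =>
    rw [hφ, hψ]
    congr 1
    · refine Option.map_congr fun f hf => ih f ?_
      exact Relation.TransGen.single (Or.inl (next_eq_some.1 hf))
    · refine Option.map_congr fun f hf => ih f ?_
      exact Relation.TransGen.single (Or.inr (snd_eq_some.1 hf))

end MSC

/-! ### Tilings -/

namespace MSC

/-- The label of the last event of process `p`, if `p` has an event. -/
def lastLabel {Γ : Type*} (M : MSC P A) (g : M.E → Γ) (p : P) : Option Γ :=
  if h : 0 < (M.word p).length then
    some (g ⟨p, ⟨(M.word p).length - 1, Nat.sub_lt h Nat.one_pos⟩⟩)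
  else none

theorem lastLabel_map {Γ Δ : Type*} (M : MSC P A) (g : M.E → Γ) (h : P → Γ → Δ) (p : P) :
    M.lastLabel (fun e => h e.1 (g e)) p = (M.lastLabel g p).map (h p) := by
  by_cases hp : 0 < (M.word p).length
  · simp [lastLabel, hp]
  · simp [lastLabel, hp]

theorem lastLabel_eq_some {Γ : Type*} {M : MSC P A} {g : M.E → Γ} {p : P} {c : Γ} :
    M.lastLabel g p = some c ↔ ∃ e : M.E, e.1 = p ∧ M.next e = none ∧ g e = c := by
  constructor
  · intro h
    by_cases hp : 0 < (M.word p).length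
    · simp only [lastLabel, hp, dite_true, Option.some_inj] at h
      exact ⟨_, rfl, next_eq_none.2 (Nat.sub_add_cancel hp), h⟩
    · simp [lastLabel, hp] at h
  · rintro ⟨⟨q, j⟩, rfl, h, rfl⟩
    have hj := next_eq_none.1 h
    simp only at hj
    have hp : 0 < (M.word q).length := by omega
    simp only [lastLabel, hp, dite_true, Option.some_inj]
    congr
    exact Nat.sub_eq_of_eq_add hj.symm

theorem lastLabel_eq_none {Γ : Type*} {M : MSC P A} {g : M.E → Γ} {p : P} :
    M.lastLabel g p = none ↔ M.word p = [] := by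
  by_cases hp : 0 < (M.word p).length
  · simp [lastLabel, hp, List.length_pos_iff.1 hp]
  · simp [lastLabel, List.length_pos_iff.not_left.1 hp]

end MSC

/-- A finite set of local constraints on labellings of the events of an MSC by `Γ`: on the labels of
first events, of successive events of a process, of internal events and of the two ends of a
message, and one constraint on the tuple of last labels (`none` for a process without events). -/
structure Tiling (P : Type u) (Γ : Type) where
  first : P → Γ → Prop
  step : P → Γ → Γ → Prop
  int : P → Γ → Prop
  msg : P → Γ → P → Γ → Prop
  fin : (P → Option Γ) → Prop

namespace Tiling

variable {Γ Δ : Type}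

/-- The labelling `g` of `M` satisfies the constraints of the tiling. -/
structure Holds (T : Tiling P Γ) (M : MSC P A) (g : M.E → Γ) : Prop where
  first : ∀ e, M.prev e = none → T.first e.1 (g e)
  step : ∀ e f : M.E, ProcEdge e f → T.step e.1 (g e) (g f)
  int : ∀ e, M.IsInternal e → T.int e.1 (g e)
  msg : ∀ e f, M.msg e f → T.msg e.1 (g e) f.1 (g f)
  fin : T.fin (M.lastLabel g)

/-- The pull-back of a tiling along a map of labels, which may depend on the process. -/
def comap (T : Tiling P Δ) (h : P → Γ → Δ) : Tiling P Γ where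
  first p c := T.first p (h p c)
  step p c d := T.step p (h p c) (h p d)
  int p c := T.int p (h p c)
  msg p c q d := T.msg p (h p c) q (h q d)
  fin o := T.fin fun p => (o p).map (h p)

theorem holds_comap {T : Tiling P Δ} {h : P → Γ → Δ} {M : MSC P A} {g : M.E → Γ} :
    (T.comap h).Holds M g ↔ T.Holds M fun e => h e.1 (g e) := by
  have hs : ∀ e f : M.E, ProcEdge e f → h e.1 (g f) = h f.1 (g f) := fun e f h => by rw [h.1]
  have hf : (M.lastLabel fun e => h e.1 (g e)) = fun p => (M.lastLabel g p).map (h p) :=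
    funext fun p => M.lastLabel_map g h p
  constructor
  · intro H
    exact ⟨H.first, fun e f hef => hs e f hef ▸ H.step e f hef, H.int, H.msg, hf ▸ H.fin⟩
  · intro H
    refine ⟨H.first, fun e f hef => ?_, H.int, H.msg, ?_⟩
    · have := H.step e f hef
      rwa [← hs e f hef] at this
    · have := H.fin
      rwa [hf] at this

/-- The conjunction of two tilings. -/
def inf (T T' : Tiling P Γ) : Tiling P Γ where
  first p c := T.first p c ∧ T'.first p c
  step p c d := T.step p c d ∧ T'.step p c d
  int p c := T.int p c ∧ T'.int p c
  msg p c q d := T.msg p c q d ∧ T'.msg p c q d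
  fin o := T.fin o ∧ T'.fin o

theorem holds_inf {T T' : Tiling P Γ} {M : MSC P A} {g : M.E → Γ} :
    (T.inf T').Holds M g ↔ T.Holds M g ∧ T'.Holds M g :=
  ⟨fun H => ⟨⟨fun e h => (H.first e h).1, fun e f h => (H.step e f h).1, fun e h => (H.int e h).1,
      fun e f h => (H.msg e f h).1, H.fin.1⟩,
    ⟨fun e h => (H.first e h).2, fun e f h => (H.step e f h).2, fun e h => (H.int e h).2,
      fun e f h => (H.msg e f h).2, H.fin.2⟩⟩,
    fun ⟨H, H'⟩ => ⟨fun e h => ⟨H.first e h, H'.first e h⟩,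
      fun e f h => ⟨H.step e f h, H'.step e f h⟩, fun e h => ⟨H.int e h, H'.int e h⟩,
      fun e f h => ⟨H.msg e f h, H'.msg e f h⟩, ⟨H.fin, H'.fin⟩⟩⟩

/-- The tiling without constraints. -/
def triv : Tiling P Γ where
  first _ _ := True
  step _ _ _ := True
  int _ _ := True
  msg _ _ _ _ := True
  fin _ := True

end Tiling

/-! ### Recognizable relations -/

/-- A property of labelled MSCs is recognizable if it is the projection of a tiling with finitely
many additional labels. -/
def Recognizable {Γ : Type} (R : ∀ M : MSC P A, (M.E → Γ) → Prop) : Prop :=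
  ∃ (Δ : Type) (_ : Finite Δ) (T : Tiling P (Γ × Δ)), ∀ (M : MSC P A) (g : M.E → Γ),
    R M g ↔ ∃ d : M.E → Δ, T.Holds M fun e => (g e, d e)

namespace Recognizable

variable {Γ Δ : Type} {R R' : ∀ M : MSC P A, (M.E → Γ) → Prop}

theorem congr (h : Recognizable R) (H : ∀ M g, R' M g ↔ R M g) : Recognizable R' := by
  obtain ⟨Δ, hΔ, T, hT⟩ := h
  exact ⟨Δ, hΔ, T, fun M g => (H M g).trans (hT M g)⟩

theorem of_tiling (T : Tiling P Γ) : Recognizable fun (M : MSC P A) g => T.Holds M g :=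
  ⟨Unit, inferInstance, T.comap fun _ c => c.1, fun _ _ =>
    ⟨fun h => ⟨fun _ => (), Tiling.holds_comap.2 h⟩, fun ⟨_, h⟩ => Tiling.holds_comap.1 h⟩⟩

theorem and (h : Recognizable R) (h' : Recognizable R') :
    Recognizable fun M g => R M g ∧ R' M g := by
  obtain ⟨Δ, hΔ, T, hT⟩ := h
  obtain ⟨Δ', hΔ', T', hT'⟩ := h'
  refine ⟨Δ × Δ', inferInstance, (T.comap fun _ c => (c.1, c.2.1)).inf
    (T'.comap fun _ c => (c.1, c.2.2)), fun M g => ?_⟩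
  simp only [hT, hT']
  constructor
  · rintro ⟨⟨d, hd⟩, d', hd'⟩
    exact ⟨fun e => (d e, d' e), Tiling.holds_inf.2
      ⟨Tiling.holds_comap.2 hd, Tiling.holds_comap.2 hd'⟩⟩
  · rintro ⟨d, hd⟩
    obtain ⟨h1, h2⟩ := Tiling.holds_inf.1 hd
    exact ⟨⟨fun e => (d e).1, Tiling.holds_comap.1 h1⟩,
      ⟨fun e => (d e).2, Tiling.holds_comap.1 h2⟩⟩

theorem comap {R : ∀ M : MSC P A, (M.E → Δ) → Prop} (h : Recognizable R) (k : P → Γ → Δ) :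
    Recognizable fun (M : MSC P A) (g : M.E → Γ) => R M fun e => k e.1 (g e) := by
  obtain ⟨Θ, hΘ, T, hT⟩ := h
  refine ⟨Θ, hΘ, T.comap fun p c => (k p c.1, c.2), fun M g => ?_⟩
  simp only [hT]
  exact exists_congr fun d => (Tiling.holds_comap (T := T) (h := fun p c => (k p c.1, c.2))
    (g := fun e => (g e, d e))).symm

theorem ex [Finite Δ] {R : ∀ M : MSC P A, (M.E → Γ × Δ) → Prop} (h : Recognizable R) :
    Recognizable fun (M : MSC P A) (g : M.E → Γ) => ∃ d : M.E → Δ, R M fun e => (g e, d e) := by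
  obtain ⟨Θ, hΘ, T, hT⟩ := h
  refine ⟨Δ × Θ, inferInstance, T.comap fun _ c => ((c.1, c.2.1), c.2.2), fun M g => ?_⟩
  simp only [hT]
  constructor
  · rintro ⟨d, t, h⟩
    exact ⟨fun e => (d e, t e), Tiling.holds_comap.2 h⟩
  · rintro ⟨d, h⟩
    exact ⟨fun e => (d e).1, fun e => (d e).2, Tiling.holds_comap.1 h⟩

theorem true : Recognizable (A := A) (P := P) (Γ := Γ) fun _ _ => True :=
  (of_tiling Tiling.triv).congr fun _ _ =>
    ⟨fun _ => ⟨fun _ _ => trivial, fun _ _ _ => trivial, fun _ _ => trivial,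
      fun _ _ _ => trivial, trivial⟩, fun _ => trivial⟩

theorem all {ι : Type*} [Finite ι] {R : ι → ∀ M : MSC P A, (M.E → Γ) → Prop}
    (h : ∀ i, Recognizable (R i)) : Recognizable fun M g => ∀ i, R i M g := by
  classical
  cases nonempty_fintype ι
  have key : ∀ s : Finset ι, Recognizable fun M g => ∀ i ∈ s, R i M g := by
    intro s
    induction s using Finset.induction_on with
    | empty => exact true.congr fun M g => by simp
    | insert i s _ ih => exact ((h i).and ih).congr fun M g => by simp
  exact (key Finset.univ).congr fun M g => by simp

theorem node (N : P → Γ → Prop) :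
    Recognizable fun (M : MSC P A) (g : M.E → Γ) => ∀ e, N e.1 (g e) := by
  refine (of_tiling { Tiling.triv with int := N, msg := fun p c q d => N p c ∧ N q d }).congr
    fun M g => ⟨fun h => ⟨fun _ _ => trivial, fun _ _ _ => trivial, fun e _ => h e,
      fun e f _ => ⟨h e, h f⟩, trivial⟩, fun h e => ?_⟩
  by_cases he : M.IsInternal e
  · exact h.int e he
  · simp only [MSC.IsInternal, not_forall] at he
    obtain ⟨f, hf⟩ := he
    by_cases hef : M.msg e f
    · exact (h.msg e f hef).1
    · exact (h.msg f e (by tauto)).2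

end Recognizable

/-! ### Recognizable transductions -/

/-- A transformation of labellings is a recognizable transduction if its graph is recognizable. -/
def IsTransduction {Γ Δ : Type} (Φ : ∀ M : MSC P A, (M.E → Γ) → M.E → Δ) : Prop :=
  Recognizable fun (M : MSC P A) (g : M.E → Γ × Δ) => ∀ e, (g e).2 = Φ M (fun e => (g e).1) e

theorem Recognizable.subst {Γ Δ : Type} [Finite Δ] {R : ∀ M : MSC P A, (M.E → Δ) → Prop}
    (h : Recognizable R) {Φ : ∀ M : MSC P A, (M.E → Γ) → M.E → Δ} (hΦ : IsTransduction Φ) :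
    Recognizable fun M g => R M (Φ M g) := by
  refine (ex (hΦ.and (h.comap fun _ (c : Γ × Δ) => c.2))).congr fun M g =>
    ⟨fun h => ⟨Φ M g, fun _ => rfl, h⟩, fun ⟨d, hd, h⟩ => ?_⟩
  rwa [← show d = Φ M g from funext hd]

namespace IsTransduction

variable {Γ Δ Θ : Type}

theorem congr {Φ Φ' : ∀ M : MSC P A, (M.E → Γ) → M.E → Δ} (h : IsTransduction Φ)
    (H : ∀ M g, Φ' M g = Φ M g) : IsTransduction Φ' := by
  obtain rfl : Φ' = Φ := funext fun M => funext fun g => H M g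
  exact h

theorem node (h : P → Γ → Δ) :
    IsTransduction fun (M : MSC P A) (g : M.E → Γ) e => h e.1 (g e) :=
  Recognizable.node fun p (c : Γ × Δ) => c.2 = h p c.1

theorem comp [Finite Δ] {Ψ : ∀ M : MSC P A, (M.E → Δ) → M.E → Θ}
    {Φ : ∀ M : MSC P A, (M.E → Γ) → M.E → Δ} (hΨ : IsTransduction Ψ) (hΦ : IsTransduction Φ) :
    IsTransduction fun M g => Ψ M (Φ M g) := by
  have h1 : Recognizable fun (M : MSC P A) (g : M.E → (Γ × Θ) × Δ) =>
      ∀ e, (g e).2 = Φ M (fun e => (g e).1.1) e :=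
    hΦ.comap fun _ (c : (Γ × Θ) × Δ) => (c.1.1, c.2)
  have h2 : Recognizable fun (M : MSC P A) (g : M.E → (Γ × Θ) × Δ) =>
      ∀ e, (g e).1.2 = Ψ M (fun e => (g e).2) e :=
    hΨ.comap fun _ (c : (Γ × Θ) × Δ) => (c.2, c.1.2)
  refine (Recognizable.ex (h1.and h2)).congr fun M g =>
    ⟨fun h => ⟨_, fun _ => rfl, h⟩, fun ⟨d, hd, h⟩ => ?_⟩
  rwa [show d = Φ M (fun e => (g e).1) from funext hd] at h

theorem pair {Φ : ∀ M : MSC P A, (M.E → Γ) → M.E → Δ} {Ψ : ∀ M : MSC P A, (M.E → Γ) → M.E → Θ}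
    (hΦ : IsTransduction Φ) (hΨ : IsTransduction Ψ) :
    IsTransduction fun M g e => (Φ M g e, Ψ M g e) :=
  ((hΦ.comap fun _ (c : Γ × Δ × Θ) => (c.1, c.2.1)).and
    (hΨ.comap fun _ (c : Γ × Δ × Θ) => (c.1, c.2.2))).congr fun M g => by
      simp only [Prod.ext_iff, forall_and]

theorem pi {ι : Type} [Finite ι] {Φ : ι → ∀ M : MSC P A, (M.E → Γ) → M.E → Δ}
    (h : ∀ i, IsTransduction (Φ i)) : IsTransduction fun M g e i => Φ i M g e :=
  (Recognizable.all fun i => (h i).comap fun _ (c : Γ × (ι → Δ)) => (c.1, c.2 i)).congr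
    fun M g => by
      simp only [funext_iff]
      exact forall_comm

theorem map [Finite Δ] {Φ : ∀ M : MSC P A, (M.E → Γ) → M.E → Δ} (hΦ : IsTransduction Φ)
    (h : P → Δ → Θ) : IsTransduction fun M g e => h e.1 (Φ M g e) :=
  (node h).comp hΦ

theorem id' : IsTransduction fun (M : MSC P A) (g : M.E → Γ) e => g e :=
  node fun _ c => c

/-- The disjunction of finitely many Boolean transductions. -/
theorem any {ι : Type*} [Finite ι] {Q : ι → ∀ M : MSC P A, (M.E → Γ) → M.E → Prop}
    [∀ i M g e, Decidable (Q i M g e)] [∀ M g e, Decidable (∃ i, Q i M g e)]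
    (h : ∀ i, IsTransduction fun M g e => decide (Q i M g e)) :
    IsTransduction fun M g e => decide (∃ i, Q i M g e) := by
  obtain ⟨n, ⟨σ⟩⟩ := Finite.exists_equiv_fin ι
  refine ((pi fun i : Fin n => h (σ.symm i)).map
    fun _ c => decide (∃ i, c i = true)).congr fun M g => funext fun e => ?_
  simp only [decide_eq_true_eq]
  rw [Bool.eq_iff_iff, decide_eq_true_eq, decide_eq_true_eq]
  exact σ.symm.surjective.exists

theorem next : IsTransduction fun (M : MSC P A) (g : M.E → Γ) e => (M.next e).map g := by
  refine (Recognizable.of_tiling { Tiling.triv with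
    step := fun _ (c d : Γ × Option Γ) => c.2 = some d.1
    fin := fun o => ∀ p c, o p = some c → c.2 = none }).congr fun M g => ?_
  beta_reduce
  constructor
  · intro h
    refine ⟨fun _ _ => trivial, fun e f hef => ?_, fun _ _ => trivial, fun _ _ _ => trivial, ?_⟩
    · simp only [h, MSC.next_eq_some.2 hef, Option.map_some]
    · intro p c hc
      obtain ⟨e, -, he, rfl⟩ := MSC.lastLabel_eq_some.1 hc
      rw [h, he, Option.map_none]
  · intro h e
    rcases he : M.next e with _ | f
    · exact h.fin e.1 (g e) (MSC.lastLabel_eq_some.2 ⟨e, rfl, he, rfl⟩)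
    · exact h.step e f (MSC.next_eq_some.1 he)

theorem prev : IsTransduction fun (M : MSC P A) (g : M.E → Γ) e => (M.prev e).map g := by
  refine (Recognizable.of_tiling { Tiling.triv with
    first := fun _ (c : Γ × Option Γ) => c.2 = none
    step := fun _ (c d : Γ × Option Γ) => d.2 = some c.1 }).congr fun M g => ?_
  beta_reduce
  constructor
  · intro h
    refine ⟨fun e he => ?_, fun e f hef => ?_, fun _ _ => trivial, fun _ _ _ => trivial, trivial⟩
    · simp only [h, he, Option.map_none]
    · simp only [h, MSC.prev_eq_some.2 hef, Option.map_some]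
  · intro h e
    rcases he : M.prev e with _ | f
    · exact h.first e he
    · exact h.step f e (MSC.prev_eq_some.1 he)

theorem snd : IsTransduction fun (M : MSC P A) (g : M.E → Γ) e => (M.snd e).map g := by
  refine (Recognizable.of_tiling { Tiling.triv with
    int := fun _ (c : Γ × Option Γ) => c.2 = none
    msg := fun _ (c : Γ × Option Γ) _ d => c.2 = some d.1 ∧ d.2 = none }).congr fun M g => ?_
  beta_reduce
  constructor
  · intro h
    refine ⟨fun _ _ => trivial, fun _ _ _ => trivial, fun e he => ?_, fun e f hef => ⟨?_, ?_⟩,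
      trivial⟩
    · simp only [h]
      rw [Option.map_eq_none_iff, Option.eq_none_iff_forall_ne_some]
      exact fun f hf => (he f).1 (MSC.snd_eq_some.1 hf)
    · simp only [h, MSC.snd_eq_some.2 hef, Option.map_some]
    · simp only [h]
      rw [Option.map_eq_none_iff, Option.eq_none_iff_forall_ne_some]
      intro f' hf'
      have := (M.msg_unique _ _ _ _ hef (MSC.snd_eq_some.1 hf') (by simp)).1
      exact M.msg_ne _ _ hef (congrArg _ this)
  · intro h e
    rcases he : M.snd e with _ | f
    · rw [Option.eq_none_iff_forall_ne_some] at he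
      by_cases hi : M.IsInternal e
      · exact h.int e hi
      · simp only [MSC.IsInternal, not_forall] at hi
        obtain ⟨f, hf⟩ := hi
        refine (h.msg f e ?_).2
        have := fun hc => he f (MSC.snd_eq_some.2 hc)
        tauto
    · exact (h.msg e f (MSC.snd_eq_some.1 he)).1

theorem rcv : IsTransduction fun (M : MSC P A) (g : M.E → Γ) e => (M.rcv e).map g := by
  refine (Recognizable.of_tiling { Tiling.triv with
    int := fun _ (c : Γ × Option Γ) => c.2 = none
    msg := fun _ (c : Γ × Option Γ) _ d => d.2 = some c.1 ∧ c.2 = none }).congr fun M g => ?_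
  beta_reduce
  constructor
  · intro h
    refine ⟨fun _ _ => trivial, fun _ _ _ => trivial, fun e he => ?_, fun e f hef => ⟨?_, ?_⟩,
      trivial⟩
    · simp only [h]
      rw [Option.map_eq_none_iff, Option.eq_none_iff_forall_ne_some]
      exact fun f hf => (he f).2 (MSC.rcv_eq_some.1 hf)
    · simp only [h, MSC.rcv_eq_some.2 hef, Option.map_some]
    · simp only [h]
      rw [Option.map_eq_none_iff, Option.eq_none_iff_forall_ne_some]
      intro f' hf'
      have := (M.msg_unique _ _ _ _ hef (MSC.rcv_eq_some.1 hf') (by simp)).1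
      exact M.msg_ne _ _ (MSC.rcv_eq_some.1 hf') (congrArg _ this.symm)
  · intro h e
    rcases he : M.rcv e with _ | f
    · rw [Option.eq_none_iff_forall_ne_some] at he
      by_cases hi : M.IsInternal e
      · exact h.int e hi
      · simp only [MSC.IsInternal, not_forall] at hi
        obtain ⟨f, hf⟩ := hi
        refine (h.msg e f ?_).2
        have := fun hc => he f (MSC.rcv_eq_some.2 hc)
        tauto
    · exact (h.msg f e (MSC.rcv_eq_some.1 he)).1

/-- Every event can be told the label of the first event of process `q`: the label is guessed,
passed on along each process, and the guesses are compared at the end. -/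
theorem firstOn (q : P) :
    IsTransduction fun (M : MSC P A) (g : M.E → Γ) _ => (M.firstOn q).map g := by
  refine (Recognizable.of_tiling { Tiling.triv with
    first := fun p (c : Γ × Option Γ) => p = q → c.2 = some c.1
    step := fun _ (c d : Γ × Option Γ) => c.2 = d.2
    fin := fun o => (∀ p p' c c', o p = some c → o p' = some c' → c.2 = c'.2) ∧
      (o q = none → ∀ p c, o p = some c → c.2 = none) }).congr fun M g => ?_
  beta_reduce
  constructor
  · intro h
    refine ⟨fun e he hq => ?_, fun e f _ => ?_, fun _ _ => trivial, fun _ _ _ => trivial, ?_, ?_⟩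
    · simp only [h, MSC.firstOn_eq_some.2 ⟨hq, MSC.prev_eq_none.1 he⟩, Option.map_some]
    · simp only [h]
    · intro p p' c c' hc hc'
      obtain ⟨e, -, -, rfl⟩ := MSC.lastLabel_eq_some.1 hc
      obtain ⟨f, -, -, rfl⟩ := MSC.lastLabel_eq_some.1 hc'
      rw [h, h]
    · intro hq p c hc
      obtain ⟨e, -, -, rfl⟩ := MSC.lastLabel_eq_some.1 hc
      rw [h, MSC.firstOn_eq_none.2 (MSC.lastLabel_eq_none.1 hq), Option.map_none]
  · intro h e
    have hconst : ∀ e f : M.E, e.1 = f.1 → (e.2 : ℕ) ≤ f.2 → (g e).2 = (g f).2 := by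
      intro e f hef hle
      have hr := MSC.reflTransGen_procEdge.2 ⟨hef, hle⟩
      induction hr with
      | refl => rfl
      | tail hr hs ih =>
        exact (ih (MSC.reflTransGen_procEdge.1 hr).1 (MSC.reflTransGen_procEdge.1 hr).2).trans
          (h.step _ _ hs)
    have hlast : ∀ e : M.E, ∃ c, M.lastLabel g e.1 = some c ∧ (g e).2 = c.2 := by
      intro e
      rcases hl : M.lastLabel g e.1 with _ | c
      · have h0 := MSC.lastLabel_eq_none.1 hl
        have h1 := e.2.2
        simp [h0] at h1
      · obtain ⟨f, hf, hn, rfl⟩ := MSC.lastLabel_eq_some.1 hl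
        refine ⟨_, rfl, hconst e f hf.symm ?_⟩
        have h1 := MSC.next_eq_none.1 hn
        have h2 := e.2.2
        have h3 : (M.word f.1).length = (M.word e.1).length := by rw [hf]
        omega
    obtain ⟨c, hc, hec⟩ := hlast e
    rcases hq : M.firstOn q with _ | f
    · rw [hec]
      exact h.fin.2 (MSC.lastLabel_eq_none.2 (MSC.firstOn_eq_none.1 hq)) _ _ hc
    · obtain ⟨d, hd, hfd⟩ := hlast f
      obtain ⟨h1, h2⟩ := MSC.firstOn_eq_some.1 hq
      rw [hec, h.fin.1 _ _ _ _ hc hd, ← hfd]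
      exact h.first f (MSC.prev_eq_none.2 h2) h1

end IsTransduction

/-! ### Transductions defined by recursion along the order -/

theorem Recognizable.loc {Γ : Type} [Finite Γ]
    (N : P → Γ → Option Γ → Option Γ → Option Γ → Option Γ → Prop) :
    Recognizable fun (M : MSC P A) (g : M.E → Γ) =>
      ∀ e, N e.1 (g e) ((M.next e).map g) ((M.snd e).map g) ((M.prev e).map g) ((M.rcv e).map g) :=
  (Recognizable.node fun p (c : Γ × Option Γ × Option Γ × Option Γ × Option Γ) =>
    N p c.1 c.2.1 c.2.2.1 c.2.2.2.1 c.2.2.2.2).subst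
    (IsTransduction.id'.pair (IsTransduction.next.pair (IsTransduction.snd.pair
      (IsTransduction.prev.pair IsTransduction.rcv))))

namespace IsTransduction

variable {Γ Δ : Type} [Finite P] [Finite Γ] [Finite Δ]

theorem of_future {Φ : ∀ M : MSC P A, (M.E → Γ) → M.E → Δ}
    (H : P → Γ → Option (Γ × Δ) → Option (Γ × Δ) → Δ)
    (hΦ : ∀ (M : MSC P A) g e, Φ M g e = H e.1 (g e) ((M.next e).map fun f => (g f, Φ M g f))
      ((M.snd e).map fun f => (g f, Φ M g f))) : IsTransduction Φ := by
  refine (Recognizable.loc fun p (c : Γ × Δ) n s _ _ => c.2 = H p c.1 n s).congr fun M g => ?_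
  constructor
  · intro h
    have hg : g = fun f => ((g f).1, Φ M (fun e => (g e).1) f) :=
      funext fun e => Prod.ext rfl (h e)
    intro e
    rw [h e, hΦ, ← hg]
  · intro h
    have hg : g = fun f => ((g f).1, Φ M (fun e => (g e).1) f) := by
      refine MSC.eq_of_future_rec (fun e n s => ((g e).1, H e.1 (g e).1 n s))
        (fun e => Prod.ext rfl (h e)) fun e => Prod.ext rfl (hΦ M _ e)
    exact fun e => (Prod.ext_iff.1 (congrFun hg e)).2

theorem of_past {Φ : ∀ M : MSC P A, (M.E → Γ) → M.E → Δ}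
    (H : P → Γ → Option (Γ × Δ) → Option (Γ × Δ) → Δ)
    (hΦ : ∀ (M : MSC P A) g e, Φ M g e = H e.1 (g e) ((M.prev e).map fun f => (g f, Φ M g f))
      ((M.rcv e).map fun f => (g f, Φ M g f))) : IsTransduction Φ := by
  refine (Recognizable.loc fun p (c : Γ × Δ) _ _ n s => c.2 = H p c.1 n s).congr fun M g => ?_
  constructor
  · intro h
    have hg : g = fun f => ((g f).1, Φ M (fun e => (g e).1) f) :=
      funext fun e => Prod.ext rfl (h e)
    intro e
    rw [h e, hΦ, ← hg]
  · intro h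
    have hg : g = fun f => ((g f).1, Φ M (fun e => (g e).1) f) := by
      refine MSC.eq_of_past_rec (fun e n s => ((g e).1, H e.1 (g e).1 n s))
        (fun e => Prod.ext rfl (h e)) fun e => Prod.ext rfl (hΦ M _ e)
    exact fun e => (Prod.ext_iff.1 (congrFun hg e)).2

end IsTransduction

namespace MSC

variable {M : MSC P A}

theorem lt_iff_head {e f : M.E} : M.lt e f ↔
    (∃ s, M.next e = some s ∧ (s = f ∨ M.lt s f)) ∨ ∃ s, M.snd e = some s ∧ (s = f ∨ M.lt s f) := by
  simp only [← le_iff, next_eq_some, snd_eq_some]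
  rw [lt, Relation.TransGen.head'_iff]
  constructor
  · rintro ⟨s, h | h, h'⟩
    exacts [Or.inl ⟨s, h, h'⟩, Or.inr ⟨s, h, h'⟩]
  · rintro (⟨s, h, h'⟩ | ⟨s, h, h'⟩)
    exacts [⟨s, Or.inl h, h'⟩, ⟨s, Or.inr h, h'⟩]

theorem lt_iff_tail {e f : M.E} : M.lt f e ↔
    (∃ s, M.prev e = some s ∧ (s = f ∨ M.lt f s)) ∨ ∃ s, M.rcv e = some s ∧ (s = f ∨ M.lt f s) := by
  simp only [@eq_comm _ _ f, ← le_iff, prev_eq_some, rcv_eq_some]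
  rw [lt, Relation.TransGen.tail'_iff]
  constructor
  · rintro ⟨s, h', h | h⟩
    exacts [Or.inl ⟨s, h, h'⟩, Or.inr ⟨s, h, h'⟩]
  · rintro (⟨s, h, h'⟩ | ⟨s, h, h'⟩)
    exacts [⟨s, h', Or.inl h⟩, ⟨s, h', Or.inr h⟩]

theorem before_iff_head {e f : M.E} : Before e f ↔
    ∃ s, M.next e = some s ∧ (s = f ∨ Before s f) := by
  simp only [next_eq_some]
  rw [← transGen_procEdge, Relation.TransGen.head'_iff]
  refine exists_congr fun s => and_congr_right fun _ => ?_
  rw [Relation.reflTransGen_iff_eq_or_transGen, transGen_procEdge, eq_comm]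

theorem before_iff_tail {e f : M.E} : Before f e ↔
    ∃ s, M.prev e = some s ∧ (s = f ∨ Before f s) := by
  simp only [prev_eq_some]
  rw [← transGen_procEdge, Relation.TransGen.tail'_iff]
  refine exists_congr fun s => and_comm.trans (and_congr_right fun _ => ?_)
  rw [Relation.reflTransGen_iff_eq_or_transGen, transGen_procEdge]

/-- The next event after `e` on the process of `e` that lies in `X`. -/
noncomputable def nextIn (M : MSC P A) (X : M.E → Bool) : M.E → Option M.E :=
  pfun fun e f => Before e f ∧ X f = true ∧ ∀ g, Before e g → X g = true → ¬ Before g f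

/-- The last event before `e` on the process of `e` that lies in `X`. -/
noncomputable def prevIn (M : MSC P A) (X : M.E → Bool) : M.E → Option M.E :=
  pfun fun e f => Before f e ∧ X f = true ∧ ∀ g, Before g e → X g = true → ¬ Before f g

theorem nextIn_eq_some {X : M.E → Bool} {e f : M.E} : M.nextIn X e = some f ↔
    Before e f ∧ X f = true ∧ ∀ g, Before e g → X g = true → ¬ Before g f := by
  refine pfun_eq_some fun _ f f' h h' => ?_
  rcases before_trichotomy (h.1.1.symm.trans h'.1.1) with hf | hf | hf
  · exact absurd hf (h'.2.2 _ h.1 h.2.1)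
  · exact hf
  · exact absurd hf (h.2.2 _ h'.1 h'.2.1)

theorem prevIn_eq_some {X : M.E → Bool} {e f : M.E} : M.prevIn X e = some f ↔
    Before f e ∧ X f = true ∧ ∀ g, Before g e → X g = true → ¬ Before f g := by
  refine pfun_eq_some fun _ f f' h h' => ?_
  rcases before_trichotomy (h.1.1.trans h'.1.1.symm) with hf | hf | hf
  · exact absurd hf (h.2.2 _ h'.1 h'.2.1)
  · exact hf
  · exact absurd hf (h'.2.2 _ h.1 h.2.1)

theorem Before.asymm {e f : M.E} (h : Before e f) : ¬ Before f e := fun h' => h.2.asymm h'.2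

theorem not_before_self {e : M.E} : ¬ Before e e := fun h => h.2.ne rfl

theorem before_of_prev {e f : M.E} (h : M.prev e = some f) : Before f e :=
  before_iff_tail.2 ⟨f, h, Or.inl rfl⟩

theorem nextIn_rec (X : M.E → Bool) (e : M.E) :
    M.nextIn X e = (M.next e).bind fun f => if X f then some f else M.nextIn X f := by
  ext f
  rcases hn : M.next e with _ | s
  · simp only [nextIn_eq_some, Option.bind_none, reduceCtorEq, iff_false]
    rintro ⟨h, -⟩
    obtain ⟨s, hs, -⟩ := before_iff_head.1 h
    simp [hn] at hs
  · have hb : ∀ g, Before e g ↔ s = g ∨ Before s g := by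
      intro g
      rw [before_iff_head, hn]
      simp
    simp only [Option.bind_some, nextIn_eq_some, hb]
    by_cases hX : X s
    · simp only [hX, if_true, Option.some_inj]
      constructor
      · rintro ⟨h | h, h', h''⟩
        · exact h
        · exact absurd h (h'' s (Or.inl rfl) hX)
      · rintro rfl
        exact ⟨Or.inl rfl, hX, by rintro g (rfl | h) _ h'; exacts [not_before_self h', h.asymm h']⟩
    · simp only [hX, Bool.false_eq_true, if_false, nextIn_eq_some]
      constructor
      · rintro ⟨rfl | h, h', h''⟩
        · exact absurd h' hX
        · exact ⟨h, h', fun g hg => h'' g (Or.inr hg)⟩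
      · rintro ⟨h, h', h''⟩
        refine ⟨Or.inr h, h', ?_⟩
        rintro g (rfl | hg) hXg
        · exact absurd hXg hX
        · exact h'' g hg hXg

theorem prevIn_rec (X : M.E → Bool) (e : M.E) :
    M.prevIn X e = (M.prev e).bind fun f => if X f then some f else M.prevIn X f := by
  ext f
  rcases hn : M.prev e with _ | s
  · simp only [prevIn_eq_some, Option.bind_none, reduceCtorEq, iff_false]
    rintro ⟨h, -⟩
    obtain ⟨s, hs, -⟩ := before_iff_tail.1 h
    simp [hn] at hs
  · have hb : ∀ g, Before g e ↔ s = g ∨ Before g s := by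
      intro g
      rw [before_iff_tail, hn]
      simp
    simp only [Option.bind_some, prevIn_eq_some, hb]
    by_cases hX : X s
    · simp only [hX, if_true, Option.some_inj]
      constructor
      · rintro ⟨h | h, h', h''⟩
        · exact h
        · exact absurd h (h'' s (Or.inl rfl) hX)
      · rintro rfl
        exact ⟨Or.inl rfl, hX, by rintro g (rfl | h) _ h'; exacts [not_before_self h', h.asymm h']⟩
    · simp only [hX, Bool.false_eq_true, if_false, prevIn_eq_some]
      constructor
      · rintro ⟨rfl | h, h', h''⟩
        · exact absurd h' hX
        · exact ⟨h, h', fun g hg => h'' g (Or.inr hg)⟩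
      · rintro ⟨h, h', h''⟩
        refine ⟨Or.inr h, h', ?_⟩
        rintro g (rfl | hg) hXg
        · exact absurd hXg hX
        · exact h'' g hg hXg

end MSC

namespace IsTransduction

open Classical in
theorem future [Finite P] : IsTransduction fun (M : MSC P A) (X : M.E → Bool) e =>
    decide (∃ f, M.lt e f ∧ X f = true) := by
  refine of_future (fun _ _ n s => n.any (fun c => c.1 || c.2) || s.any fun c => c.1 || c.2)
    fun M X e => ?_
  rw [Bool.eq_iff_iff]
  simp only [decide_eq_true_eq, Bool.or_eq_true, Option.any_map,
    Option.any_eq_true]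
  constructor
  · rintro ⟨f, hf, hX⟩
    rcases MSC.lt_iff_head.1 hf with ⟨s, hs, h⟩ | ⟨s, hs, h⟩
    · refine Or.inl ⟨s, hs, ?_⟩
      rcases h with rfl | h
      exacts [Or.inl hX, Or.inr ⟨f, h, hX⟩]
    · refine Or.inr ⟨s, hs, ?_⟩
      rcases h with rfl | h
      exacts [Or.inl hX, Or.inr ⟨f, h, hX⟩]
  · rintro (⟨s, hs, h | ⟨f, h, hX⟩⟩ | ⟨s, hs, h | ⟨f, h, hX⟩⟩)
    · exact ⟨s, MSC.lt_iff_head.2 (Or.inl ⟨s, hs, Or.inl rfl⟩), h⟩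
    · exact ⟨f, MSC.lt_iff_head.2 (Or.inl ⟨s, hs, Or.inr h⟩), hX⟩
    · exact ⟨s, MSC.lt_iff_head.2 (Or.inr ⟨s, hs, Or.inl rfl⟩), h⟩
    · exact ⟨f, MSC.lt_iff_head.2 (Or.inr ⟨s, hs, Or.inr h⟩), hX⟩

open Classical in
theorem past [Finite P] : IsTransduction fun (M : MSC P A) (X : M.E → Bool) e =>
    decide (∃ f, M.lt f e ∧ X f = true) := by
  refine of_past (fun _ _ n s => n.any (fun c => c.1 || c.2) || s.any fun c => c.1 || c.2)
    fun M X e => ?_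
  rw [Bool.eq_iff_iff]
  simp only [decide_eq_true_eq, Bool.or_eq_true, Option.any_map,
    Option.any_eq_true]
  constructor
  · rintro ⟨f, hf, hX⟩
    rcases MSC.lt_iff_tail.1 hf with ⟨s, hs, h⟩ | ⟨s, hs, h⟩
    · refine Or.inl ⟨s, hs, ?_⟩
      rcases h with rfl | h
      exacts [Or.inl hX, Or.inr ⟨f, h, hX⟩]
    · refine Or.inr ⟨s, hs, ?_⟩
      rcases h with rfl | h
      exacts [Or.inl hX, Or.inr ⟨f, h, hX⟩]
  · rintro (⟨s, hs, h | ⟨f, h, hX⟩⟩ | ⟨s, hs, h | ⟨f, h, hX⟩⟩)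
    · exact ⟨s, MSC.lt_iff_tail.2 (Or.inl ⟨s, hs, Or.inl rfl⟩), h⟩
    · exact ⟨f, MSC.lt_iff_tail.2 (Or.inl ⟨s, hs, Or.inr h⟩), hX⟩
    · exact ⟨s, MSC.lt_iff_tail.2 (Or.inr ⟨s, hs, Or.inl rfl⟩), h⟩
    · exact ⟨f, MSC.lt_iff_tail.2 (Or.inr ⟨s, hs, Or.inr h⟩), hX⟩

variable {Γ C : Type} [Finite P] [Finite C]

theorem nextIn : IsTransduction fun (M : MSC P A) (g : M.E → Bool × C) e =>
    (M.nextIn (fun e => (g e).1) e).map fun e => (g e).2 := by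
  refine of_future (fun _ _ n _ => n.bind fun c => if c.1.1 then some c.1.2 else c.2)
    fun M g e => ?_
  rw [MSC.nextIn_rec]
  rcases M.next e with _ | s
  · rfl
  · simp only [Option.bind_some, Option.map_some]
    split_ifs <;> rfl

theorem prevIn : IsTransduction fun (M : MSC P A) (g : M.E → Bool × C) e =>
    (M.prevIn (fun e => (g e).1) e).map fun e => (g e).2 := by
  refine of_past (fun _ _ n _ => n.bind fun c => if c.1.1 then some c.1.2 else c.2)
    fun M g e => ?_
  rw [MSC.prevIn_rec]
  rcases M.prev e with _ | s
  · rfl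
  · simp only [Option.bind_some, Option.map_some]
    split_ifs <;> rfl

end IsTransduction

/-! ### Certifying the sign of a monotone map -/

namespace SignCert

/-- The condition on the label `(k, b)` of `e`, the colour `pc` of the last fixed point before `e`
and the label `d` of the value of `D` at `e`. -/
def Check (k : Ordering) (b : Bool) (pc : Option Bool) (d : Option (Option (Ordering × Bool))) :
    Prop :=
  match k with
  | .eq => ∃ c, d = some (some c) ∧ c.1 = .eq ∧ c.2 = b ∧ pc ≠ some b
  | .gt => d = none ∨ ∃ c, d = some (some c) ∧ (c.1 = .gt ∧ c.2 ≠ b ∨ c.1 = .eq ∧ pc ≠ some c.2)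
  | .lt => d = some none ∨
      ∃ c, d = some (some c) ∧ (c.1 = .lt ∧ c.2 ≠ b ∨ c.1 = .eq ∧ pc = some c.2)

variable {E : Type*}

/-- The position of an extended value in the chain with positions `0, …, B - 1`, shifted by one:
`some none` is below and `none` above all events. -/
def rank (pos : E → ℕ) (B : ℕ) : Option (Option E) → ℕ
  | none => B + 2
  | some none => 0
  | some (some d) => pos d + 1

theorem rank_top (pos : E → ℕ) (B : ℕ) : rank pos B none = B + 2 := rfl

theorem rank_bot (pos : E → ℕ) (B : ℕ) : rank pos B (some none) = 0 := rfl

theorem rank_val (pos : E → ℕ) (B : ℕ) (d : E) : rank pos B (some (some d)) = pos d + 1 := rfl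

/-- `pv` maps each event of the chain `S` to the last event before it of class `eq`. -/
structure IsPrev (S : Set E) (pos : E → ℕ) (cls : E → Ordering) (pv : E → Option E) : Prop where
  mem : ∀ e ∈ S, ∀ k, pv e = some k → k ∈ S
  lt : ∀ e ∈ S, ∀ k, pv e = some k → pos k < pos e
  eq : ∀ e ∈ S, ∀ k, pv e = some k → cls k = .eq
  between : ∀ e ∈ S, ∀ k, pv e = some k → ∀ m ∈ S, pos m < pos e → cls m = .eq → pos m ≤ pos k
  none : ∀ e ∈ S, pv e = none → ∀ m ∈ S, pos m < pos e → cls m ≠ .eq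

/-- A chain with a monotone map to its extension by a least and a greatest element. -/
structure MonoMap (S : Set E) (pos : E → ℕ) (B : ℕ) (D : E → Option (Option E)) : Prop where
  inj : ∀ e ∈ S, ∀ f ∈ S, pos e = pos f → e = f
  bound : ∀ e, pos e < B
  mem : ∀ e ∈ S, ∀ d, D e = some (some d) → d ∈ S
  mono : ∀ e ∈ S, ∀ f ∈ S, pos e ≤ pos f → rank pos B (D e) ≤ rank pos B (D f)

section

variable {S : Set E} {pos : E → ℕ} {B : ℕ} {D : E → Option (Option E)} {pv : E → Option E}
  {cls : E → Ordering} {col : E → Bool}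

/-- Labels that pass the check describe the sign of `D` correctly. If a labelled fixed point were
moved, then, as fixed points alternate their colours, so would be its image, in the same direction,
and this would go on for ever; a wrong strict sign leads to a similar contradiction. -/
theorem sign_of_check (hD : MonoMap S pos B D) (hp : IsPrev S pos cls pv)
    (H : ∀ e ∈ S, Check (cls e) (col e) ((pv e).map col)
      ((D e).map (Option.map fun d => (cls d, col d)))) (e : E) (he : e ∈ S) :
    cls e ≠ .lt ↔ pos e + 1 ≤ rank pos B (D e) := by
  have hval : ∀ e ∈ S, ∀ c, (D e).map (Option.map fun d => (cls d, col d)) = some (some c) →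
      ∃ d ∈ S, D e = some (some d) ∧ c = (cls d, col d) := by
    intro e he c hc
    rcases h : D e with _ | _ | d
    · simp [h] at hc
    · simp [h] at hc
    · simp only [h, Option.map_some, Option.some_inj] at hc
      exact ⟨d, hD.mem e he d h, rfl, hc.symm⟩
  have heq : ∀ e ∈ S, cls e = .eq → ∃ d ∈ S, D e = some (some d) ∧ cls d = .eq ∧ col d = col e ∧
      (pv e).map col ≠ some (col e) := by
    intro e he hc
    have := H e he
    rw [hc] at this
    obtain ⟨c, hc1, hc2, hc3, hc4⟩ := this
    obtain ⟨d, hd, hd', rfl⟩ := hval e he c hc1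
    exact ⟨d, hd, hd', hc2, hc3, hc4⟩
  have hprev : ∀ e ∈ S, ∀ m ∈ S, pos m < pos e → cls m = .eq → ∃ k ∈ S, pv e = some k ∧
      pos m ≤ pos k ∧ pos k < pos e ∧ cls k = .eq := by
    intro e he m hm hme hmc
    rcases h : pv e with _ | k
    · exact absurd hmc (hp.none e he h m hm hme)
    · exact ⟨k, hp.mem e he k h, rfl, hp.between e he k h m hm hme hmc, hp.lt e he k h,
        hp.eq e he k h⟩
  have hmono : ∀ e ∈ S, ∀ f ∈ S, ∀ d d', D e = some (some d) → D f = some (some d') →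
      pos e ≤ pos f → pos d ≤ pos d' := by
    intro e he f hf d d' hd hd' hle
    have := hD.mono e he f hf hle
    simp only [hd, hd', rank_val] at this
    omega
  -- If an event of class `eq` is moved upwards, so is its image `d`: the last event of class `eq`
  -- before `d` has another colour than `d`, so it lies strictly between the two, and is itself
  -- moved strictly above `d`.
  have hup : ∀ n, ∀ e ∈ S, ∀ d, cls e = .eq → D e = some (some d) → pos e < pos d →
      B - pos e = n → False := by
    intro n
    induction n using Nat.strong_induction_on with
    | _ n ih =>
      intro e he d hc hd hlt hn
      obtain ⟨d', hd'S, hd', hdc, hcol, -⟩ := heq e he hc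
      obtain rfl : d = d' := by simpa [hd] using hd'
      obtain ⟨d2, hd2S, hd2, -, -, hpc⟩ := heq d hd'S hdc
      obtain ⟨k, hkS, hk, h1, h2, hkc⟩ := hprev d hd'S e he hlt hc
      simp only [hk, Option.map_some, ne_eq, Option.some_inj] at hpc
      have hek : pos e < pos k := lt_of_le_of_ne h1 fun h => hpc (by
        rw [← hD.inj e he k hkS h, hcol])
      obtain ⟨k', hk'S, hk', -, hkcol, -⟩ := heq k hkS hkc
      have h3 := hmono e he k hkS d k' hd hk' hek.le
      have h4 := hmono k hkS d hd'S k' d2 hk' hd2 h2.le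
      have h5 : pos d < pos k' := lt_of_le_of_ne h3 fun h => hpc (by
        rw [← hkcol, hD.inj d hd'S k' hk'S h])
      have := hD.bound d
      exact ih (B - pos d) (by omega) d hd'S d2 hdc hd2 (by omega) rfl
  -- The same downwards; here the descent is along positions.
  have hdown : ∀ n, ∀ e ∈ S, ∀ d, cls e = .eq → D e = some (some d) → pos d < pos e →
      pos e = n → False := by
    intro n
    induction n using Nat.strong_induction_on with
    | _ n ih =>
      intro e he d hc hd hlt hn
      obtain ⟨d', hd'S, hd', hdc, hcol, hpc⟩ := heq e he hc
      obtain rfl : d = d' := by simpa [hd] using hd'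
      obtain ⟨d2, hd2S, hd2, -, -, -⟩ := heq d hd'S hdc
      obtain ⟨k, hkS, hk, h1, h2, hkc⟩ := hprev e he d hd'S hlt hdc
      simp only [hk, Option.map_some, ne_eq, Option.some_inj] at hpc
      have hdk : pos d < pos k := lt_of_le_of_ne h1 fun h => hpc (by
        rw [← hD.inj d hd'S k hkS h, hcol])
      obtain ⟨k', hk'S, hk', -, hkcol, -⟩ := heq k hkS hkc
      have h3 := hmono k hkS e he k' d hk' hd h2.le
      have h4 := hmono d hd'S k hkS d2 k' hd2 hk' hdk.le
      have h5 : pos k' < pos d := lt_of_le_of_ne h3 fun h => hpc (by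
        rw [← hcol, ← hD.inj k' hk'S d hd'S h, hkcol])
      exact ih (pos d) (by omega) d hd'S d2 hdc hd2 (by omega) rfl
  have hfix : ∀ e ∈ S, cls e = .eq → D e = some (some e) := by
    intro e he hc
    obtain ⟨d, hdS, hd, -⟩ := heq e he hc
    rcases Nat.lt_trichotomy (pos e) (pos d) with h | h | h
    · exact (hup _ e he d hc hd h rfl).elim
    · rw [hd, hD.inj e he d hdS h]
    · exact (hdown _ e he d hc hd h rfl).elim
  -- If an event of class `gt` is moved downwards to an event of class `gt`, then that event is
  -- moved downwards as well, by monotonicity. An image that is a fixed point is not the last one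
  -- before the event, and the last one lies strictly above the image, against monotonicity.
  have hgt : ∀ n, ∀ e ∈ S, cls e = .gt → pos e = n → pos e + 1 < rank pos B (D e) := by
    intro n
    induction n using Nat.strong_induction_on with
    | _ n ih =>
      intro e he hc hn
      by_contra hcon
      have hch := H e he
      rw [hc] at hch
      rcases hch with h | ⟨c, h, hor⟩
      · rw [Option.map_eq_none_iff] at h
        have := hD.bound e
        simp only [h, rank_top] at hcon
        omega
      · obtain ⟨d, hdS, hd, rfl⟩ := hval e he c h
        simp only [hd, rank_val] at hcon
        have hne : pos d ≠ pos e := by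
          intro h
          obtain rfl := hD.inj d hdS e he h
          simp [hc] at hor
        have hlt : pos d < pos e := by omega
        rcases hor with ⟨hdc, -⟩ | ⟨hdc, hpc⟩
        · have h1 := ih (pos d) (by omega) d hdS hdc rfl
          have h2 := hD.mono d hdS e he hlt.le
          simp only [hd, rank_val] at h2
          omega
        · obtain ⟨k, hkS, hk, h1, h2, hkc⟩ := hprev e he d hdS hlt hdc
          simp only [hk, Option.map_some, ne_eq, Option.some_inj] at hpc
          have h3 := hmono k hkS e he k d (hfix k hkS hkc) hd h2.le
          exact hpc (by rw [hD.inj d hdS k hkS (by omega)])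
  -- If an event of class `lt` is moved upwards to a fixed point `d`, then `d` has the colour of the
  -- last fixed point before the event. As colours alternate, there is a fixed point between the
  -- event and `d`, against monotonicity.
  have hlt : ∀ n, ∀ e ∈ S, cls e = .lt → B - pos e = n → rank pos B (D e) < pos e + 1 := by
    intro n
    induction n using Nat.strong_induction_on with
    | _ n ih =>
      intro e he hc hn
      by_contra hcon
      have hch := H e he
      rw [hc] at hch
      rcases hch with h | ⟨c, h, hor⟩
      · have h' : D e = some none := by
          rcases h' : D e with _ | _ | d <;> simp [h'] at h ⊢
        simp only [h', rank_bot] at hcon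
        omega
      · obtain ⟨d, hdS, hd, rfl⟩ := hval e he c h
        simp only [hd, rank_val] at hcon
        have hne : pos d ≠ pos e := by
          intro h
          obtain rfl := hD.inj d hdS e he h
          simp [hc] at hor
        have hlt : pos e < pos d := by omega
        have hb := hD.bound d
        rcases hor with ⟨hdc, -⟩ | ⟨hdc, hpc⟩
        · have h1 := ih (B - pos d) (by omega) d hdS hdc rfl
          have h2 := hD.mono e he d hdS hlt.le
          simp only [hd, rank_val] at h2
          omega
        · rcases hk : pv e with _ | k
          · simp [hk] at hpc
          simp only [hk, Option.map_some, Option.some_inj] at hpc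
          have hkS := hp.mem e he k hk
          have hkc := hp.eq e he k hk
          have hke := hp.lt e he k hk
          obtain ⟨-, -, -, -, -, hpd⟩ := heq d hdS hdc
          obtain ⟨k', hk'S, hk', h1, h2, hk'c⟩ := hprev d hdS k hkS (by omega) hkc
          simp only [hk', Option.map_some, ne_eq, Option.some_inj] at hpd
          have h3 : pos k ≠ pos k' := fun h => hpd (by rw [← hpc, hD.inj k hkS k' hk'S h])
          have h4 : pos e ≤ pos k' := by
            by_contra hcon'
            have := hp.between e he k hk k' hk'S (by omega) hk'c
            omega
          have := hmono e he k' hk'S d k' hd (hfix k' hk'S hk'c) h4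
          omega
  constructor
  · intro hne
    rcases h : cls e with _ | _ | _
    · exact absurd h hne
    · simp [hfix e he h, rank_val]
    · exact (hgt _ e he h rfl).le
  · intro hle hc
    have := hlt _ e he hc rfl
    omega

/-- Two-colouring of a terminating partial function. -/
theorem exists_alternating (f : E → Option E) (m : E → ℕ) (hm : ∀ e d, f e = some d → m d < m e) :
    ∃ col : E → Bool, ∀ e d, f e = some d → col d ≠ col e := by
  have hwf : WellFounded fun d e => f e = some d :=
    Subrelation.wf (fun {d e} h => hm e d h) (measure m).wf
  refine ⟨hwf.fix fun e ih => match h : f e with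
    | none => true
    | some d => !(ih d h), fun e d h => ?_⟩
  rw [hwf.fix_eq _ e]
  split
  · simp_all
  · next d' h' =>
    obtain rfl : d = d' := by simpa [h] using h'
    simp

/-- The correct signs can be completed to labels that pass the check: it remains to colour fixed
points alternately along the chain, and the other events alternately along the orbits of `D`. -/
theorem exists_check (hD : MonoMap S pos B D)
    (hcls : ∀ e, cls e = compare (rank pos B (D e)) (pos e + 1)) (hp : IsPrev S pos cls pv) :
    ∃ col : E → Bool, ∀ e ∈ S, Check (cls e) (col e) ((pv e).map col)
      ((D e).map (Option.map fun d => (cls d, col d))) := by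
  classical
  -- the next element of the same class in the orbit of `D`, or the previous fixed point
  let f : E → Option E := fun e =>
    if e ∈ S then
      if cls e = .eq then pv e else ((D e).getD none).filter fun d => cls d = cls e
    else none
  let m : E → ℕ := fun e => if cls e = .gt then B - pos e else pos e
  have hlt : ∀ e, cls e = .lt ↔ rank pos B (D e) < pos e + 1 := fun e => by
    rw [hcls, compare_lt_iff_lt]
  have heq : ∀ e, cls e = .eq ↔ rank pos B (D e) = pos e + 1 := fun e => by
    rw [hcls, compare_eq_iff_eq]
  have hgt : ∀ e, cls e = .gt ↔ pos e + 1 < rank pos B (D e) := fun e => by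
    rw [hcls, compare_gt_iff_gt]
  obtain ⟨col, hcol⟩ := exists_alternating f m (by
    intro e d h
    have hb := hD.bound d
    have hb' := hD.bound e
    by_cases he : e ∈ S
    swap
    · simp [f, he] at h
    by_cases hc : cls e = .eq
    · simp only [f, he, hc, if_true] at h
      have h1 := hp.lt e he d h
      have h2 := hp.eq e he d h
      simpa [m, hc, h2] using h1
    · simp only [f, he, hc, if_true, if_false, Option.filter_eq_some_iff, decide_eq_true_eq] at h
      obtain ⟨h, hdc⟩ := h
      have hDe : D e = some (some d) := by
        rcases h' : D e with _ | _ | d' <;> simp [h'] at h ⊢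
        exact h
      simp only [m, hdc]
      rcases hk : cls e with _ | _ | _
      · have := (hlt e).1 hk
        simp only [hDe, rank_val] at this
        simp only [reduceCtorEq, if_false]
        omega
      · exact absurd hk hc
      · have := (hgt e).1 hk
        simp only [hDe, rank_val] at this
        simp only [if_true]
        omega)
  refine ⟨col, fun e he => ?_⟩
  rcases hk : cls e with _ | _ | _
  · rcases hd : D e with _ | _ | d
    · have := (hlt e).1 hk
      have := hD.bound e
      simp only [hd, rank_top] at *
      omega
    · exact Or.inl rfl
    · right
      refine ⟨_, rfl, ?_⟩
      have h1 := (hlt e).1 hk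
      have hdS := hD.mem e he d hd
      have hm := hD.mono d hdS e he (by simp only [hd, rank_val] at h1; omega)
      simp only [hd, rank_val] at h1 hm
      rcases hdk : cls d with _ | _ | _
      · exact Or.inl ⟨hdk, hcol e d (by simp [f, he, hk, hd, hdk])⟩
      · right
        refine ⟨hdk, ?_⟩
        rcases hpv : pv e with _ | k
        · exact absurd hdk (hp.none e he hpv d hdS (by omega))
        · have hkS := hp.mem e he k hpv
          have hke := hp.lt e he k hpv
          have h2 := hp.between e he k hpv d hdS (by omega) hdk
          have h3 := (heq k).1 (hp.eq e he k hpv)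
          have h4 := hD.mono k hkS e he hke.le
          simp only [hd, rank_val] at h4
          rw [hD.inj d hdS k hkS (by omega)]
          rfl
      · have := (hgt d).1 hdk
        omega
  · have h1 := (heq e).1 hk
    rcases hd : D e with _ | _ | d
    · have := hD.bound e
      simp only [hd, rank_top] at *
      omega
    · simp only [hd, rank_bot] at *
      omega
    · simp only [hd, rank_val] at h1
      obtain rfl := hD.inj d (hD.mem e he d hd) e he (by omega)
      refine ⟨_, rfl, hk, rfl, ?_⟩
      rcases hpv : pv d with _ | k
      · simp
      · simpa using hcol d k (by simp [f, he, hk, hpv])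
  · rcases hd : D e with _ | _ | d
    · exact Or.inl rfl
    · have := (hgt e).1 hk
      simp only [hd, rank_bot] at *
      omega
    · right
      refine ⟨_, rfl, ?_⟩
      have h1 := (hgt e).1 hk
      have hdS := hD.mem e he d hd
      have hm := hD.mono e he d hdS (by simp only [hd, rank_val] at h1; omega)
      simp only [hd, rank_val] at h1 hm
      rcases hdk : cls d with _ | _ | _
      · have := (hlt d).1 hdk
        omega
      · right
        refine ⟨hdk, ?_⟩
        rcases hpv : pv e with _ | k
        · simp
        -- `k` is also the last fixed point before `d`
        have hkS := hp.mem e he k hpv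
        have hke := hp.lt e he k hpv
        have hkc := hp.eq e he k hpv
        rcases hpd : pv d with _ | k'
        · exact absurd hkc (hp.none d hdS hpd k hkS (by omega))
        have hk'S := hp.mem d hdS k' hpd
        have hk'd := hp.lt d hdS k' hpd
        have hk'c := hp.eq d hdS k' hpd
        have h2 := hp.between d hdS k' hpd k hkS (by omega) hkc
        have h3 : pos k' < pos e := by
          by_contra hcon
          have h4 := hD.mono e he k' hk'S (by omega)
          have h5 := (heq k').1 hk'c
          simp only [hd, rank_val] at h4
          omega
        have h4 := hp.between e he k hpv k' hk'S h3 hk'c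
        obtain rfl := hD.inj k hkS k' hk'S (by omega)
        simpa using hcol d k (by simp [f, hdS, hdk, hpd])
      · exact Or.inl ⟨hdk, hcol e d (by simp [f, he, hk, hd, hdk])⟩

end

end SignCert

/-! ### Latest events reached along paths -/

namespace MSC

variable {M : MSC P A}

theorem exists_nextIn {X : M.E → Bool} {e f : M.E} (h : Before e f) (hX : X f = true) :
    ∃ g, M.nextIn X e = some g ∧ (g.2 : ℕ) ≤ f.2 := by
  obtain ⟨g, ⟨h1, h2⟩, h3⟩ := WellFounded.has_min (measure fun f : M.E => (f.2 : ℕ)).wf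
    {f | Before e f ∧ X f = true} ⟨f, h, hX⟩
  refine ⟨g, nextIn_eq_some.2 ⟨h1, h2, fun k hk hXk hkg => h3 k ⟨hk, hXk⟩ hkg.2⟩, ?_⟩
  exact not_lt.1 (h3 f ⟨h, hX⟩)

theorem exists_prevIn {X : M.E → Bool} {e f : M.E} (h : Before f e) (hX : X f = true) :
    ∃ g, M.prevIn X e = some g ∧ (f.2 : ℕ) ≤ g.2 := by
  obtain ⟨g, ⟨h1, h2⟩, h3⟩ := WellFounded.has_min (measure fun f : M.E => (e.2 : ℕ) - f.2).wf
    {f | Before f e ∧ X f = true} ⟨f, h, hX⟩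
  have key : ∀ k, Before k e → X k = true → (k.2 : ℕ) ≤ g.2 := by
    intro k hk hXk
    have : ¬ ((e.2 : ℕ) - k.2 < e.2 - g.2) := h3 k ⟨hk, hXk⟩
    have := hk.2
    omega
  exact ⟨g, prevIn_eq_some.2 ⟨h1, h2, fun k hk hXk hkg => absurd hkg.2 (key k hk hXk).not_gt⟩,
    key f h hX⟩

/-- The last event up to `e` on the process of `e` that lies in `X`. -/
noncomputable def lastIn (M : MSC P A) (X : M.E → Bool) (e : M.E) : Option M.E :=
  if X e then some e else M.prevIn X e

theorem lastIn_mem {X : M.E → Bool} {e g : M.E} (h : M.lastIn X e = some g) :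
    g.1 = e.1 ∧ (g.2 : ℕ) ≤ e.2 ∧ X g = true := by
  unfold lastIn at h
  split_ifs at h with hX
  · obtain rfl := Option.some_inj.1 h
    exact ⟨rfl, _root_.le_refl _, hX⟩
  · obtain ⟨h1, h2, -⟩ := prevIn_eq_some.1 h
    exact ⟨h1.1, h1.2.le, h2⟩

theorem exists_lastIn {X : M.E → Bool} {e f : M.E} (h : f.1 = e.1) (h' : (f.2 : ℕ) ≤ e.2)
    (hX : X f = true) : ∃ g, M.lastIn X e = some g ∧ (f.2 : ℕ) ≤ g.2 := by
  unfold lastIn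
  split_ifs with hXe
  · exact ⟨e, rfl, h'⟩
  · rcases h'.lt_or_eq with h' | h'
    · exact exists_prevIn ⟨h, h'⟩ hX
    · obtain rfl := event_ext h h'
      exact absurd hX hXe

open Classical in
/-- The receive events whose message comes from process `r`. -/
noncomputable def recvFrom (M : MSC P A) (r : P) (g : M.E) : Bool :=
  (M.rcv g).any fun f => f.1 = r

/-- The send event that matches the last event up to `e` on the process of `e` that receives from
process `r`. -/
noncomputable def back (r : P) (M : MSC P A) (e : M.E) : Option M.E :=
  (M.lastIn (M.recvFrom r) e).bind M.rcv

theorem recvFrom_iff {r : P} {g : M.E} : M.recvFrom r g = true ↔ ∃ f, M.msg f g ∧ f.1 = r := by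
  simp only [recvFrom, Option.any_eq_true, rcv_eq_some, decide_eq_true_eq]

theorem back_mem {r : P} {e f : M.E} (h : back r M e = some f) : f.1 = r ∧ M.lt f e := by
  obtain ⟨g, hg, hf⟩ := Option.bind_eq_some_iff.1 h
  obtain ⟨h1, h2, h3⟩ := lastIn_mem hg
  obtain ⟨f', hf', rfl⟩ := recvFrom_iff.1 h3
  obtain rfl : f' = f := Option.some_inj.1 ((rcv_eq_some.2 hf').symm.trans hf)
  exact ⟨rfl, M.lt_of_lt_of_le (M.lt_of_msg hf') (M.le_of_pos h1 h2)⟩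

theorem exists_back {e f g : M.E} (h : g.1 = e.1) (h' : (g.2 : ℕ) ≤ e.2) (hf : M.msg f g) :
    ∃ f', back f.1 M e = some f' ∧ (f.2 : ℕ) ≤ f'.2 := by
  obtain ⟨g', hg', hle⟩ := exists_lastIn (X := M.recvFrom f.1) h h' (recvFrom_iff.2 ⟨f, hf, rfl⟩)
  obtain ⟨h1, h2, h3⟩ := lastIn_mem hg'
  obtain ⟨f', hf', hr⟩ := recvFrom_iff.1 h3
  refine ⟨f', by rw [back, hg', Option.bind_some, rcv_eq_some]; exact hf', ?_⟩
  exact (reflTransGen_procEdge.1 ((M.fifo _ _ _ _ hf hf' hr.symm (h.trans h1.symm)).2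
    (reflTransGen_procEdge.2 ⟨h.trans h1.symm, hle⟩))).2

theorem back_mono {r : P} {e e' f : M.E} (h : e.1 = e'.1) (h' : (e.2 : ℕ) ≤ e'.2)
    (hf : back r M e = some f) : ∃ f', back r M e' = some f' ∧ (f.2 : ℕ) ≤ f'.2 := by
  obtain ⟨g, hg, hgf⟩ := Option.bind_eq_some_iff.1 hf
  obtain ⟨h1, h2, -⟩ := lastIn_mem hg
  obtain rfl := (back_mem hf).1
  exact exists_back (h1.trans h) (h2.trans h') (rcv_eq_some.1 hgf)

/-- Going back from `e` along messages from the processes in the list `w`, each time from the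
latest possible send event. -/
noncomputable def path : List P → ∀ M : MSC P A, M.E → Option M.E
  | [], _, e => some e
  | r :: w, M, e => (back r M e).bind (path w M)

theorem path_le {w : List P} {e f : M.E} (h : path w M e = some f) : M.le f e := by
  induction w generalizing e with
  | nil =>
    obtain rfl := Option.some_inj.1 h
    exact M.le_refl _
  | cons r w ih =>
    obtain ⟨g, hg, hgf⟩ := Option.bind_eq_some_iff.1 h
    exact M.le_trans (ih hgf) (back_mem hg).2.le

theorem path_mono {w : List P} {e e' f : M.E} (h : e.1 = e'.1) (h' : (e.2 : ℕ) ≤ e'.2)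
    (hf : path w M e = some f) :
    ∃ f', path w M e' = some f' ∧ f.1 = f'.1 ∧ (f.2 : ℕ) ≤ f'.2 := by
  induction w generalizing e e' with
  | nil =>
    obtain rfl := Option.some_inj.1 hf
    exact ⟨e', rfl, h, h'⟩
  | cons r w ih =>
    obtain ⟨g, hg, hgf⟩ := Option.bind_eq_some_iff.1 hf
    obtain ⟨g', hg', hle⟩ := back_mono h h' hg
    obtain ⟨f', hf', h1⟩ := ih ((back_mem hg).1.trans (back_mem hg').1.symm) hle hgf
    exact ⟨f', by rw [path, hg', Option.bind_some, hf'], h1⟩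

/-- If `f ≤ e`, then going back from `e` along some short path reaches the process of `f` at `f` or
later. On the process of `e`, the first event above `f` receives a message from an event that is
above `f` as well, and no event in between lies on the process of `e`. -/
theorem exists_path [Finite P] {f e : M.E} (h : M.le f e) :
    ∃ w : List P, w.length ≤ Nat.card P ∧
      ∃ f', path w M e = some f' ∧ f.1 = f'.1 ∧ (f.2 : ℕ) ≤ f'.2 := by
  suffices H : ∀ n, ∀ f e : M.E, {p | ∃ g : M.E, g.1 = p ∧ M.le f g ∧ M.le g e}.ncard = n →
      M.le f e → ∃ w : List P, w.length ≤ n ∧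
        ∃ f', path w M e = some f' ∧ f.1 = f'.1 ∧ (f.2 : ℕ) ≤ f'.2 by
    obtain ⟨w, hw, hw'⟩ := H _ f e rfl h
    exact ⟨w, hw.trans (Set.ncard_le_card _), hw'⟩
  intro n
  induction n using Nat.strong_induction_on with
  | _ n ih =>
    intro f e hn h
    by_cases hfe : f.1 = e.1
    · exact ⟨[], Nat.zero_le _, e, rfl, hfe, M.pos_le_of_le hfe h⟩
    obtain ⟨e₀, ⟨h1, h2⟩, h3⟩ := WellFounded.has_min (measure fun f : M.E => (f.2 : ℕ)).wf
      {g | g.1 = e.1 ∧ M.le f g} ⟨e, rfl, h⟩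
    replace h3 : ∀ g : M.E, g.1 = e.1 → M.le f g → (e₀.2 : ℕ) ≤ g.2 :=
      fun g hg hfg => not_lt.1 (h3 g ⟨hg, hfg⟩)
    have hlt : M.lt f e₀ := by
      rcases M.le_iff.1 h2 with rfl | h2
      · exact absurd h1 hfe
      · exact h2
    rcases lt_iff_tail.1 hlt with ⟨s, hs, hfs⟩ | ⟨t, ht, hft⟩
    · have hb := before_of_prev hs
      exact absurd (h3 s (hb.1.trans h1) (M.le_iff.2 (hfs.imp_left Eq.symm))) hb.2.not_ge
    · replace hft := M.le_iff.2 (hft.imp_left Eq.symm)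
      have hmsg := rcv_eq_some.1 ht
      have he₀ : (e₀.2 : ℕ) ≤ e.2 := h3 e rfl h
      have hte : M.le t e := (M.lt_of_lt_of_le (M.lt_of_msg hmsg) (M.le_of_pos h1 he₀)).le
      have hcard : {p | ∃ g : M.E, g.1 = p ∧ M.le f g ∧ M.le g t}.ncard <
          {p | ∃ g : M.E, g.1 = p ∧ M.le f g ∧ M.le g e}.ncard := by
        refine Set.ncard_lt_ncard ⟨?_, ?_⟩
        · rintro p ⟨g, hp, hg, hg'⟩
          exact ⟨g, hp, hg, M.le_trans hg' hte⟩
        · intro hsub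
          obtain ⟨g, hp, hg, hg'⟩ := hsub ⟨e, rfl, h, M.le_refl e⟩
          have := M.pos_lt_of_lt (hp.trans h1.symm)
            (M.lt_of_le_of_lt hg' (M.lt_of_msg hmsg))
          have := h3 g hp hg
          omega
      obtain ⟨w, hw, f', hf', hp, hle⟩ := ih _ (hn ▸ hcard) f t rfl hft
      obtain ⟨t', ht', hle'⟩ := exists_back h1 he₀ hmsg
      obtain ⟨f'', hf'', hp', hle''⟩ := path_mono (back_mem ht').1.symm hle' hf'
      refine ⟨t.1 :: w, ?_, f'', by rw [path, ht', Option.bind_some, hf''], hp.trans hp',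
        hle.trans hle''⟩
      simp only [List.length_cons]
      omega

open Classical in
/-- The event reached along the path `w` if it lies on process `q`. -/
noncomputable def pathTo (q : P) (w : List P) (M : MSC P A) (e : M.E) : Option M.E :=
  (path w M e).filter fun f => f.1 = q

theorem pathTo_eq_some {q : P} {w : List P} {e f : M.E} :
    pathTo q w M e = some f ↔ path w M e = some f ∧ f.1 = q := by
  simp [pathTo, Option.filter_eq_some_iff]

theorem pathTo_mono {q : P} {w : List P} {e e' f : M.E} (h : e.1 = e'.1) (h' : (e.2 : ℕ) ≤ e'.2)
    (hf : pathTo q w M e = some f) : ∃ f', pathTo q w M e' = some f' ∧ (f.2 : ℕ) ≤ f'.2 := by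
  obtain ⟨h1, h2⟩ := pathTo_eq_some.1 hf
  obtain ⟨f', h3, h4, h5⟩ := path_mono h h' h1
  exact ⟨f', pathTo_eq_some.2 ⟨h3, h4.symm.trans h2⟩, h5⟩

/-- The first event of process `q` that lies in `X` and, if `o = some f`, comes after `f`. -/
noncomputable def nextFrom (M : MSC P A) (X : M.E → Bool) (q : P) : Option M.E → Option M.E
  | none => (M.firstOn q).bind fun f => if X f then some f else M.nextIn X f
  | some f => M.nextIn X f

theorem nextFrom_mem {X : M.E → Bool} {q : P} {o : Option M.E} (ho : ∀ f, o = some f → f.1 = q)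
    {x : M.E} (h : M.nextFrom X q o = some x) :
    x.1 = q ∧ X x = true ∧ (∀ f, o = some f → Before f x) ∧
      ∀ y : M.E, y.1 = q → X y = true → (∀ f, o = some f → Before f y) → (x.2 : ℕ) ≤ y.2 := by
  have key : ∀ f : M.E, f.1 = q → M.nextIn X f = some x → ∀ y : M.E, X y = true → Before f y →
      (x.2 : ℕ) ≤ y.2 := by
    intro f hf h y hX hb
    obtain ⟨x', hx', hle⟩ := exists_nextIn hb hX
    rwa [← Option.some_inj.1 (hx'.symm.trans h)]
  rcases o with _ | f
  · obtain ⟨f, hf, hx⟩ := Option.bind_eq_some_iff.1 h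
    obtain ⟨h1, h2⟩ := firstOn_eq_some.1 hf
    split_ifs at hx with hXf
    · obtain rfl := Option.some_inj.1 hx
      exact ⟨h1, hXf, by simp, fun y _ _ _ => by omega⟩
    · obtain ⟨h3, h4, -⟩ := nextIn_eq_some.1 hx
      refine ⟨h3.1.symm.trans h1, h4, by simp, fun y hy hXy _ =>
        key f h1 hx y hXy ⟨h1.trans hy.symm,
        Nat.pos_of_ne_zero ?_ |>.trans_le' h2.le⟩⟩
      intro h0
      obtain rfl := event_ext (h1.trans hy.symm) (h2.trans h0.symm)
      exact hXf hXy
  · obtain ⟨h3, h4, -⟩ := nextIn_eq_some.1 h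
    refine ⟨h3.1.symm.trans (ho f rfl), h4, fun f' hf' => ?_, fun y _ hX hb =>
      key f (ho f rfl) h y hX (hb f rfl)⟩
    obtain rfl := Option.some_inj.1 hf'
    exact h3

theorem exists_nextFrom {X : M.E → Bool} {q : P} {o : Option M.E}
    {y : M.E} (hq : y.1 = q) (hX : X y = true) (hy : ∀ f, o = some f → Before f y) :
    ∃ x, M.nextFrom X q o = some x := by
  rcases o with _ | f
  · rcases hf : M.firstOn q with _ | f
    · rw [firstOn_eq_none] at hf
      have h0 : (M.word y.1).length = 0 := by rw [hq, hf, List.length_nil]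
      have := y.2.2
      omega
    · simp only [nextFrom, hf, Option.bind_some]
      split_ifs with hXf
      · exact ⟨f, rfl⟩
      · obtain ⟨h1, h2⟩ := firstOn_eq_some.1 hf
        have hb : Before f y := by
          refine ⟨h1.trans hq.symm, ?_⟩
          rw [h2]
          refine Nat.pos_of_ne_zero fun h0 => ?_
          obtain rfl := event_ext (h1.trans hq.symm) (h2.trans h0.symm)
          exact hXf hX
        exact (exists_nextIn hb hX).imp fun _ h => h.1
  · exact (exists_nextIn (hy f rfl) hX).imp fun _ h => h.1

/-- The composition of going back from process `p` to process `q` along `w`, forward to the next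
event of `X`, and back to process `p` along `w'`. Here `none` means that there is no such event of
`X`, and `some none` that there is no way back. -/
noncomputable def loop (p q : P) (w w' : List P) (M : MSC P A) (X : M.E → Bool) (e : M.E) :
    Option (Option M.E) :=
  (M.nextFrom X q (pathTo q w M e)).map (pathTo p w' M)

/-- An upper bound of the positions of all events. -/
noncomputable def bound (M : MSC P A) : ℕ := ⨆ p, (M.word p).length

theorem pos_lt_bound [Finite P] (e : M.E) : (e.2 : ℕ) < M.bound :=
  e.2.2.trans_le (le_ciSup (f := fun p => (M.word p).length) (Set.finite_range _).bddAbove e.1)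

/-- Going back along a path and going forward to the next event of a set are monotone. -/
theorem monoMap_loop [Finite P] (p q : P) (w w' : List P) (M : MSC P A) (X : M.E → Bool) :
    SignCert.MonoMap {e : M.E | e.1 = p} (fun e => e.2) M.bound (loop p q w w' M X) where
  inj e he f hf h := event_ext (he.trans hf.symm) h
  bound := pos_lt_bound
  mem e _ d hd := by
    obtain ⟨x, -, hx⟩ := Option.map_eq_some_iff.1 hd
    exact (pathTo_eq_some.1 hx).2
  mono e he e' he' hle := by
    have hto : ∀ (e : M.E) f, pathTo q w M e = some f → f.1 = q :=
      fun e f hf => (pathTo_eq_some.1 hf).2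
    rcases hx' : M.nextFrom X q (pathTo q w M e') with _ | x'
    · have : loop p q w w' M X e' = none := by rw [loop, hx', Option.map_none]
      rw [this, SignCert.rank_top]
      rcases loop p q w w' M X e with _ | _ | d
      · exact _root_.le_refl _
      · exact Nat.zero_le _
      · rw [SignCert.rank_val]
        have := pos_lt_bound d
        omega
    · obtain ⟨h1, h2, h3, -⟩ := nextFrom_mem (hto e') hx'
      have h4 : ∀ f, pathTo q w M e = some f → Before f x' := by
        intro f hf
        obtain ⟨f', hf', hff⟩ := pathTo_mono (he.trans he'.symm) hle hf
        exact ⟨(hto e f hf).trans h1.symm, hff.trans_lt (h3 f' hf').2⟩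
      obtain ⟨x, hx⟩ := exists_nextFrom h1 h2 h4
      obtain ⟨h5, -, -, h6⟩ := nextFrom_mem (hto e) hx
      have h7 := h6 x' h1 h2 h4
      simp only [loop, hx, hx', Option.map_some]
      rcases hd : pathTo p w' M x with _ | d
      · exact Nat.zero_le _
      · obtain ⟨d', hd', hdd⟩ := pathTo_mono (h5.trans h1.symm) h7 hd
        simpa only [hd', SignCert.rank_val, Nat.add_le_add_iff_right] using hdd

/-- An event `e` of process `p` is concurrent to some event of `X` on process `q` unless
some loop map moves `e` weakly upwards: then every such event lies below the event
on `q` reached from `e`, or above the next event of `X`, which is above `e`. -/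
theorem exists_concurrent_iff [Finite P] {p q : P} (X : M.E → Bool) {e : M.E}
    (he : e.1 = p) :
    (∃ f, X f = true ∧ f.1 = q ∧ ¬ M.le e f ∧ ¬ M.le f e) ↔
      ¬ ∃ (w : {w : List P // w.length ≤ Nat.card P}) (w' : {w : List P // w.length ≤ Nat.card P}),
        (e.2 : ℕ) + 1 ≤ SignCert.rank (fun e : M.E => (e.2 : ℕ)) M.bound
          (loop p q w.1 w'.1 M X e) := by
  have hto : ∀ w (e : M.E) f, pathTo q w M e = some f → f.1 = q :=
    fun w e f hf => (pathTo_eq_some.1 hf).2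
  constructor
  · rintro ⟨f, hX, hq, h1, h2⟩ ⟨⟨w, hw⟩, ⟨w', hw'⟩, h⟩
    have hb : ∀ f', pathTo q w M e = some f' → Before f' f := by
      intro f' hf'
      refine ⟨(hto w e f' hf').trans hq.symm, ?_⟩
      by_contra hcon
      exact h2 (M.le_trans (M.le_of_pos (hq.trans (hto w e f' hf').symm) (not_lt.1 hcon))
        (path_le (pathTo_eq_some.1 hf').1))
    obtain ⟨x, hx⟩ := exists_nextFrom hq hX hb
    obtain ⟨h3, -, -, h4⟩ := nextFrom_mem (hto w e) hx
    simp only [loop, hx, Option.map_some] at h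
    rcases hd : pathTo p w' M x with _ | d
    · simp [hd, SignCert.rank_bot] at h
    · simp only [hd, SignCert.rank_val, Nat.add_le_add_iff_right] at h
      obtain ⟨h5, h6⟩ := pathTo_eq_some.1 hd
      exact h1 (M.le_trans (M.le_of_pos (he.trans h6.symm) h)
        (M.le_trans (path_le h5) (M.le_of_pos (h3.trans hq.symm) (h4 f hq hX hb))))
  · intro h
    by_contra hcon
    refine h ?_
    -- the path from `e` to the last event of `q` below `e`
    obtain ⟨w, hw⟩ : ∃ w : {w : List P // w.length ≤ Nat.card P},
        ∀ f : M.E, f.1 = q → M.le f e → ∃ f', pathTo q w.1 M e = some f' ∧ (f.2 : ℕ) ≤ f'.2 := by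
      by_cases hex : ∃ f : M.E, f.1 = q ∧ M.le f e
      · obtain ⟨f₀, ⟨h1, h2⟩, h3⟩ := WellFounded.has_min
          (measure fun f : M.E => M.bound - (f.2 : ℕ)).wf {f | f.1 = q ∧ M.le f e} hex
        obtain ⟨w, hw, f', hf', h4, h5⟩ := exists_path h2
        refine ⟨⟨w, hw⟩, fun f hf hfe => ⟨f', pathTo_eq_some.2 ⟨hf', h4.symm.trans h1⟩, ?_⟩⟩
        have h6 : ¬ (M.bound - (f.2 : ℕ) < M.bound - f₀.2) := h3 f ⟨hf, hfe⟩
        have := pos_lt_bound f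
        omega
      · exact ⟨⟨[], Nat.zero_le _⟩, fun f hf hfe => absurd ⟨f, hf, hfe⟩ hex⟩
    rcases hx : M.nextFrom X q (pathTo q w.1 M e) with _ | x
    · refine ⟨w, ⟨[], Nat.zero_le _⟩, ?_⟩
      rw [loop, hx, Option.map_none, SignCert.rank_top]
      have := pos_lt_bound e
      omega
    · obtain ⟨h1, h2, h3, -⟩ := nextFrom_mem (hto w e) hx
      have hex : M.le e x := by
        by_contra hex
        have hxe : M.le x e := by
          by_contra hxe
          exact hcon ⟨x, h2, h1, hex, hxe⟩
        obtain ⟨f', hf', hle⟩ := hw x h1 hxe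
        exact absurd (h3 f' hf').2 hle.not_gt
      obtain ⟨w', hw', d, hd, h4, h5⟩ := exists_path hex
      refine ⟨w, ⟨w', hw'⟩, ?_⟩
      have : pathTo p w' M x = some d := pathTo_eq_some.2 ⟨hd, h4.symm.trans he⟩
      rw [loop, hx, Option.map_some, this, SignCert.rank_val]
      omega

end MSC

/-! ### The concurrency relation is recognizable -/

/-- A partial map between events is evaluable if every event can be told the label of its image. -/
def Evaluable (F : ∀ M : MSC P A, M.E → Option M.E) : Prop :=
  ∀ (C : Type) [Finite C], IsTransduction fun (M : MSC P A) (g : M.E → C) e => (F M e).map g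

namespace Evaluable

variable {F G : ∀ M : MSC P A, M.E → Option M.E}

theorem bind (hF : Evaluable F) (hG : Evaluable G) :
    Evaluable fun M e => (F M e).bind (G M) := by
  intro C _
  refine (((hF (Option C)).comp (hG C)).map fun _ c => c.join).congr fun M g => funext fun e => ?_
  beta_reduce
  rcases F M e with _ | f <;> rfl

open Classical in
theorem filter (hF : Evaluable F) (q : P) :
    Evaluable fun M e => (F M e).filter fun f => f.1 = q := by
  intro C _
  refine (((hF (Bool × C)).comp (IsTransduction.node fun p (c : C) => (decide (p = q), c))).map
    fun _ c => c.bind fun c => if c.1 then some c.2 else none).congr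
    fun M g => funext fun e => ?_
  beta_reduce
  rcases F M e with _ | f
  · rfl
  · by_cases hf : f.1 = q
    · simp only [Option.filter_some, hf, decide_true, if_true, Option.map_some, Option.bind_some]
    · simp only [Option.filter_some, hf, decide_false, Bool.false_eq_true, if_false,
        Option.map_none, Option.map_some, Option.bind_some]

variable [Finite P]

theorem back (r : P) : Evaluable (A := A) (MSC.back r) := by
  intro C _
  classical
  have h1 : IsTransduction fun (M : MSC P A) (g : M.E → C) e =>
      (M.recvFrom r e, (M.rcv e).map g) := by
    refine ((IsTransduction.rcv.comp (IsTransduction.node fun p (c : C) => (decide (p = r), c))).map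
      fun _ c => (c.any fun c => c.1, c.map fun c => c.2)).congr fun M g => funext fun e => ?_
    rw [MSC.recvFrom]
    rcases M.rcv e with _ | f <;> rfl
  have h2 : IsTransduction fun (M : MSC P A) (g : M.E → Bool × Option C) e =>
      (M.lastIn (fun e => (g e).1) e).map fun e => (g e).2 := by
    refine ((IsTransduction.id'.pair IsTransduction.prevIn).map fun _ c =>
      if c.1.1 then some c.1.2 else c.2).congr fun M g => funext fun e => ?_
    unfold MSC.lastIn
    split_ifs <;> rfl
  refine ((h2.comp h1).map fun _ c => c.join).congr fun M g => funext fun e => ?_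
  beta_reduce
  rw [MSC.back]
  rcases M.lastIn (M.recvFrom r) e with _ | f <;> rfl

theorem path (w : List P) : Evaluable (A := A) (MSC.path w) := by
  induction w with
  | nil => exact fun C _ => IsTransduction.node fun _ c => some c
  | cons r w ih => exact (back r).bind ih

theorem pathTo (q : P) (w : List P) : Evaluable (A := A) (MSC.pathTo q w) :=
  (path w).filter q

end Evaluable

namespace IsTransduction

variable [Finite P]

theorem loop (p q : P) (w w' : List P) (C : Type) [Finite C] :
    IsTransduction fun (M : MSC P A) (g : M.E → Bool × C) e =>
      (MSC.loop p q w w' M (fun e => (g e).1) e).map (Option.map fun e => (g e).2) := by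
  have h1 : IsTransduction fun (M : MSC P A) (g : M.E → Bool × C) e =>
      ((g e).1, (MSC.pathTo p w' M e).map fun e => (g e).2) :=
    (node fun _ (c : Bool × C) => c.1).pair
      ((Evaluable.pathTo p w' C).comp (node fun _ (c : Bool × C) => c.2))
  have h2 : IsTransduction fun (M : MSC P A) (g : M.E → Bool × Option C) e =>
      (g e, (M.nextIn (fun e => (g e).1) e).map fun e => (g e).2) := id'.pair nextIn
  have h3 : IsTransduction fun (M : MSC P A) (g : M.E → (Bool × Option C) × Option (Option C)) e =>
      ((M.firstOn q).map g, (MSC.pathTo q w M e).map fun e => (g e).2) :=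
    (firstOn q).pair ((Evaluable.pathTo q w _).comp
      (node fun _ (c : (Bool × Option C) × Option (Option C)) => c.2))
  refine (((h3.comp h2).comp h1).map fun _ c => match c.2 with
    | some z => z
    | none => c.1.bind fun d : (Bool × Option C) × Option (Option C) =>
      if d.1.1 then some d.1.2 else d.2).congr fun M g => funext fun e => ?_
  beta_reduce
  rw [MSC.loop]
  rcases MSC.pathTo q w M e with _ | f
  · simp only [MSC.nextFrom, Option.map_none]
    rcases M.firstOn q with _ | f
    · rfl
    · simp only [Option.bind_some, Option.map_some]
      split_ifs
      · rfl
      · simp only [Option.map_map]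
        rfl
  · simp only [MSC.nextFrom, Option.map_some, Option.map_map]
    rfl

open Classical in
/-- The sign of a loop map is recognizable: it is guessed, together with a colouring that
certifies it. -/
theorem sign (p q : P) (w w' : List P) :
    IsTransduction fun (M : MSC P A) (X : M.E → Bool) e => decide (e.1 = p ∧
      (e.2 : ℕ) + 1 ≤
        SignCert.rank (fun e : M.E => (e.2 : ℕ)) M.bound (MSC.loop p q w w' M X e)) := by
  have : Finite Ordering := Finite.of_injective (fun o : Ordering => (o.isLT, o.isEq)) (by
    intro a b; cases a <;> cases b <;> simp)
  have h1 : IsTransduction fun (M : MSC P A) (g : M.E → (Bool × Bool) × Ordering × Bool) e =>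
      (g e, (M.prevIn (fun e => decide ((g e).2.1 = .eq)) e).map (fun e => (g e).2.2),
        (MSC.loop p q w w' M (fun e => (g e).1.1) e).map (Option.map fun e => (g e).2)) :=
    id'.pair ((prevIn.comp (node fun _ (c : (Bool × Bool) × Ordering × Bool) =>
      (decide (c.2.1 = .eq), c.2.2))).pair ((loop p q w w' (Ordering × Bool)).comp
        (node fun _ (c : (Bool × Bool) × Ordering × Bool) => (c.1.1, c.2))))
  -- The guessed labels are the sign and the colour; the check at an event looks up the colour of
  -- the last fixed point before it and the label of its image.
  refine ((Recognizable.node fun r (c : ((Bool × Bool) × Ordering × Bool) × Option Bool ×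
    Option (Option (Ordering × Bool))) => (r = p → SignCert.Check c.1.2.1 c.1.2.2 c.2.1 c.2.2) ∧
      c.1.1.2 = decide (r = p ∧ c.1.2.1 ≠ .lt)).subst h1).ex.congr fun M g => ?_
  have hprev : ∀ cls : M.E → Ordering, SignCert.IsPrev {e : M.E | e.1 = p} (fun e => (e.2 : ℕ)) cls
      (M.prevIn fun e => decide (cls e = .eq)) := fun cls =>
    { mem := fun e he k hk => (MSC.prevIn_eq_some.1 hk).1.1.trans he
      lt := fun e _ k hk => (MSC.prevIn_eq_some.1 hk).1.2
      eq := fun e _ k hk => of_decide_eq_true (MSC.prevIn_eq_some.1 hk).2.1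
      between := fun e he k hk m hm hlt hc => by
        obtain ⟨g, hg, hle⟩ := MSC.exists_prevIn (X := fun e => decide (cls e = .eq))
          (show MSC.Before m e from ⟨hm.trans he.symm, hlt⟩) (decide_eq_true hc)
        rwa [← Option.some_inj.1 (hg.symm.trans hk)]
      none := fun e he hk m hm hlt hc => by
        obtain ⟨g, hg, -⟩ := MSC.exists_prevIn (X := fun e => decide (cls e = .eq))
          (show MSC.Before m e from ⟨hm.trans he.symm, hlt⟩) (decide_eq_true hc)
        rw [hk] at hg
        cases hg }
  have hD := MSC.monoMap_loop p q w w' M fun e => (g e).1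
  constructor
  · intro h
    set cls : M.E → Ordering := fun e => compare (SignCert.rank (fun e : M.E => (e.2 : ℕ)) M.bound
      (MSC.loop p q w w' M (fun e => (g e).1) e)) ((e.2 : ℕ) + 1) with hcls
    obtain ⟨col, hcol⟩ := SignCert.exists_check hD (cls := cls) (fun _ => rfl) (hprev cls)
    refine ⟨fun e => (cls e, col e), fun e => ⟨fun he => hcol e he, ?_⟩⟩
    rw [h e]
    simp only [hcls, ne_eq, compare_lt_iff_lt, not_lt]
  · rintro ⟨l, hl⟩ e
    refine (hl e).2.trans ?_
    congr 1
    refine propext (and_congr_right fun he => ?_)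
    exact SignCert.sign_of_check hD (hprev fun e => (l e).1) (col := fun e => (l e).2)
      (fun e he => (hl e).1 he) e he

open Classical in
/-- Whether an event is concurrent to a marked one is determined by the signs of the finitely many
loop maps along short paths. -/
theorem concurrent : IsTransduction fun (M : MSC P A) (X : M.E → Bool) e =>
    decide (∃ f, X f = true ∧ ¬ M.le e f ∧ ¬ M.le f e) := by
  have : Finite {w : List P // w.length ≤ Nat.card P} :=
    Set.Finite.to_subtype (List.finite_length_le P _)
  have h : ∀ c : P × P, IsTransduction fun (M : MSC P A) (X : M.E → Bool) e =>
      decide (e.1 = c.1 ∧ ∃ f, X f = true ∧ f.1 = c.2 ∧ ¬ M.le e f ∧ ¬ M.le f e) := by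
    intro c
    refine ((any fun w : {w : List P // w.length ≤ Nat.card P} =>
      any fun w' : {w : List P // w.length ≤ Nat.card P} => sign (A := A) c.1 c.2 w.1 w'.1).map
        fun r b => decide (r = c.1 ∧ b = false)).congr fun M X => funext fun e => ?_
    rw [Bool.eq_iff_iff, decide_eq_true_eq, decide_eq_true_eq, decide_eq_false_iff_not]
    refine and_congr_right fun he => ?_
    rw [MSC.exists_concurrent_iff X he]
    simp only [he, true_and]
  refine (any h).congr fun M X => funext fun e => ?_
  rw [Bool.eq_iff_iff, decide_eq_true_eq, decide_eq_true_eq]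
  constructor
  · rintro ⟨f, hX, hf⟩
    exact ⟨(e.1, f.1), rfl, f, hX, rfl, hf⟩
  · rintro ⟨c, -, f, hX, -, hf⟩
    exact ⟨f, hX, hf⟩

end IsTransduction

/-! ### The eight relative positions of two events -/

namespace MSC

variable {M : MSC P A}

/-- The relative position of two events, numbered from `0` to `7`: equality, process edge, reversed
process edge, message edge, reversed message edge, strict order without an edge, reversed strict
order without an edge, and incomparability. Exactly one of them applies to a given pair. -/
def Kind (M : MSC P A) : Fin 8 → M.E → M.E → Prop
  | 0, e, f => e = f
  | 1, e, f => ProcEdge e f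
  | 2, e, f => ProcEdge f e
  | 3, e, f => M.msg e f
  | 4, e, f => M.msg f e
  | 5, e, f => M.lt e f ∧ ¬ (ProcEdge e f ∨ M.msg e f)
  | 6, e, f => M.lt f e ∧ ¬ (ProcEdge f e ∨ M.msg f e)
  | 7, e, f => ¬ M.le e f ∧ ¬ M.le f e

/-- The position of the second event relative to the first, from that of the first relative to the
second. -/
def flipKind : Fin 8 → Fin 8 := ![0, 2, 1, 4, 3, 6, 5, 7]

theorem kind_flip {r : Fin 8} {e f : M.E} : M.Kind (flipKind r) f e ↔ M.Kind r e f := by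
  fin_cases r <;> simp [Kind, flipKind, eq_comm, and_comm]

theorem exists_kind (e f : M.E) : ∃ r, M.Kind r e f := by
  by_cases h1 : M.le e f
  · rcases M.le_iff.1 h1 with h | h
    · exact ⟨0, h⟩
    · by_cases hp : ProcEdge e f
      · exact ⟨1, hp⟩
      by_cases hm : M.msg e f
      · exact ⟨3, hm⟩
      exact ⟨5, h, by tauto⟩
  by_cases h2 : M.le f e
  · rcases M.le_iff.1 h2 with h | h
    · exact ⟨0, h.symm⟩
    · by_cases hp : ProcEdge f e
      · exact ⟨2, hp⟩
      by_cases hm : M.msg f e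
      · exact ⟨4, hm⟩
      exact ⟨6, h, by tauto⟩
  exact ⟨7, h1, h2⟩

end MSC

/-! ### Events without an edge to a given one -/

namespace IsTransduction

open Classical in
/-- Whether a marked event lies above the current one in a strict order `lt` but is not joined to it
by an edge can be determined from the last two marked events of each process: if the last one is not
adjacent, it decides the question, and otherwise the last but one is not adjacent and decides it.
The order `bef` of a process and the edges `adj` enter through a few of their properties, so that
the lemma applies to the order of an MSC as well as to its converse. -/
theorem far [Finite P] {bef adj lt : ∀ M : MSC P A, M.E → M.E → Prop}
    (bef_lt : ∀ M e f, bef M e f → lt M e f)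
    (lt_trans : ∀ M e f g, lt M e f → lt M f g → lt M e g)
    (lt_wf : ∀ M, WellFounded (Function.swap (lt M)))
    (bef_proc : ∀ M e f, bef M e f → e.1 = f.1)
    (bef_total : ∀ M (e f : M.E), e.1 = f.1 → bef M e f ∨ e = f ∨ bef M f e)
    (adj_unique : ∀ M e f g, adj M e f → adj M e g → f.1 = g.1 → f = g)
    (hlast : IsTransduction fun (M : MSC P A) (X : M.E → Bool) e =>
      decide (X e = true ∧ ∀ f, bef M e f → X f = false))
    (hlt : IsTransduction fun (M : MSC P A) (X : M.E → Bool) e =>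
      decide (∃ f, lt M e f ∧ X f = true))
    (hadj : IsTransduction fun (M : MSC P A) (X : M.E → Bool) e =>
      decide (∃ f, adj M e f ∧ X f = true)) :
    IsTransduction fun (M : MSC P A) (X : M.E → Bool) e =>
      decide (∃ f, (lt M e f ∧ ¬ adj M e f) ∧ X f = true) := by
  set last : ∀ M : MSC P A, (M.E → Bool) → M.E → Bool := fun M X e =>
    decide (X e = true ∧ ∀ f, bef M e f → X f = false)
  have last_iff : ∀ M X e, last M X e = true ↔ X e = true ∧ ∀ f, bef M e f → X f = false :=
    fun M X e => decide_eq_true_iff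
  have exists_last : ∀ (M : MSC P A) (X : M.E → Bool) f, X f = true →
      ∃ g, (g = f ∨ bef M f g) ∧ last M X g = true := by
    intro M X f hf
    induction f using (lt_wf M).induction with
    | _ f ih =>
      by_cases h : ∃ g, bef M f g ∧ X g = true
      · obtain ⟨g, hfg, hg⟩ := h
        obtain ⟨k, hk, hl⟩ := ih g (bef_lt M f g hfg) hg
        refine ⟨k, Or.inr ?_, hl⟩
        rcases hk with rfl | hk
        · exact hfg
        · have hfk : f.1 = k.1 := (bef_proc M f g hfg).trans (bef_proc M g k hk)
          rcases bef_total M f k hfk with h | rfl | h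
          · exact h
          · exact absurd (lt_trans M _ _ _ (bef_lt M _ _ hfg) (bef_lt M _ _ hk))
              fun h => (lt_wf M).asymmetric _ _ h h
          · exact absurd (lt_trans M _ _ _ (bef_lt M _ _ hfg) (bef_lt M _ _ hk))
              fun h' => (lt_wf M).asymmetric _ _ h' (bef_lt M _ _ h)
      · push Not at h
        exact ⟨f, Or.inl rfl, (last_iff M X f).2 ⟨hf, fun g hg => by simpa using h g hg⟩⟩
  have last_unique : ∀ (M : MSC P A) (X : M.E → Bool) f g, f.1 = g.1 → last M X f = true →
      last M X g = true → f = g := by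
    intro M X f g hfg hf hg
    rw [last_iff] at hf hg
    rcases bef_total M f g hfg with h | h | h
    · simp [hf.2 g h] at hg
    · exact h
    · simp [hg.2 f h] at hf
  set second : ∀ M : MSC P A, (M.E → Bool) → M.E → Bool := fun M X =>
    last M fun e => X e && ! last M X e
  have hsecond : IsTransduction (P := P) (A := A) second :=
    hlast.comp ((id'.pair hlast).map fun _ c => c.1 && ! c.2)
  have hon : ∀ q : P, IsTransduction fun (M : MSC P A) (X : M.E → Bool) e =>
      X e && decide (e.1 = q) := fun q => node fun p b => b && decide (p = q)
  refine (any fun q : P => ((hadj.comp ((hon q).comp hlast)).pair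
    ((hlt.comp ((hon q).comp hlast)).pair (hlt.comp ((hon q).comp hsecond)))).map
      fun _ c => decide (cond c.1 c.2.2 c.2.1 = true)).congr fun M X => funext fun e => ?_
  rw [Bool.eq_iff_iff, decide_eq_true_eq, decide_eq_true_eq]
  simp only [Bool.and_eq_true, decide_eq_true_eq]
  constructor
  · rintro ⟨f, ⟨hef, hnadj⟩, hX⟩
    refine ⟨f.1, ?_⟩
    obtain ⟨g, hg, hgl⟩ := exists_last M X f hX
    have hgf : g.1 = f.1 := by
      rcases hg with rfl | hg
      exacts [rfl, (bef_proc _ _ _ hg).symm]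
    by_cases hadj : ∃ g, adj M e g ∧ last M X g = true ∧ g.1 = f.1
    · rw [decide_eq_true hadj]
      obtain ⟨g', hg', hl', hgf'⟩ := hadj
      obtain rfl := last_unique M X g' g (hgf'.trans hgf.symm) hl' hgl
      have hfl : last M X f ≠ true := fun h =>
        hnadj (last_unique M X f g' hgf.symm h hgl ▸ hg')
      obtain ⟨k, hk, hkl⟩ := exists_last M (fun e => X e && ! last M X e) f (by simp [hX, hfl])
      refine decide_eq_true ⟨k, ?_, hkl, ?_⟩
      · rcases hk with rfl | hk
        exacts [hef, lt_trans _ _ _ _ hef (bef_lt _ _ _ hk)]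
      · rcases hk with rfl | hk
        exacts [rfl, (bef_proc _ _ _ hk).symm]
    · rw [decide_eq_false hadj]
      refine decide_eq_true ⟨g, ?_, hgl, hgf⟩
      rcases hg with rfl | hg
      exacts [hef, lt_trans _ _ _ _ hef (bef_lt _ _ _ hg)]
  · rintro ⟨q, h⟩
    by_cases hadj : ∃ g, adj M e g ∧ last M X g = true ∧ g.1 = q
    · rw [decide_eq_true hadj] at h
      obtain ⟨g, hg, hgl, rfl⟩ := hadj
      obtain ⟨f, hef, hs, hfg⟩ := of_decide_eq_true h
      have hs' := ((last_iff M (fun e => X e && ! last M X e) f).1 hs).1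
      simp only [Bool.and_eq_true, Bool.not_eq_true'] at hs'
      refine ⟨f, ⟨hef, fun hf => ?_⟩, hs'.1⟩
      rw [adj_unique M e f g hf hg hfg, hgl] at hs'
      simp at hs'
    · rw [decide_eq_false hadj] at h
      obtain ⟨f, hef, hl, hfq⟩ := of_decide_eq_true h
      exact ⟨f, ⟨hef, fun hf => hadj ⟨f, hf, hl, hfq⟩⟩, ((last_iff _ _ _).1 hl).1⟩

open Classical in
theorem procEdge : IsTransduction fun (M : MSC P A) (X : M.E → Bool) e =>
    decide (∃ f, ProcEdge e f ∧ X f = true) :=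
  (next.map fun _ o => o.any id).congr fun M X => funext fun e => by
    rw [Bool.eq_iff_iff, decide_eq_true_eq]
    simp [Option.any_map, Option.any_eq_true, MSC.next_eq_some]

open Classical in
theorem procEdge_swap : IsTransduction fun (M : MSC P A) (X : M.E → Bool) e =>
    decide (∃ f, ProcEdge f e ∧ X f = true) :=
  (prev.map fun _ o => o.any id).congr fun M X => funext fun e => by
    rw [Bool.eq_iff_iff, decide_eq_true_eq]
    simp [Option.any_map, Option.any_eq_true, MSC.prev_eq_some]

open Classical in
theorem msg : IsTransduction fun (M : MSC P A) (X : M.E → Bool) e =>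
    decide (∃ f, M.msg e f ∧ X f = true) :=
  (snd.map fun _ o => o.any id).congr fun M X => funext fun e => by
    rw [Bool.eq_iff_iff, decide_eq_true_eq]
    simp [Option.any_map, Option.any_eq_true, MSC.snd_eq_some]

open Classical in
theorem msg_swap : IsTransduction fun (M : MSC P A) (X : M.E → Bool) e =>
    decide (∃ f, M.msg f e ∧ X f = true) :=
  (rcv.map fun _ o => o.any id).congr fun M X => funext fun e => by
    rw [Bool.eq_iff_iff, decide_eq_true_eq]
    simp [Option.any_map, Option.any_eq_true, MSC.rcv_eq_some]

open Classical in
theorem or {Q R : ∀ M : MSC P A, M.E → M.E → Prop}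
    (hQ : IsTransduction fun (M : MSC P A) (X : M.E → Bool) e => decide (∃ f, Q M e f ∧ X f = true))
    (hR : IsTransduction fun (M : MSC P A) (X : M.E → Bool) e =>
      decide (∃ f, R M e f ∧ X f = true)) :
    IsTransduction fun (M : MSC P A) (X : M.E → Bool) e =>
      decide (∃ f, (Q M e f ∨ R M e f) ∧ X f = true) :=
  ((hQ.pair hR).map fun _ c => c.1 || c.2).congr fun M X => funext fun e => by
    rw [Bool.eq_iff_iff, decide_eq_true_eq]
    simp [or_and_right, exists_or]

variable [Finite P]

open Classical in
theorem lastMarked : IsTransduction fun (M : MSC P A) (X : M.E → Bool) e =>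
    decide (X e = true ∧ ∀ f, MSC.Before e f → X f = false) :=
  ((id'.pair (nextIn.comp (node fun _ b => (b, ())))).map fun _ c => c.1 && c.2.isNone).congr
    fun M X => funext fun e => by
      rw [Bool.eq_iff_iff, decide_eq_true_eq]
      simp only [Bool.and_eq_true, Option.isNone_iff_eq_none, Option.map_eq_none_iff]
      refine and_congr_right fun _ => ⟨fun h => ?_, fun h f hf => ?_⟩
      · refine Option.eq_none_iff_forall_ne_some.2 fun f hf => ?_
        obtain ⟨h1, h2, -⟩ := MSC.nextIn_eq_some.1 hf
        simp [h f h1] at h2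
      · by_contra hX
        obtain ⟨g, hg, -⟩ := MSC.exists_nextIn hf (Bool.not_eq_false _ ▸ hX : X f = true)
        rw [h] at hg
        cases hg

open Classical in
theorem firstMarked : IsTransduction fun (M : MSC P A) (X : M.E → Bool) e =>
    decide (X e = true ∧ ∀ f, MSC.Before f e → X f = false) :=
  ((id'.pair (prevIn.comp (node fun _ b => (b, ())))).map fun _ c => c.1 && c.2.isNone).congr
    fun M X => funext fun e => by
      rw [Bool.eq_iff_iff, decide_eq_true_eq]
      simp only [Bool.and_eq_true, Option.isNone_iff_eq_none, Option.map_eq_none_iff]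
      refine and_congr_right fun _ => ⟨fun h => ?_, fun h f hf => ?_⟩
      · refine Option.eq_none_iff_forall_ne_some.2 fun f hf => ?_
        obtain ⟨h1, h2, -⟩ := MSC.prevIn_eq_some.1 hf
        simp [h f h1] at h2
      · by_contra hX
        obtain ⟨g, hg, -⟩ := MSC.exists_prevIn hf (Bool.not_eq_false _ ▸ hX : X f = true)
        rw [h] at hg
        cases hg

open Classical in
theorem ltFar : IsTransduction fun (M : MSC P A) (X : M.E → Bool) e =>
    decide (∃ f, (M.lt e f ∧ ¬ (ProcEdge e f ∨ M.msg e f)) ∧ X f = true) := by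
  refine far (bef := fun M => MSC.Before) (adj := fun M e f => ProcEdge e f ∨ M.msg e f)
    (lt := fun M => M.lt) (fun _ _ _ h => h.lt) (fun M _ _ _ h h' => M.lt_trans h h')
    (fun M => M.wf_gt) (fun _ _ _ h => h.1) (fun _ _ _ h => MSC.before_trichotomy h)
    (fun M e f g h h' hfg => ?_) lastMarked future (procEdge.or msg)
  rcases h with h | h <;> rcases h' with h' | h'
  · exact MSC.event_ext hfg (h.2.symm.trans h'.2)
  · exact absurd (h.1.trans hfg) (M.msg_ne _ _ h')
  · exact absurd (h'.1.trans hfg.symm) (M.msg_ne _ _ h)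
  · exact (M.msg_unique _ _ _ _ h h' (Or.inl rfl)).2

open Classical in
theorem gtFar : IsTransduction fun (M : MSC P A) (X : M.E → Bool) e =>
    decide (∃ f, (M.lt f e ∧ ¬ (ProcEdge f e ∨ M.msg f e)) ∧ X f = true) := by
  refine far (bef := fun M e f => MSC.Before f e) (adj := fun M e f => ProcEdge f e ∨ M.msg f e)
    (lt := fun M e f => M.lt f e) (fun _ _ _ h => h.lt) (fun M _ _ _ h h' => M.lt_trans h' h)
    (fun M => M.wf_lt) (fun _ _ _ h => h.1.symm)
    (fun _ _ _ h => (MSC.before_trichotomy h.symm).imp_right (Or.imp_left Eq.symm))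
    (fun M e f g h h' hfg => ?_) firstMarked past (procEdge_swap.or msg_swap)
  rcases h with h | h <;> rcases h' with h' | h'
  · exact MSC.event_ext hfg (Nat.succ_injective (h.2.trans h'.2.symm))
  · exact absurd (hfg.symm.trans h.1) (M.msg_ne _ _ h')
  · exact absurd (hfg.trans h'.1) (M.msg_ne _ _ h)
  · exact (M.msg_unique _ _ _ _ h h' (Or.inr (Or.inr (Or.inr rfl)))).1

open Classical in
/-- The set of relative positions in which an event sees marked events is computed by a
recognizable transduction. -/
theorem kinds : IsTransduction fun (M : MSC P A) (X : M.E → Bool) e (r : Fin 8) =>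
    decide (∃ f, M.Kind r e f ∧ X f = true) := by
  refine pi (Φ := fun r M X e => decide (∃ f, M.Kind r e f ∧ X f = true)) fun r => ?_
  fin_cases r
  · exact id'.congr fun M X => funext fun e => by simp [MSC.Kind]
  · exact procEdge
  · exact procEdge_swap
  · exact msg
  · exact msg_swap
  · exact ltFar
  · exact gtFar
  · exact concurrent.congr fun M X => funext fun e => by simp [MSC.Kind, and_comm]

end IsTransduction

/-- The transduction of relative positions as a tiling with labels `0, …, N`, from which the mark
and the set of positions are read off by `xb` and `yb`. -/
theorem exists_kindTiling [Finite P] : ∃ (N : ℕ) (T : Tiling P (Fin (N + 1)))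
    (xb : Fin (N + 1) → Bool) (yb : Fin (N + 1) → Fin 8 → Bool),
    (∀ (M : MSC P A) c, T.Holds M c →
      ∀ e r, yb (c e) r = true ↔ ∃ f, M.Kind r e f ∧ xb (c f) = true) ∧
    ∀ (M : MSC P A) (X : M.E → Bool), ∃ c, T.Holds M c ∧ ∀ e, xb (c e) = X e := by
  classical
  obtain ⟨Δ, hΔ, T, hT⟩ := IsTransduction.kinds (P := P) (A := A)
  have h1 : ∀ (M : MSC P A) c, T.Holds M c →
      ∀ e r, (c e).1.2 r = true ↔ ∃ f, M.Kind r e f ∧ (c f).1.1 = true := by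
    intro M c hc e r
    have := (hT M fun e => (c e).1).2 ⟨fun e => (c e).2, hc⟩ e
    rw [this, decide_eq_true_iff]
  have h2 : ∀ (M : MSC P A) (X : M.E → Bool), ∃ c, T.Holds M c ∧ ∀ e, (c e).1.1 = X e := by
    intro M X
    obtain ⟨d, hd⟩ := (hT M fun e => (X e, fun r => decide (∃ f, M.Kind r e f ∧ X f = true))).1
      fun e => rfl
    exact ⟨_, hd, fun _ => rfl⟩
  obtain ⟨n, ⟨σ⟩⟩ := Finite.exists_equiv_fin ((Bool × (Fin 8 → Bool)) × Δ)
  rcases n with _ | N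
  · -- Without labels there is no MSC, since every MSC has an event and a labelling.
    have : ∀ M : MSC P A, False := fun M => by
      obtain ⟨p, hp⟩ := M.word_ne
      obtain ⟨c, -⟩ := h2 M fun _ => false
      exact (σ (c ⟨p, ⟨0, List.length_pos_iff.2 hp⟩⟩)).elim0
    exact ⟨0, Tiling.triv, fun _ => false, fun _ _ => false, fun M => (this M).elim,
      fun M => (this M).elim⟩
  · refine ⟨N, T.comap fun _ i => σ.symm i, fun i => (σ.symm i).1.1, fun i => (σ.symm i).1.2,
      fun M c hc => h1 M _ (Tiling.holds_comap.1 hc), fun M X => ?_⟩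
    obtain ⟨c, hc, hX⟩ := h2 M X
    refine ⟨fun e => σ (c e), Tiling.holds_comap.2 ?_, fun e => ?_⟩
    · simpa only [σ.symm_apply_apply] using hc
    · simpa only [σ.symm_apply_apply] using hX e

/-! ### Automation for primitive recursive functions -/

namespace PrimrecAuto

variable {α β σ τ : Type*} [Primcodable α] [Primcodable β] [Primcodable σ] [Primcodable τ]

-- With the following lemmas, `fun_prop` proves that functions are primitive recursive by their
-- shape.
attribute [fun_prop] Primrec
attribute [fun_prop] Primrec.id Primrec.const

@[fun_prop] theorem comp {f : β → σ} {g : α → β} (hf : Primrec f) (hg : Primrec g) :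
    Primrec fun a => f (g a) := hf.comp hg

@[fun_prop] theorem prodMk {f : α → β} {g : α → σ} (hf : Primrec f) (hg : Primrec g) :
    Primrec fun a => (f a, g a) := hf.pair hg

@[fun_prop] theorem prodFst {f : α → β × σ} (hf : Primrec f) : Primrec fun a => (f a).1 :=
  Primrec.fst.comp hf

@[fun_prop] theorem prodSnd {f : α → β × σ} (hf : Primrec f) : Primrec fun a => (f a).2 :=
  Primrec.snd.comp hf

@[fun_prop] theorem natAdd {f g : α → ℕ} (hf : Primrec f) (hg : Primrec g) :
    Primrec fun a => f a + g a := Primrec.nat_add.comp hf hg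

@[fun_prop] theorem natMax {f g : α → ℕ} (hf : Primrec f) (hg : Primrec g) :
    Primrec fun a => max (f a) (g a) := Primrec.nat_max.comp hf hg

@[fun_prop] theorem eq [DecidableEq β] {f g : α → β} (hf : Primrec f) (hg : Primrec g) :
    Primrec fun a => decide (f a = g a) := Primrec.eq.decide.comp hf hg

@[fun_prop] theorem natLt {f g : α → ℕ} (hf : Primrec f) (hg : Primrec g) :
    Primrec fun a => decide (f a < g a) := Primrec.nat_lt.decide.comp hf hg

@[fun_prop] theorem and {f g : α → Bool} (hf : Primrec f) (hg : Primrec g) :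
    Primrec fun a => f a && g a := Primrec.and.comp hf hg

@[fun_prop] theorem or {f g : α → Bool} (hf : Primrec f) (hg : Primrec g) :
    Primrec fun a => f a || g a := Primrec.or.comp hf hg

@[fun_prop] theorem not {f : α → Bool} (hf : Primrec f) : Primrec fun a => ! f a :=
  Primrec.not.comp hf

@[fun_prop] theorem cond {c : α → Bool} {f g : α → σ} (hc : Primrec c) (hf : Primrec f)
    (hg : Primrec g) : Primrec fun a => bif c a then f a else g a := Primrec.cond hc hf hg

@[fun_prop] theorem optionSome {f : α → σ} (hf : Primrec f) : Primrec fun a => some (f a) :=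
  Primrec.option_some.comp hf

@[fun_prop] theorem optionGetD {f : α → Option σ} {g : α → σ} (hf : Primrec f) (hg : Primrec g) :
    Primrec fun a => (f a).getD (g a) := Primrec.option_getD.comp hf hg

@[fun_prop] theorem optionMap {f : α → Option β} {g : α → β → σ} (hf : Primrec f)
    (hg : Primrec fun p : α × β => g p.1 p.2) : Primrec fun a => (f a).map (g a) :=
  Primrec.option_map hf hg

@[fun_prop] theorem optionElim {f : α → Option β} {d : α → σ} {g : α → β → σ} (hf : Primrec f)
    (hd : Primrec d) (hg : Primrec fun p : α × β => g p.1 p.2) :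
    Primrec fun a => (f a).elim (d a) (g a) :=
  (Primrec.option_casesOn hf hd hg).of_eq fun a => by cases f a <;> rfl

@[fun_prop] theorem sumInl {f : α → σ} (hf : Primrec f) :
    Primrec fun a => (Sum.inl (f a) : σ ⊕ τ) := Primrec.sumInl.comp hf

@[fun_prop] theorem sumInr {f : α → τ} (hf : Primrec f) :
    Primrec fun a => (Sum.inr (f a) : σ ⊕ τ) := Primrec.sumInr.comp hf

@[fun_prop] theorem sumElim {f : α → β ⊕ τ} {g : α → β → σ} {h : α → τ → σ} (hf : Primrec f)
    (hg : Primrec fun p : α × β => g p.1 p.2) (hh : Primrec fun p : α × τ => h p.1 p.2) :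
    Primrec fun a => (f a).elim (g a) (h a) :=
  (Primrec.sumCasesOn hf hg hh).of_eq fun a => by cases f a <;> rfl

@[fun_prop] theorem encode {f : α → β} (hf : Primrec f) :
    Primrec fun a => Encodable.encode (f a) := Primrec.encode.comp hf

@[fun_prop] theorem finVal {n : ℕ} {f : α → Fin n} (hf : Primrec f) :
    Primrec fun a => (f a : ℕ) := Primrec.fin_val.comp hf

@[fun_prop] theorem listCons {f : α → β} {g : α → List β} (hf : Primrec f) (hg : Primrec g) :
    Primrec fun a => f a :: g a := Primrec.list_cons.comp hf hg

@[fun_prop] theorem listAppend {f g : α → List β} (hf : Primrec f) (hg : Primrec g) :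
    Primrec fun a => f a ++ g a := Primrec.list_append.comp hf hg

@[fun_prop] theorem listMap {f : α → List β} {g : α → β → σ} (hf : Primrec f)
    (hg : Primrec fun p : α × β => g p.1 p.2) : Primrec fun a => (f a).map (g a) :=
  Primrec.list_map hf hg

@[fun_prop] theorem listFlatMap {f : α → List β} {g : α → β → List σ} (hf : Primrec f)
    (hg : Primrec fun p : α × β => g p.1 p.2) : Primrec fun a => (f a).flatMap (g a) :=
  Primrec.list_flatMap hf hg

@[fun_prop] theorem listFoldr {f : α → List β} {d : α → σ} {g : α → β → σ → σ} (hf : Primrec f)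
    (hd : Primrec d) (hg : Primrec fun p : α × β × σ => g p.1 p.2.1 p.2.2) :
    Primrec fun a => (f a).foldr (g a) (d a) :=
  Primrec.list_foldr hf hd (h := fun a p => g a p.1 p.2) hg

@[fun_prop] theorem listAny {f : α → List β} {g : α → β → Bool} (hf : Primrec f)
    (hg : Primrec fun p : α × β => g p.1 p.2) : Primrec fun a => (f a).any (g a) := by
  have : Primrec fun a => (f a).foldr (fun b r => g a b || r) false := by fun_prop
  exact this.of_eq fun a => by induction f a <;> simp_all

@[fun_prop] theorem listAll {f : α → List β} {g : α → β → Bool} (hf : Primrec f)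
    (hg : Primrec fun p : α × β => g p.1 p.2) : Primrec fun a => (f a).all (g a) := by
  have : Primrec fun a => (f a).foldr (fun b r => g a b && r) true := by fun_prop
  exact this.of_eq fun a => by induction f a <;> simp_all

@[fun_prop] theorem listFilter {f : α → List β} {g : α → β → Bool} (hf : Primrec f)
    (hg : Primrec fun p : α × β => g p.1 p.2) : Primrec fun a => (f a).filter (g a) := by
  have : Primrec fun a => (f a).foldr (fun b r => bif g a b then b :: r else r) [] := by fun_prop
  exact this.of_eq fun a => by
    induction f a with
    | nil => rfl
    | cons b l ih => rw [List.foldr_cons, ih, List.filter_cons]; cases g a b <;> rfl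

@[fun_prop] theorem listRange {f : α → ℕ} (hf : Primrec f) :
    Primrec fun a => List.range (f a) := Primrec.list_range.comp hf

@[fun_prop] theorem listLength {f : α → List β} (hf : Primrec f) :
    Primrec fun a => (f a).length := Primrec.list_length.comp hf

@[fun_prop] theorem listTail {f : α → List β} (hf : Primrec f) :
    Primrec fun a => (f a).tail := Primrec.list_tail.comp hf

@[fun_prop] theorem listDrop {f : α → ℕ} {g : α → List β} (hf : Primrec f) (hg : Primrec g) :
    Primrec fun a => (g a).drop (f a) := Primrec.list_drop.comp hf hg

@[fun_prop] theorem listGetElem? {f : α → List β} {g : α → ℕ} (hf : Primrec f) (hg : Primrec g) :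
    Primrec fun a => (f a)[g a]? := Primrec.list_getElem?.comp hf hg

@[fun_prop] theorem listGetD {f : α → List β} {g : α → ℕ} {d : α → β} (hf : Primrec f)
    (hg : Primrec g) (hd : Primrec d) : Primrec fun a => (f a).getD (g a) (d a) := by
  have : Primrec fun a => ((f a)[g a]?).getD (d a) := by fun_prop
  exact this.of_eq fun a => by rw [List.getD_eq_getElem?_getD]

@[fun_prop] theorem listHeadD {f : α → List β} {d : α → β} (hf : Primrec f) (hd : Primrec d) :
    Primrec fun a => (f a).headD (d a) := by
  have : Primrec fun a => ((f a)[0]?).getD (d a) := by fun_prop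
  exact this.of_eq fun a => by cases f a <;> rfl

theorem finApp {n : ℕ} {f : α → Fin n → σ} {i : α → Fin n} (hf : Primrec f)
    (hi : Primrec i) : Primrec fun a => f a (i a) := Primrec.fin_app.comp hf hi

theorem finLam {n : ℕ} {f : α → Fin n → σ} (hf : ∀ i, Primrec fun a => f a i) : Primrec f :=
  Primrec.fin_curry.2 (Primrec.fin_curry₁.2 hf).swap

end PrimrecAuto

/-! ### Descriptions of machines from local constraints -/

/-- The lists of length `n` with entries from the list `L`. -/
def allLists {α : Type*} (n : ℕ) (L : List α) : List (List α) :=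
  (List.range n).foldr (fun _ ls => L.flatMap fun x => ls.map fun l => x :: l) [[]]

theorem mem_allLists {α : Type*} {n : ℕ} {L l : List α} :
    l ∈ allLists n L ↔ l.length = n ∧ ∀ x ∈ l, x ∈ L := by
  have key : ∀ (r : List ℕ) (l : List α),
      l ∈ r.foldr (fun _ ls => L.flatMap fun x => ls.map fun l => x :: l) [[]] ↔
        l.length = r.length ∧ ∀ x ∈ l, x ∈ L := by
    intro r
    induction r with
    | nil => intro l; simp +contextual [List.length_eq_zero_iff]
    | cons a r ih =>
      intro l
      simp only [List.foldr_cons, List.mem_flatMap, List.mem_map, ih]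
      constructor
      · rintro ⟨x, hx, l, ⟨h1, h2⟩, rfl⟩
        simpa [h1, hx] using h2
      · rintro ⟨h1, h2⟩
        rcases l with _ | ⟨x, l⟩
        · simp at h1
        · exact ⟨x, h2 x (by simp), l, ⟨by simpa using h1, fun y hy => h2 y (by simp [hy])⟩, rfl⟩
  simpa [allLists] using key (List.range n) l

@[fun_prop] theorem primrec_allLists {α β : Type*} [Primcodable α] [Primcodable β] {f : β → ℕ}
    {g : β → List α} (hf : Primrec f) (hg : Primrec g) :
    Primrec fun b => allLists (f b) (g b) := by
  unfold allLists
  fun_prop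

theorem le_foldr_max {L : List ℕ} {a : ℕ} (h : a ∈ L) : a ≤ L.foldr max 0 := by
  induction L with
  | nil => cases h
  | cons b L ih =>
    rcases List.mem_cons.1 h with rfl | h
    · exact le_max_left _ _
    · exact (ih h).trans (le_max_right _ _)

/-- Decidable local constraints on labellings by entries of the list `labels`: a tiling for the
processes `0, …, k - 1`, with an additional constraint `node` that involves the label in
`0, …, l - 1` which the MSC itself attaches to an event. -/
structure Blueprint (k l : ℕ) (Γ : Type) where
  labels : List Γ
  node : Fin k → Fin l → Γ → Bool
  first : Fin k → Γ → Bool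
  step : Fin k → Γ → Γ → Bool
  int : Fin k → Γ → Bool
  msg : Fin k → Γ → Fin k → Γ → Bool
  fin : (Fin k → Option Γ) → Bool

namespace Blueprint

variable {k l : ℕ} {Γ : Type}

/-- The labelling `c` of `M` satisfies the constraints. -/
structure Accepts (B : Blueprint k l Γ) (numP : P ≃ Fin k) (numA : A ≃ Fin l) (M : MSC P A)
    (c : M.E → Γ) : Prop where
  mem : ∀ e, c e ∈ B.labels
  node : ∀ e, B.node (numP e.1) (numA (M.label e)) (c e) = true
  first : ∀ e, M.prev e = none → B.first (numP e.1) (c e) = true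
  step : ∀ e f : M.E, ProcEdge e f → B.step (numP e.1) (c e) (c f) = true
  int : ∀ e, M.IsInternal e → B.int (numP e.1) (c e) = true
  msg : ∀ e f, M.msg e f → B.msg (numP e.1) (c e) (numP f.1) (c f) = true
  fin : B.fin (fun i => M.lastLabel c (numP.symm i)) = true

/-- A transition in the making: the label of the preceding event, the label of the event, the
letter read, and, for a send (`true`) or receive (`false`) action, the label and process at
the other end. -/
abbrev Move (k l : ℕ) (Γ : Type) : Type := Option Γ × Γ × Fin l × Option (Bool × Γ × Fin k)

/-- All transitions in the making with labels from the list `L`. -/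
def moves (L : List Γ) : List (Move k l Γ) :=
  (none :: L.map some).flatMap fun o => L.flatMap fun c =>
    (List.finRange l).flatMap fun a => (none :: [true, false].flatMap fun b =>
      L.flatMap fun d => (List.finRange k).map fun q => some (b, d, q)).map fun x =>
        (o, c, a, x)

theorem mem_moves {L : List Γ} {o : Option Γ} {c : Γ} {a : Fin l}
    {x : Option (Bool × Γ × Fin k)} : (o, c, a, x) ∈ moves L ↔
      (∀ d ∈ o, d ∈ L) ∧ c ∈ L ∧ ∀ y ∈ x, y.2.1 ∈ L := by
  rcases o with _ | o <;> rcases x with _ | ⟨b, d, q⟩ <;> simp [moves]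
  all_goals cases b <;> aesop

/-- The constraints that a transition of process `p` has to satisfy. -/
def ok (B : Blueprint k l Γ) (p : Fin k) (t : Move k l Γ) : Bool :=
  B.node p t.2.2.1 t.2.1 &&
    (t.1.elim (B.first p t.2.1) (fun c => B.step p c t.2.1) &&
      t.2.2.2.elim (B.int p t.2.1) fun x =>
        bif x.1 then B.msg p t.2.1 x.2.2 x.2.1 else B.msg x.2.2 x.2.1 p t.2.1)

variable [Primcodable Γ]

/-- The action of a transition: the message on an edge consists of the labels of its two ends. -/
def action (t : Move k l Γ) : ActCode k l :=
  t.2.2.2.elim (Sum.inl t.2.2.1) fun x => Sum.inr (t.2.2.1, x.1,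
    (bif x.1 then Encodable.encode (t.2.1, x.2.1) else Encodable.encode (x.2.1, t.2.1)), x.2.2)

/-- The description of a machine that guesses a labelling and checks the constraints: the state of
a process is the label of its last event, or `none` at the start. -/
def code (B : Blueprint k l Γ) : CFMCode k l :=
  (fun _ => (B.labels.map fun c => Encodable.encode (some c)).foldr (fun a b => max a b) 0,
    (B.labels.flatMap fun c => B.labels.map fun d => Encodable.encode (c, d) + 1).foldr
      (fun a b => max a b) 0,
    fun p => ((moves B.labels).filter fun t => B.ok p t).map fun t =>
      (Encodable.encode t.1, action t, Encodable.encode (some t.2.1)),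
    ((allLists k (none :: B.labels.map some)).filter fun o => B.fin fun i => o.getD i none).map
      fun o i => Encodable.encode (o.getD i none))

theorem encode_le {B : Blueprint k l Γ} {o : Option Γ} (h : ∀ c ∈ o, c ∈ B.labels) (p : Fin k) :
    Encodable.encode o < B.code.1 p + 1 := by
  rcases o with _ | c
  · exact Nat.succ_pos _
  · exact Nat.lt_succ_of_le (le_foldr_max (List.mem_map.2 ⟨c, h c rfl, rfl⟩))

theorem encode_lt {B : Blueprint k l Γ} {c d : Γ} (hc : c ∈ B.labels) (hd : d ∈ B.labels) :
    Encodable.encode (c, d) < B.code.2.1 :=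
  Nat.lt_of_succ_le (le_foldr_max (List.mem_flatMap.2 ⟨c, hc, List.mem_map.2 ⟨d, hd, rfl⟩⟩))

theorem mem_trans {B : Blueprint k l Γ} {p : Fin k} {s s' : ℕ} {α : ActCode k l} :
    (s, α, s') ∈ B.code.2.2.1 p ↔ ∃ t ∈ moves B.labels, B.ok p t = true ∧
      Encodable.encode t.1 = s ∧ action t = α ∧ Encodable.encode (some t.2.1) = s' := by
  simp only [code, List.mem_map, List.mem_filter, Prod.mk.injEq, and_assoc]

theorem mem_acc {B : Blueprint k l Γ} {g : Fin k → ℕ} :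
    g ∈ B.code.2.2.2 ↔ ∃ o : Fin k → Option Γ, (∀ i, ∀ c ∈ o i, c ∈ B.labels) ∧ B.fin o = true ∧
      g = fun i => Encodable.encode (o i) := by
  simp only [code, List.mem_map, List.mem_filter, mem_allLists]
  constructor
  · rintro ⟨o, ⟨⟨h1, h2⟩, h3⟩, rfl⟩
    refine ⟨fun i => o.getD i none, fun i c hc => ?_, h3, rfl⟩
    have hi : (i : ℕ) < o.length := h1 ▸ i.2
    have := h2 _ (List.getElem_mem hi)
    beta_reduce at hc
    rw [List.getD_eq_getElem _ _ hi] at hc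
    rw [Option.mem_def.1 hc] at this
    simpa using this
  · rintro ⟨o, h1, h2, rfl⟩
    have ho : ∀ i : Fin k, (List.ofFn o).getD i none = o i := fun i => by
      rw [List.getD_eq_getElem _ _ (by simp)]
      simp
    refine ⟨List.ofFn o, ⟨⟨by simp, fun x hx => ?_⟩, ?_⟩, ?_⟩
    · obtain ⟨i, rfl⟩ := List.mem_ofFn.1 hx
      rcases hi : o i with _ | c
      · simp
      · simpa using h1 i c hi
    · simpa only [ho] using h2
    · simp only [ho]

/-- The labels involved in a transition satisfy the constraints on the event that takes it. -/
theorem run_mem_ok {B : Blueprint k l Γ} {numP : P ≃ Fin k} {numA : A ≃ Fin l} {p : P}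
    {t : CFMTrans P A (Fin B.code.2.1) (Fin (B.code.1 (numP p) + 1)) p}
    (h : t ∈ (B.code.toCFM numP numA).Δ p) : ∃ (o : Option Γ) (c : Γ), c ∈ B.labels ∧
      (t.source : ℕ) = Encodable.encode o ∧ (t.target : ℕ) = Encodable.encode (some c) ∧
      B.node (numP p) (numA t.act.label) c = true ∧
      (o.elim (B.first (numP p) c) fun d => B.step (numP p) d c) = true ∧
      (t.act.IsInternal → B.int (numP p) c = true) ∧
      (∀ m q, t.act.IsSend m q → ∃ d : Γ, (m : ℕ) = Encodable.encode (c, d) ∧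
        B.msg (numP p) c (numP q) d = true) ∧
      ∀ m q, t.act.IsRecv m q → ∃ d : Γ, (m : ℕ) = Encodable.encode (d, c) := by
  obtain ⟨⟨o, c, a, x⟩, hm, hok, h1, h2, h3⟩ := mem_trans.1 h
  obtain ⟨-, hc, -⟩ := mem_moves.1 hm
  simp only [ok, Bool.and_eq_true] at hok
  obtain ⟨ok1, ok2, ok3⟩ := hok
  refine ⟨o, c, hc, h1.symm, h3.symm, ?_, ok2, ?_⟩
  · rcases t with ⟨s, act, s'⟩
    rcases x with _ | ⟨b, d, q⟩ <;> rcases act with _ | _ | _ <;>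
      simp_all [action, Act.code, Act.label]
  · rcases t with ⟨s, act, s'⟩
    rcases x with _ | ⟨_ | _, d, q⟩ <;> rcases act with a | ⟨a, m, q'⟩ | ⟨a, m, q'⟩ <;>
      simp_all [action, Act.code, Act.IsInternal, Act.IsSend, Act.IsRecv]
    · exact ⟨d, h2.2.1.symm⟩
    · exact ⟨d, h2.2.1.symm, h2.2.2 ▸ ok3⟩

/-- From an accepted labelling, a transition for each event, with source, target and message given
by the labels. -/
theorem exists_run_step {B : Blueprint k l Γ} {numP : P ≃ Fin k} {numA : A ≃ Fin l} {M : MSC P A}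
    {c : M.E → Γ} (hc : B.Accepts numP numA M c) (e : M.E) :
    ∃ t : CFMTrans P A (Fin B.code.2.1) (Fin (B.code.1 (numP e.1) + 1)) e.1,
      t ∈ (B.code.toCFM numP numA).Δ e.1 ∧ t.act.label = M.label e ∧
      (t.source : ℕ) = Encodable.encode ((M.prev e).map c) ∧
      (t.target : ℕ) = Encodable.encode (some (c e)) ∧
      (M.IsInternal e → t.act.IsInternal) ∧
      (∀ f, M.msg e f → t.act.IsSend ⟨_, encode_lt (hc.mem e) (hc.mem f)⟩ f.1) ∧
      ∀ f, M.msg f e → t.act.IsRecv ⟨_, encode_lt (hc.mem f) (hc.mem e)⟩ f.1 := by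
  have hsrc : ∀ d ∈ (M.prev e).map c, d ∈ B.labels := by
    intro d hd
    obtain ⟨f, -, rfl⟩ := Option.map_eq_some_iff.1 hd
    exact hc.mem f
  have htgt : ∀ d ∈ some (c e), d ∈ B.labels := fun d hd => Option.some_inj.1 hd ▸ hc.mem e
  have hpre : (((M.prev e).map c).elim (B.first (numP e.1) (c e)) fun d =>
      B.step (numP e.1) d (c e)) = true := by
    rcases hp : M.prev e with _ | f
    · exact hc.first e hp
    · have hf := MSC.prev_eq_some.1 hp
      exact hf.1 ▸ hc.step f e hf
  -- In each of the three cases, it remains to find the action and the other end of its message.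
  have key : ∀ (act : Act P A (Fin B.code.2.1) e.1) (x : Option (Bool × Γ × Fin k)),
      (∀ y ∈ x, y.2.1 ∈ B.labels) → act.label = M.label e →
      action ((M.prev e).map c, c e, numA (M.label e), x) = act.code numP numA →
      (x.elim (B.int (numP e.1) (c e)) fun x => bif x.1 then B.msg (numP e.1) (c e) x.2.2 x.2.1
        else B.msg x.2.2 x.2.1 (numP e.1) (c e)) = true →
      (⟨⟨_, encode_le hsrc (numP e.1)⟩, act, ⟨_, encode_le htgt (numP e.1)⟩⟩ :
        CFMTrans P A (Fin B.code.2.1) (Fin (B.code.1 (numP e.1) + 1)) e.1) ∈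
          (B.code.toCFM numP numA).Δ e.1 := by
    intro act x hx hl hact hxe
    refine mem_trans.2 ⟨_, mem_moves.2 ⟨hsrc, hc.mem e, hx⟩, ?_, rfl, hact, rfl⟩
    simp only [ok, Bool.and_eq_true]
    exact ⟨hc.node e, hpre, hxe⟩
  by_cases hint : M.IsInternal e
  · exact ⟨_, key (.internal (M.label e)) none (by simp) rfl rfl (hc.int e hint), rfl, rfl, rfl,
      fun _ => trivial, fun f hf => absurd hf (hint f).1, fun f hf => absurd hf (hint f).2⟩
  · simp only [MSC.IsInternal, not_forall] at hint
    obtain ⟨f, hf⟩ := hint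
    by_cases hef : M.msg e f
    · refine ⟨_, key (.send (M.label e) ⟨_, encode_lt (hc.mem e) (hc.mem f)⟩
        ⟨f.1, (M.msg_ne e f hef).symm⟩) (some (true, c f, numP f.1)) (by simp [hc.mem f]) rfl rfl
        (hc.msg e f hef), rfl, rfl, rfl, fun h => absurd hef (h f).1, fun g hg => ?_,
        fun g hg => ?_⟩
      · obtain rfl := (M.msg_unique _ _ _ _ hef hg (Or.inl rfl)).2
        exact ⟨rfl, rfl⟩
      · obtain rfl := (M.msg_unique _ _ _ _ hef hg (Or.inr (Or.inl rfl))).1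
        exact absurd rfl (M.msg_ne _ _ hg)
    · have hfe : M.msg f e := by tauto
      refine ⟨_, key (.recv (M.label e) ⟨_, encode_lt (hc.mem f) (hc.mem e)⟩
        ⟨f.1, M.msg_ne f e hfe⟩) (some (false, c f, numP f.1)) (by simp [hc.mem f]) rfl rfl
        (hc.msg f e hfe), rfl, rfl, rfl, fun h => absurd hfe (h f).2, fun g hg => ?_,
        fun g hg => ?_⟩
      · obtain rfl := (M.msg_unique _ _ _ _ hfe hg (Or.inr (Or.inr (Or.inl rfl)))).1
        exact absurd rfl (M.msg_ne _ _ hfe)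
      · obtain rfl := (M.msg_unique _ _ _ _ hfe hg (Or.inr (Or.inr (Or.inr rfl)))).1
        exact ⟨rfl, rfl⟩

/-- The machine of a blueprint accepts precisely the MSCs with an accepted labelling. -/
theorem mem_language_code {B : Blueprint k l Γ} {numP : P ≃ Fin k} {numA : A ≃ Fin l}
    {M : MSC P A} : M ∈ (B.code.toCFM numP numA).language ↔ ∃ c, B.Accepts numP numA M c := by
  constructor
  · rintro ⟨ρ, hρ, o, ho, hacc⟩
    choose pr c h1 h2 h3 h4 h5 h6 h7 h8 using fun e => run_mem_ok (hρ.mem e)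
    have hfirst : ∀ e, M.prev e = none → pr e = none := by
      rintro ⟨p, i⟩ he
      have h := hρ.init p i (MSC.prev_eq_none.1 he)
      refine Encodable.encode_injective ((h2 _).symm.trans ?_)
      rw [h]
      rfl
    have hstep : ∀ e f : M.E, ProcEdge e f → pr f = some (c e) := by
      rintro ⟨p, i⟩ ⟨q, j⟩ h
      obtain rfl : p = q := h.1
      refine Encodable.encode_injective ((h2 _).symm.trans (Eq.trans ?_ (h3 _)))
      rw [hρ.step p i j h]
    refine ⟨c, h1, fun e => hρ.label e ▸ h4 e, fun e he => ?_, fun e f hef => ?_,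
      fun e he => h6 e (hρ.internal e he), fun e f hef => ?_, ?_⟩
    · have := h5 e
      rwa [hfirst e he] at this
    · have := h5 f
      rw [hstep e f hef] at this
      exact hef.1 ▸ this
    · obtain ⟨m, hs, hr⟩ := hρ.message e f hef
      obtain ⟨d, hd, hmsg⟩ := h7 e m _ hs
      obtain ⟨d', hd'⟩ := h8 f m _ hr
      obtain ⟨-, rfl⟩ := Prod.ext_iff.1 (Encodable.encode_injective (hd.symm.trans hd'))
      exact hmsg
    · obtain ⟨s, hs, hfin, rfl⟩ := mem_acc.1 ho
      convert hfin using 2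
      funext i
      refine Encodable.encode_injective (Eq.trans ?_ ((hacc (numP.symm i)).trans ?_))
      · unfold CFM.lastState MSC.lastLabel
        split_ifs
        · exact (h3 _).symm
        · rfl
      · simp only [Equiv.apply_symm_apply]
  · rintro ⟨c, hc⟩
    choose ρ h1 h2 h3 h4 h5 h6 h7 using exists_run_step hc
    refine ⟨ρ, ⟨h1, h2, fun p i hi => ?_, fun p i j hij => ?_, h5, fun e f hef =>
      ⟨_, h6 e f hef, h7 f e hef⟩⟩, _, mem_acc.2 ⟨fun i => M.lastLabel c (numP.symm i),
      fun i d hd => ?_, hc.fin, rfl⟩, fun p => ?_⟩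
    · apply Fin.ext
      rw [h3, MSC.prev_eq_none.2 hi]
      rfl
    · apply Fin.ext
      rw [h4, h3, MSC.prev_eq_some.2 hij]
      rfl
    · obtain ⟨e, -, -, rfl⟩ := MSC.lastLabel_eq_some.1 hd
      exact hc.mem e
    · simp only [Equiv.symm_apply_apply]
      unfold CFM.lastState MSC.lastLabel
      split_ifs
      · exact h4 _
      · rfl

open PrimrecAuto in
/-- If the parts of a blueprint depend on a parameter in a primitive recursive way, so does the
description of its machine. -/
theorem primrec_code {α : Type*} [Primcodable α] {B : α → Blueprint k l Γ}
    (h1 : Primrec fun a => (B a).labels)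
    (h2 : Primrec fun x : α × Fin k × Fin l × Γ => (B x.1).node x.2.1 x.2.2.1 x.2.2.2)
    (h3 : Primrec fun x : α × Fin k × Γ => (B x.1).first x.2.1 x.2.2)
    (h4 : Primrec fun x : α × Fin k × Γ × Γ => (B x.1).step x.2.1 x.2.2.1 x.2.2.2)
    (h5 : Primrec fun x : α × Fin k × Γ => (B x.1).int x.2.1 x.2.2)
    (h6 : Primrec fun x : α × (Fin k × Γ) × Fin k × Γ =>
      (B x.1).msg x.2.1.1 x.2.1.2 x.2.2.1 x.2.2.2)
    (h7 : Primrec fun x : α × (Fin k → Option Γ) => (B x.1).fin x.2) :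
    Primrec fun a => (B a).code := by
  have hmoves : Primrec fun L : List Γ => (moves L : List (Move k l Γ)) := by
    unfold moves
    fun_prop
  have hbound : Primrec fun L : List Γ =>
      (L.map fun c => Encodable.encode (some c)).foldr (fun a b => max a b) 0 := by fun_prop
  have hbound' : Primrec fun L : List Γ =>
      (L.flatMap fun c => L.map fun d => Encodable.encode (c, d) + 1).foldr
        (fun a b => max a b) 0 := by fun_prop
  have hact : Primrec fun t : Move k l Γ => (action t : ActCode k l) := by
    unfold action
    fun_prop
  have hok : ∀ p, Primrec fun x : α × Move k l Γ => (B x.1).ok p x.2 := by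
    intro p
    refine and (h2.comp (show Primrec fun x : α × Move k l Γ =>
      (x.1, p, x.2.2.2.1, x.2.2.1) by fun_prop)) (and (optionElim (by fun_prop)
      (h3.comp (show Primrec fun x : α × Move k l Γ => (x.1, p, x.2.2.1) by fun_prop))
      (h4.comp (show Primrec fun y : (α × Move k l Γ) × Γ =>
        (y.1.1, p, y.2, y.1.2.2.1) by fun_prop))) (optionElim (by fun_prop)
      (h5.comp (show Primrec fun x : α × Move k l Γ => (x.1, p, x.2.2.1) by fun_prop))
      (cond (by fun_prop)
        (h6.comp (show Primrec fun y : (α × Move k l Γ) × Bool × Γ × Fin k =>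
          (y.1.1, (p, y.1.2.2.1), (y.2.2.2, y.2.2.1)) by fun_prop))
        (h6.comp (show Primrec fun y : (α × Move k l Γ) × Bool × Γ × Fin k =>
          (y.1.1, (y.2.2.2, y.2.2.1), (p, y.1.2.2.1)) by fun_prop)))))
  have hlists : Primrec fun L : List Γ => allLists k (none :: L.map some) := by fun_prop
  refine prodMk (finLam fun i => hbound.comp h1) (prodMk (hbound'.comp h1) (prodMk
    (finLam fun p => listMap (listFilter (hmoves.comp h1) (hok p)) ?_)
    (listMap (listFilter (hlists.comp h1) ?_) ?_)))
  · have : Primrec fun t : Move k l Γ =>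
        (Encodable.encode t.1, (action t : ActCode k l), Encodable.encode (some t.2.1)) := by
      fun_prop
    exact this.comp Primrec.snd
  · have : Primrec fun (o : List (Option Γ)) (i : Fin k) => o.getD i none :=
      finLam fun i => by fun_prop
    exact h7.comp (prodMk Primrec.fst (this.comp Primrec.snd))
  · exact finLam fun i => by fun_prop

end Blueprint

/-! ### Evaluation of formulas in Polish notation -/

namespace Polish

variable {k l : ℕ}

/-- All that the evaluation of a formula needs to know about an event: its process, its label, and a
list of truth values, namely those of the set variables followed by those of the quantified
subformulas. -/
abbrev Letter (k l : ℕ) : Type := Fin k × Fin l × List Bool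

/-- The letter assigned to the variable `u`, if `x` and `y` are assigned to the two variables. -/
def pick (u : ℕ) (x y : Letter k l) : Letter k l := bif decide (u = 0) then x else y

/-- The position of variable `w` relative to variable `u`, if that of the second variable relative
to the first is `r`. -/
def relKind (r : Fin 8) (u w : ℕ) : Fin 8 :=
  bif decide (u = w) then 0 else bif decide (u = 0) then r else MSC.flipKind r

/-- One step of the evaluation of a string of symbols from right to left. The state consists of the
number of symbols read and a stack of truth values. The two variables have the letters `x` and
`y`, and the position `r` relative to each other. The value of a quantified subformula, which
depends on the other variable only, is looked up in the letter of that variable, at a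
position given by the number of symbols to the right of the quantifier. -/
def evalStep (n : ℕ) (x y : Letter k l) (r : Fin 8) (s : ℕ × ℕ × ℕ) (t : ℕ × List Bool) :
    ℕ × List Bool :=
  (t.1 + 1,
    bif decide (s.1 = 0) then decide (((pick s.2.2 x y).1 : ℕ) = s.2.1) :: t.2
    else bif decide (s.1 = 1) then decide (((pick s.2.2 x y).2.1 : ℕ) = s.2.1) :: t.2
    else bif decide (s.1 = 2) then
      (decide (s.2.2 < n) && (pick s.2.1 x y).2.2.getD s.2.2 false) :: t.2
    else bif decide (s.1 = 3) then decide (relKind r s.2.1 s.2.2 = 0) :: t.2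
    else bif decide (s.1 = 4) then decide (relKind r s.2.1 s.2.2 = 1) :: t.2
    else bif decide (s.1 = 5) then decide (relKind r s.2.1 s.2.2 = 3) :: t.2
    else bif decide (s.1 = 6) then
      (decide (relKind r s.2.1 s.2.2 = 0) || (decide (relKind r s.2.1 s.2.2 = 1) ||
        (decide (relKind r s.2.1 s.2.2 = 3) || decide (relKind r s.2.1 s.2.2 = 5)))) :: t.2
    else bif decide (s.1 = 7) then (t.2.headD false || t.2.tail.headD false) :: t.2.tail.tail
    else bif decide (s.1 = 8) then (! t.2.headD false) :: t.2.tail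
    else (pick s.2.1 y x).2.2.getD (n + t.1) false :: t.2.tail)

/-- The final state of the evaluation of a string of symbols. -/
def eval (n : ℕ) (x y : Letter k l) (r : Fin 8) (S : List (ℕ × ℕ × ℕ)) : ℕ × List Bool :=
  S.foldr (fun s t => evalStep n x y r s t) (0, [])

/-- The truth value of the formula `S` if the variable `u` has the letter `z`, the other variable
has the letter `x`, and `r` is the position of `u` relative to the other variable. -/
def value (n u : ℕ) (S : List (ℕ × ℕ × ℕ)) (x z : Letter k l) (r : Fin 8) : Bool :=
  bif decide (u = 0) then (eval n z x (MSC.flipKind r) S).2.headD false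
  else (eval n x z r S).2.headD false

section Primrec

variable {α : Type*} [Primcodable α]

@[fun_prop] theorem primrec_flipKind {f : α → Fin 8} (hf : Primrec f) :
    Primrec fun a => MSC.flipKind (f a) := (Primrec.dom_finite MSC.flipKind).comp hf

@[fun_prop] theorem primrec_pick {u : α → ℕ} {x y : α → Letter k l} (hu : Primrec u)
    (hx : Primrec x) (hy : Primrec y) : Primrec fun a => pick (u a) (x a) (y a) := by
  unfold pick
  fun_prop

@[fun_prop] theorem primrec_relKind {r : α → Fin 8} {u w : α → ℕ} (hr : Primrec r)
    (hu : Primrec u) (hw : Primrec w) : Primrec fun a => relKind (r a) (u a) (w a) := by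
  unfold relKind
  fun_prop

@[fun_prop] theorem primrec_evalStep {n : α → ℕ} {x y : α → Letter k l} {r : α → Fin 8}
    {s : α → ℕ × ℕ × ℕ} {t : α → ℕ × List Bool} (hn : Primrec n) (hx : Primrec x) (hy : Primrec y)
    (hr : Primrec r) (hs : Primrec s) (ht : Primrec t) :
    Primrec fun a => evalStep (n a) (x a) (y a) (r a) (s a) (t a) := by
  unfold evalStep
  fun_prop

@[fun_prop] theorem primrec_eval {n : α → ℕ} {x y : α → Letter k l} {r : α → Fin 8}
    {S : α → List (ℕ × ℕ × ℕ)} (hn : Primrec n) (hx : Primrec x) (hy : Primrec y)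
    (hr : Primrec r) (hS : Primrec S) :
    Primrec fun a => eval (n a) (x a) (y a) (r a) (S a) := by
  unfold eval
  fun_prop

@[fun_prop] theorem primrec_value {n u : α → ℕ} {S : α → List (ℕ × ℕ × ℕ)} {x z : α → Letter k l}
    {r : α → Fin 8} (hn : Primrec n) (hu : Primrec u) (hS : Primrec S) (hx : Primrec x)
    (hz : Primrec z) (hr : Primrec r) :
    Primrec fun a => value (n a) (u a) (S a) (x a) (z a) (r a) := by
  unfold value
  fun_prop

end Primrec

theorem eval_cons (n : ℕ) (x y : Letter k l) (r : Fin 8) (s : ℕ × ℕ × ℕ) (S : List (ℕ × ℕ × ℕ)) :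
    eval n x y r (s :: S) = evalStep n x y r s (eval n x y r S) := rfl

theorem eval_fst (n : ℕ) (x y : Letter k l) (r : Fin 8) (S : List (ℕ × ℕ × ℕ)) :
    (eval n x y r S).1 = S.length := by
  induction S with
  | nil => rfl
  | cons s S ih => exact congrArg (· + 1) ih

/-- The evaluation of a string depends only on the first truth values in the letters. -/
theorem eval_congr {n : ℕ} {x y x' y' : Letter k l} (r : Fin 8) (S : List (ℕ × ℕ × ℕ))
    (h1 : x.1 = x'.1) (h2 : x.2.1 = x'.2.1)
    (h3 : ∀ i < n + S.length, x.2.2.getD i false = x'.2.2.getD i false)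
    (h1' : y.1 = y'.1) (h2' : y.2.1 = y'.2.1)
    (h3' : ∀ i < n + S.length, y.2.2.getD i false = y'.2.2.getD i false) :
    eval n x y r S = eval n x' y' r S := by
  induction S with
  | nil => rfl
  | cons s S ih =>
    have ih := ih (fun i hi => h3 i (hi.trans_le (by simp)))
      (fun i hi => h3' i (hi.trans_le (by simp)))
    have p1 : ∀ u, (pick u x y).1 = (pick u x' y').1 := fun u => by
      unfold pick; cases decide (u = 0) <;> assumption
    have p2 : ∀ u, (pick u x y).2.1 = (pick u x' y').2.1 := fun u => by
      unfold pick; cases decide (u = 0) <;> assumption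
    have p3 : ∀ u, ∀ i < n + (S.length + 1), (pick u x y).2.2.getD i false =
        (pick u x' y').2.2.getD i false := fun u => by
      unfold pick; cases decide (u = 0) <;> assumption
    have p4 : ∀ u, ∀ i < n + (S.length + 1), (pick u y x).2.2.getD i false =
        (pick u y' x').2.2.getD i false := fun u => by
      unfold pick; cases decide (u = 0) <;> assumption
    have p5 : (decide (s.2.2 < n) && (pick s.2.1 x y).2.2.getD s.2.2 false) =
        (decide (s.2.2 < n) && (pick s.2.1 x' y').2.2.getD s.2.2 false) := by
      by_cases hs : s.2.2 < n
      · rw [p3 _ _ (by omega)]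
      · rw [decide_eq_false hs, Bool.false_and, Bool.false_and]
    have hl := eval_fst n x' y' r S
    change evalStep n x y r s (eval n x y r S) = evalStep n x' y' r s (eval n x' y' r S)
    rw [ih]
    unfold evalStep
    rw [p1, p2, p5, p4 _ _ (by omega)]

theorem value_congr {n u : ℕ} {x z x' z' : Letter k l} (r : Fin 8) (S : List (ℕ × ℕ × ℕ))
    (h1 : x.1 = x'.1) (h2 : x.2.1 = x'.2.1)
    (h3 : ∀ i < n + S.length, x.2.2.getD i false = x'.2.2.getD i false)
    (h1' : z.1 = z'.1) (h2' : z.2.1 = z'.2.1)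
    (h3' : ∀ i < n + S.length, z.2.2.getD i false = z'.2.2.getD i false) :
    value n u S x z r = value n u S x' z' r := by
  unfold value
  rw [eval_congr _ S h1 h2 h3 h1' h2' h3', eval_congr _ S h1' h2' h3' h1 h2 h3]

end Polish

namespace FO2

/-- Satisfaction depends only on the values of the free variables. -/
theorem sat_congr {n : ℕ} {M : MSC P A} {X : Fin n → Set M.E} (φ : FO2 P A n) {v w : Fin 2 → M.E}
    (h : ∀ x ∈ φ.freeVars, v x = w x) : φ.Sat M X v ↔ φ.Sat M X w := by
  induction φ generalizing v w with
  | proc | label | mem | eq | procEdge | msg | le => simp_all [freeVars, Sat]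
  | or φ ψ h1 h2 =>
    simp only [freeVars, Finset.mem_union] at h
    exact or_congr (h1 fun x hx => h x (Or.inl hx)) (h2 fun x hx => h x (Or.inr hx))
  | not φ h1 => exact not_congr (h1 h)
  | ex x φ h1 =>
    refine exists_congr fun e => h1 fun z hz => ?_
    by_cases hx : z = x
    · subst hx; simp
    · simp only [Function.update_of_ne hx]
      exact h z (Finset.mem_erase.2 ⟨hx, hz⟩)

end FO2

namespace MSC

variable {M : MSC P A}

theorem kind_zero {r : Fin 8} {e f : M.E} (h : M.Kind r e f) : e = f ↔ r = 0 := by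
  refine ⟨?_, fun hr => by subst hr; exact h⟩
  rintro rfl
  fin_cases r
  · rfl
  · exact absurd h.2 (by simp)
  · exact absurd h.2 (by simp)
  · exact absurd rfl (M.msg_ne _ _ h)
  · exact absurd rfl (M.msg_ne _ _ h)
  · exact absurd h.1 (M.lt_irrefl _)
  · exact absurd h.1 (M.lt_irrefl _)
  · exact absurd (M.le_refl _) h.1

theorem lt_of_procEdge {e f : M.E} (h : ProcEdge e f) : M.lt e f :=
  Relation.TransGen.single (Or.inl h)

theorem kind_le {r : Fin 8} {e f : M.E} (h : M.Kind r e f) :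
    M.le e f ↔ r = 0 ∨ r = 1 ∨ r = 3 ∨ r = 5 := by
  fin_cases r
  · exact iff_of_true (h ▸ M.le_refl _) (by decide)
  · exact iff_of_true (lt_of_procEdge h).le (by decide)
  · exact iff_of_false (M.not_le_of_lt (lt_of_procEdge h)) (by decide)
  · exact iff_of_true (M.lt_of_msg h).le (by decide)
  · exact iff_of_false (M.not_le_of_lt (M.lt_of_msg h)) (by decide)
  · exact iff_of_true h.1.le (by decide)
  · exact iff_of_false (M.not_le_of_lt h.1) (by decide)
  · exact iff_of_false h.1 (by decide)

/-- Distinct relative positions exclude each other; this and the neighbouring lemmas spell it out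
for the atomic formulas. -/
theorem kind_procEdge {r : Fin 8} {e f : M.E} (h : M.Kind r e f) : ProcEdge e f ↔ r = 1 := by
  refine ⟨fun hp => ?_, fun hr => by subst hr; exact h⟩
  have hlt := lt_of_procEdge hp
  fin_cases r
  · exact absurd ((show e = f from h) ▸ hlt) (M.lt_irrefl _)
  · rfl
  · exact absurd (lt_of_procEdge h).le (M.not_le_of_lt hlt)
  · exact absurd hp.1 (M.msg_ne _ _ h)
  · exact absurd hp.1.symm (M.msg_ne _ _ h)
  · exact absurd (Or.inl hp) h.2
  · exact absurd h.1.le (M.not_le_of_lt hlt)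
  · exact absurd hlt.le h.1

theorem kind_msg {r : Fin 8} {e f : M.E} (h : M.Kind r e f) : M.msg e f ↔ r = 3 := by
  refine ⟨fun hp => ?_, fun hr => by subst hr; exact h⟩
  have hlt := M.lt_of_msg hp
  fin_cases r
  · exact absurd ((show e = f from h) ▸ hlt) (M.lt_irrefl _)
  · exact absurd h.1 (M.msg_ne _ _ hp)
  · exact absurd h.1.symm (M.msg_ne _ _ hp)
  · rfl
  · exact absurd (M.lt_of_msg h).le (M.not_le_of_lt hlt)
  · exact absurd (Or.inr hp) h.2
  · exact absurd h.1.le (M.not_le_of_lt hlt)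
  · exact absurd hlt.le h.1

end MSC

namespace Polish

variable {k l n : ℕ} {M : MSC P A}

/-- The letters `c` of the events carry the right truth values, with respect to the formulas in the
string `S` and the values `X` of the set variables. -/
structure Consistent (numP : P ≃ Fin k) (numA : A ≃ Fin l) (X : Fin n → Set M.E)
    (S : List (ℕ × ℕ × ℕ)) (c : M.E → Letter k l) : Prop where
  proc : ∀ e, (c e).1 = numP e.1
  label : ∀ e, (c e).2.1 = numA (M.label e)
  set : ∀ e (i : Fin n), (c e).2.2.getD i false = true ↔ e ∈ X i
  ex : ∀ u w S', (9, u, w) :: S' <:+ S → ∀ e, (c e).2.2.getD (n + S'.length) false = true ↔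
    ∃ f r, M.Kind r e f ∧ value n u S' (c e) (c f) r = true

theorem pick_letter (c : M.E → Letter k l) (v : Fin 2 → M.E) (u : Fin 2) :
    pick u (c (v 0)) (c (v 1)) = c (v u) := by
  fin_cases u <;> rfl

theorem kind_relKind {r : Fin 8} {v : Fin 2 → M.E} (h : M.Kind r (v 0) (v 1)) (u w : Fin 2) :
    M.Kind (relKind r u w) (v u) (v w) := by
  fin_cases u <;> fin_cases w
  · exact rfl
  · exact h
  · exact MSC.kind_flip.2 h
  · exact rfl

open Classical in
/-- The evaluation of a formula in Polish notation pushes its truth value onto the stack. -/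
theorem eval_toSymbols {numP : P ≃ Fin k} {numA : A ≃ Fin l} {X : Fin n → Set M.E}
    {S : List (ℕ × ℕ × ℕ)} {c : M.E → Letter k l} (hc : Consistent numP numA X S c)
    (φ : FO2 P A n) (S' : List (ℕ × ℕ × ℕ)) (hS : φ.toSymbols numP numA ++ S' <:+ S)
    (v : Fin 2 → M.E) (r : Fin 8) (hr : M.Kind r (v 0) (v 1)) :
    (eval n (c (v 0)) (c (v 1)) r (φ.toSymbols numP numA ++ S')).2 =
      decide (φ.Sat M X v) :: (eval n (c (v 0)) (c (v 1)) r S').2 := by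
  induction φ generalizing S' v r with
  | proc p u =>
    simp only [FO2.toSymbols, List.singleton_append, eval_cons, evalStep]
    simp [pick_letter, hc.proc, FO2.Sat, Fin.val_inj]
    congr
  | label a u =>
    simp only [FO2.toSymbols, List.singleton_append, eval_cons, evalStep]
    simp [pick_letter, hc.label, FO2.Sat, Fin.val_inj]
    congr
  | mem u i =>
    have := hc.set (v u) i
    simp only [FO2.toSymbols, List.singleton_append, eval_cons, evalStep]
    simp only [OfNat.ofNat_ne_zero, decide_false, cond_false, OfNat.ofNat_ne_one, decide_true,
      cond_true, i.2, Bool.true_and, pick_letter, List.cons.injEq, and_true]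
    rw [Bool.eq_iff_iff, this, decide_eq_true_iff]
    rfl
  | eq u w =>
    have := MSC.kind_zero (kind_relKind hr u w)
    simp only [FO2.toSymbols, List.singleton_append, eval_cons, evalStep]
    simp [FO2.Sat, this]
  | procEdge u w =>
    have := MSC.kind_procEdge (kind_relKind hr u w)
    simp only [FO2.toSymbols, List.singleton_append, eval_cons, evalStep]
    simp [FO2.Sat, this]
  | msg u w =>
    have := MSC.kind_msg (kind_relKind hr u w)
    simp only [FO2.toSymbols, List.singleton_append, eval_cons, evalStep]
    simp [FO2.Sat, this]
  | le u w =>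
    have := MSC.kind_le (kind_relKind hr u w)
    simp only [FO2.toSymbols, List.singleton_append, eval_cons, evalStep]
    simp [FO2.Sat, this]
  | or φ ψ h1 h2 =>
    simp only [FO2.toSymbols, List.cons_append, List.append_assoc, eval_cons, evalStep] at hS ⊢
    have hS' := (List.suffix_cons _ _).trans hS
    rw [h1 _ hS' v r hr, h2 _ ((List.suffix_append _ _).trans hS') v r hr]
    simp only [Nat.reduceEqDiff, OfNat.ofNat_ne_zero, OfNat.ofNat_ne_one, decide_false, cond_false,
      decide_true, cond_true, List.headD_cons, List.tail_cons, List.cons.injEq, and_true]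
    rw [Bool.eq_iff_iff]
    simp only [Bool.or_eq_true, decide_eq_true_iff]
    rfl
  | not φ h1 =>
    simp only [FO2.toSymbols, List.cons_append, eval_cons, evalStep] at hS ⊢
    rw [h1 _ ((List.suffix_cons _ _).trans hS) v r hr]
    simp only [Nat.reduceEqDiff, OfNat.ofNat_ne_zero, OfNat.ofNat_ne_one, decide_false, cond_false,
      decide_true, cond_true, List.headD_cons, List.tail_cons, List.cons.injEq, and_true]
    rw [Bool.eq_iff_iff]
    simp only [Bool.not_eq_true', decide_eq_false_iff_not, decide_eq_true_iff]
    rfl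
  | ex u φ h1 =>
    simp only [FO2.toSymbols, List.cons_append, eval_cons, evalStep] at hS ⊢
    have hS' := (List.suffix_cons _ _).trans hS
    rw [h1 _ hS' v r hr, eval_fst]
    simp only [Nat.reduceEqDiff, OfNat.ofNat_ne_zero, OfNat.ofNat_ne_one, decide_false, cond_false,
      List.tail_cons, List.cons.injEq, and_true]
    rw [Bool.eq_iff_iff, decide_eq_true_iff]
    have key : ∀ (e f : M.E) (r' : Fin 8), M.Kind r' e f →
        (∀ w, w ≠ u → v w = e) →
        (value n u (φ.toSymbols numP numA ++ S') (c e) (c f) r' = true ↔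
          φ.Sat M X (Function.update v u f)) := by
      intro e f r' hr' he
      fin_cases u
      · have he1 : v 1 = e := he 1 (by decide)
        have := h1 S' hS' (Function.update v 0 f) (MSC.flipKind r') (by
          simpa [he1] using MSC.kind_flip.2 hr')
        simp only [Function.update_self, ne_eq, one_ne_zero, not_false_eq_true,
          Function.update_of_ne, he1] at this
        simp [value, this]
      · have he0 : v 0 = e := he 0 (by decide)
        have := h1 S' hS' (Function.update v 1 f) r' (by simpa [he0] using hr')
        simp only [Function.update_self, ne_eq, zero_ne_one, not_false_eq_true,
          Function.update_of_ne, he0] at this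
        simp [value, this]
    -- The stack refers to the letter of the variable that is not quantified.
    have hother : ∃ e, pick u (c (v 1)) (c (v 0)) = c e ∧ ∀ w, w ≠ u → v w = e := by
      fin_cases u
      · exact ⟨v 1, rfl, fun w hw => by fin_cases w <;> simp_all⟩
      · exact ⟨v 0, rfl, fun w hw => by fin_cases w <;> simp_all⟩
    obtain ⟨e, he, hv⟩ := hother
    rw [he, hc.ex u 0 _ hS e]
    constructor
    · rintro ⟨f, r', hr', h⟩
      exact ⟨f, (key e f r' hr' hv).1 h⟩
    · rintro ⟨f, h⟩
      obtain ⟨r', hr'⟩ := MSC.exists_kind e f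
      exact ⟨f, r', hr', (key e f r' hr' hv).2 h⟩

end Polish

/-! ### From sentences to machines -/

namespace Polish

variable {k l N : ℕ}

/-- The letters that can occur in an MSC, for a string of symbols of length `h` with `n` set
variables. -/
def letters (k l n h : ℕ) : List (Letter k l) :=
  (List.finRange k).flatMap fun p => (List.finRange l).flatMap fun a =>
    (allLists (n + h) [true, false]).map fun m => (p, a, m)

theorem mem_letters {n h : ℕ} {x : Letter k l} : x ∈ letters k l n h ↔ x.2.2.length = n + h := by
  rcases x with ⟨p, a, m⟩
  simp [letters, mem_allLists]

@[fun_prop] theorem primrec_letters {α : Type*} [Primcodable α] {n h : α → ℕ} (hn : Primrec n)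
    (hh : Primrec h) : Primrec fun a => letters k l (n a) (h a) := by
  unfold letters
  fun_prop

/-- The labels of the machine for a formula: the list of truth values of an event, and a list of
labels of the tiling of relative positions, one for each letter. -/
abbrev Mark (N : ℕ) : Type := List Bool × List (Fin (N + 1))

/-- The label of the `i`-th copy of the tiling of relative positions. -/
def copy (i : ℕ) (c : Mark N) : Fin (N + 1) := c.2.getD i 0

@[fun_prop] theorem primrec_copy {α : Type*} [Primcodable α] {i : α → ℕ} {c : α → Mark N}
    (hi : Primrec i) (hc : Primrec c) : Primrec fun a => copy (i a) (c a) := by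
  unfold copy
  fun_prop

/-- The truth value of the formula `∃ u, S` in a mark `c` with letter `x`: for each letter `z`, the
copy of the tiling that belongs to `z` tells in which relative positions there are events with
letter `z`. -/
def search (yb : Fin (N + 1) → Fin 8 → Bool) (L : List (Letter k l)) (n u : ℕ)
    (S : List (ℕ × ℕ × ℕ)) (c : Mark N) (x : Letter k l) : Bool :=
  (List.range L.length).any fun i => (List.finRange 8).any fun r =>
    yb (copy i c) r && value n u S x (L.getD i x) r

open Classical in
/-- The constraints which say that all copies of the tiling of relative positions are filled
correctly, that the letters of the events carry the right truth values for the quantified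
subformulas, and that the formula is true. -/
noncomputable def blueprint (T : Tiling P (Fin (N + 1))) (xb : Fin (N + 1) → Bool)
    (yb : Fin (N + 1) → Fin 8 → Bool) (numP : P ≃ Fin k) (l : ℕ) (w : ℕ × List (ℕ × ℕ × ℕ)) :
    Blueprint k l (Mark N) where
  labels := (allLists (w.1 + w.2.length) [true, false]).flatMap fun m =>
    (allLists (letters k l w.1 w.2.length).length (List.finRange (N + 1))).map fun cs => (m, cs)
  node p a c :=
    ((List.range (letters k l w.1 w.2.length).length).all fun i =>
      decide (xb (copy i c) =
        decide ((letters k l w.1 w.2.length).getD i (p, a, c.1) = (p, a, c.1)))) &&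
    (((List.range w.2.length).all fun d => ! decide ((w.2.getD d (0, 0, 0)).1 = 9) ||
      decide (c.1.getD (w.1 + (w.2.drop (d + 1)).length) false =
        search yb (letters k l w.1 w.2.length) w.1 (w.2.getD d (0, 0, 0)).2.1 (w.2.drop (d + 1)) c
          (p, a, c.1))) &&
    (eval w.1 (p, a, c.1) (p, a, c.1) 0 w.2).2.headD false)
  first p c := (List.range (letters k l w.1 w.2.length).length).all fun i =>
    decide (T.first (numP.symm p) (copy i c))
  step p c d := (List.range (letters k l w.1 w.2.length).length).all fun i =>
    decide (T.step (numP.symm p) (copy i c) (copy i d))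
  int p c := (List.range (letters k l w.1 w.2.length).length).all fun i =>
    decide (T.int (numP.symm p) (copy i c))
  msg p c q d := (List.range (letters k l w.1 w.2.length).length).all fun i =>
    decide (T.msg (numP.symm p) (copy i c) (numP.symm q) (copy i d))
  fin o := (List.range (letters k l w.1 w.2.length).length).all fun i =>
    decide (T.fin fun p => (o (numP p)).map fun c => copy i c)

open PrimrecAuto in
@[fun_prop] theorem primrec_search {α : Type*} [Primcodable α] (yb : Fin (N + 1) → Fin 8 → Bool)
    {L : α → List (Letter k l)} {n u : α → ℕ} {S : α → List (ℕ × ℕ × ℕ)} {c : α → Mark N}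
    {x : α → Letter k l} (hL : Primrec L) (hn : Primrec n) (hu : Primrec u) (hS : Primrec S)
    (hc : Primrec c) (hx : Primrec x) :
    Primrec fun a => search yb (L a) (n a) (u a) (S a) (c a) (x a) := by
  have hy : Primrec fun z : Fin (N + 1) × Fin 8 => yb z.1 z.2 := Primrec.dom_finite _
  unfold search
  refine listAny (by fun_prop) (listAny (by fun_prop) (and (hy.comp (g := fun t : (α × ℕ) × Fin 8 =>
    (copy t.1.2 (c t.1.1), t.2)) ?_) ?_)) <;> fun_prop

open PrimrecAuto in
theorem primrec_blueprint_code (T : Tiling P (Fin (N + 1))) (xb : Fin (N + 1) → Bool)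
    (yb : Fin (N + 1) → Fin 8 → Bool) (numP : P ≃ Fin k) (l : ℕ) :
    Primrec fun w => (blueprint T xb yb numP l w).code := by
  classical
  have hx : Primrec xb := Primrec.dom_finite _
  have h1 : Primrec fun z : Fin k × Fin (N + 1) => decide (T.first (numP.symm z.1) z.2) :=
    Primrec.dom_finite _
  have h2 : Primrec fun z : Fin k × Fin (N + 1) × Fin (N + 1) =>
    decide (T.step (numP.symm z.1) z.2.1 z.2.2) := Primrec.dom_finite _
  have h3 : Primrec fun z : Fin k × Fin (N + 1) => decide (T.int (numP.symm z.1) z.2) :=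
    Primrec.dom_finite _
  have h4 : Primrec fun z : (Fin k × Fin (N + 1)) × Fin k × Fin (N + 1) =>
    decide (T.msg (numP.symm z.1.1) z.1.2 (numP.symm z.2.1) z.2.2) := Primrec.dom_finite _
  have h5 : Primrec fun o : Fin k → Option (Fin (N + 1)) => decide (T.fin fun p => o (numP p)) :=
    Primrec.dom_finite _
  refine Blueprint.primrec_code ?_ ?_ ?_ ?_ ?_ ?_ ?_
  · unfold blueprint
    fun_prop
  · unfold blueprint
    fun_prop
  · exact listAll (by fun_prop) (h1.comp (g := fun x : ((ℕ × List (ℕ × ℕ × ℕ)) × Fin k × Mark N) × ℕ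
      => (x.1.2.1, copy x.2 x.1.2.2)) (by fun_prop))
  · exact listAll (by fun_prop) (h2.comp (g := fun x : ((ℕ × List (ℕ × ℕ × ℕ)) × Fin k × Mark N ×
      Mark N) × ℕ => (x.1.2.1, copy x.2 x.1.2.2.1, copy x.2 x.1.2.2.2)) (by fun_prop))
  · exact listAll (by fun_prop) (h3.comp (g := fun x : ((ℕ × List (ℕ × ℕ × ℕ)) × Fin k × Mark N) × ℕ
      => (x.1.2.1, copy x.2 x.1.2.2)) (by fun_prop))
  · exact listAll (by fun_prop) (h4.comp (g := fun x : ((ℕ × List (ℕ × ℕ × ℕ)) × (Fin k × Mark N) ×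
      Fin k × Mark N) × ℕ => ((x.1.2.1.1, copy x.2 x.1.2.1.2), x.1.2.2.1, copy x.2 x.1.2.2.2))
      (by fun_prop))
  · refine listAll (by fun_prop) (h5.comp (g := fun x : ((ℕ × List (ℕ × ℕ × ℕ)) ×
      (Fin k → Option (Mark N))) × ℕ => fun i => (x.1.2 i).map fun c => copy x.2 c)
      (finLam fun i => optionMap (finApp ?_ ?_) ?_)) <;>
      fun_prop

end Polish

namespace Polish

variable {k l n N : ℕ} {M : MSC P A}

/-- If the `i`-th copy of the tiling marks the events with the `i`-th letter, then the search is
correct. -/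
theorem search_iff {T : Tiling P (Fin (N + 1))} {xb : Fin (N + 1) → Bool}
    {yb : Fin (N + 1) → Fin 8 → Bool}
    (hT : ∀ c, T.Holds M c → ∀ e r, yb (c e) r = true ↔ ∃ f, M.Kind r e f ∧ xb (c f) = true)
    {L : List (Letter k l)} {c : M.E → Mark N} {x : M.E → Letter k l} (hL : ∀ e, x e ∈ L)
    (hH : ∀ i < L.length, T.Holds M fun e => copy i (c e))
    (hx : ∀ i < L.length, ∀ e, xb (copy i (c e)) = true ↔ L.getD i (x e) = x e)
    (u : ℕ) (S : List (ℕ × ℕ × ℕ)) (e : M.E) :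
    search yb L n u S (c e) (x e) = true ↔
      ∃ f r, M.Kind r e f ∧ value n u S (x e) (x f) r = true := by
  simp only [search, List.any_eq_true, List.mem_range, Bool.and_eq_true]
  constructor
  · rintro ⟨i, hi, r, -, hy, hv⟩
    obtain ⟨f, hf, hxf⟩ := (hT _ (hH i hi) e r).1 hy
    refine ⟨f, r, hf, ?_⟩
    have h := (hx i hi f).1 hxf
    rw [List.getD_eq_getElem _ _ hi] at h hv
    rwa [← h]
  · rintro ⟨f, r, hf, hv⟩
    obtain ⟨i, hi, h⟩ := List.getElem_of_mem (hL f)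
    refine ⟨i, hi, r, List.mem_finRange r, (hT _ (hH i hi) e r).2 ⟨f, hf, (hx i hi f).2 ?_⟩, ?_⟩
    · rw [List.getD_eq_getElem _ _ hi, h]
    · rwa [List.getD_eq_getElem _ _ hi, h]

open Classical in
/-- The truth values of the quantified subformulas in the string `S` at each event, from right to
left. Each is determined by those further to the right. -/
noncomputable def truth (numP : P ≃ Fin k) (numA : A ≃ Fin l) (X : Fin n → Set M.E) :
    List (ℕ × ℕ × ℕ) → M.E → List Bool
  | [], _ => []
  | s :: S, e => truth numP numA X S e ++ [decide (∃ f r, M.Kind r e f ∧ value n s.2.1 S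
      (numP e.1, numA (M.label e), List.ofFn (fun i => decide (e ∈ X i)) ++ truth numP numA X S e)
      (numP f.1, numA (M.label f), List.ofFn (fun i => decide (f ∈ X i)) ++ truth numP numA X S f)
      r = true)]

open Classical in
/-- The letters of the events, for the string `S` and the values `X` of the set variables. -/
noncomputable def letter (numP : P ≃ Fin k) (numA : A ≃ Fin l) (X : Fin n → Set M.E)
    (S : List (ℕ × ℕ × ℕ)) (e : M.E) : Letter k l :=
  (numP e.1, numA (M.label e), List.ofFn (fun i => decide (e ∈ X i)) ++ truth numP numA X S e)

section letter

variable (numP : P ≃ Fin k) (numA : A ≃ Fin l) (X : Fin n → Set M.E)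

theorem length_truth (S : List (ℕ × ℕ × ℕ)) (e : M.E) :
    (truth numP numA X S e).length = S.length := by
  induction S with
  | nil => rfl
  | cons s S ih => simp [truth, ih]

theorem letter_mem (S : List (ℕ × ℕ × ℕ)) (e : M.E) :
    letter numP numA X S e ∈ letters k l n S.length := by
  simp [mem_letters, letter, length_truth]

theorem truth_prefix {S S' : List (ℕ × ℕ × ℕ)} (h : S' <:+ S) (e : M.E) :
    truth numP numA X S' e <+: truth numP numA X S e := by
  obtain ⟨R, rfl⟩ := h
  induction R with
  | nil => exact List.prefix_rfl
  | cons s R ih => exact ih.trans (List.prefix_append _ _)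

/-- The letter for a string extends the letters for its suffixes. -/
theorem letter_getD {S S' : List (ℕ × ℕ × ℕ)} (h : S' <:+ S) (e : M.E) {i : ℕ}
    (hi : i < n + S'.length) :
    (letter numP numA X S e).2.2.getD i false = (letter numP numA X S' e).2.2.getD i false := by
  classical
  obtain ⟨R, hR⟩ := truth_prefix numP numA X h e
  have hl : i < (letter numP numA X S' e).2.2.length := by
    simpa [letter, length_truth] using hi
  have : (letter numP numA X S e).2.2 = (letter numP numA X S' e).2.2 ++ R := by
    simp only [letter, ← hR, List.append_assoc]
  rw [this, List.getD_append _ _ _ _ hl]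

/-- The canonical letters are consistent. By `letter_getD`, the truth value of a quantified
subformula is the one computed from the letters for its own string. -/
theorem letter_consistent (S : List (ℕ × ℕ × ℕ)) :
    Consistent numP numA X S (letter numP numA X S) where
  proc _ := rfl
  label _ := rfl
  set e i := by
    classical
    rw [letter_getD numP numA X (List.nil_suffix) e (by simp : (i : ℕ) < n + _)]
    simp [letter, truth]
  ex u w S' h e := by
    classical
    have hS' := (List.suffix_cons _ _).trans h
    rw [letter_getD numP numA X h e (by simp)]
    have : (letter numP numA X ((9, u, w) :: S') e).2.2.getD (n + S'.length) false =
        decide (∃ f r, M.Kind r e f ∧ value n u S' (letter numP numA X S' e)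
          (letter numP numA X S' f) r = true) := by
      have hl : n + S'.length = (letter numP numA X S' e).2.2.length := by
        simp [letter, length_truth]
      change ((_ ++ (truth numP numA X S' e ++ [_])).getD _ _) = _
      have key : ∀ (a : List Bool) (b : Bool) (j : ℕ), j = a.length →
          (a ++ [b]).getD j false = b := by
        rintro a b j rfl
        simp
      rw [← List.append_assoc]
      exact key _ _ _ hl
    rw [this, decide_eq_true_iff]
    refine exists_congr fun f => exists_congr fun r => and_congr_right fun _ => ?_
    rw [value_congr (x := letter numP numA X S e) (z := letter numP numA X S f)
      (x' := letter numP numA X S' e) (z' := letter numP numA X S' f) r S' rfl rfl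
      (fun i hi => letter_getD numP numA X hS' e hi) rfl rfl
      (fun i hi => letter_getD numP numA X hS' f hi)]

end letter

/-- A labelling is accepted if and only if all copies of the tiling are filled correctly and the
conditions on single events hold. -/
theorem accepts_iff {T : Tiling P (Fin (N + 1))} {xb : Fin (N + 1) → Bool}
    {yb : Fin (N + 1) → Fin 8 → Bool} {numP : P ≃ Fin k} {numA : A ≃ Fin l}
    {w : ℕ × List (ℕ × ℕ × ℕ)} {c : M.E → Mark N} :
    (blueprint T xb yb numP l w).Accepts numP numA M c ↔
      (∀ e, c e ∈ (blueprint T xb yb numP l w).labels) ∧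
      (∀ e, (blueprint T xb yb numP l w).node (numP e.1) (numA (M.label e)) (c e) = true) ∧
      ∀ i < (letters k l w.1 w.2.length).length, T.Holds M fun e => copy i (c e) := by
  classical
  have hlast : ∀ i, (M.lastLabel fun e => copy i (c e)) =
      fun p => (M.lastLabel c (numP.symm (numP p))).map fun c => copy i c := fun i =>
    funext fun p => by
      rw [Equiv.symm_apply_apply]
      exact M.lastLabel_map c (fun _ c => copy i c) p
  constructor
  · intro h
    refine ⟨h.mem, h.node, fun i hi => ⟨fun e he => ?_, fun e f hef => ?_, fun e he => ?_,
      fun e f hef => ?_, ?_⟩⟩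
    · simpa using of_decide_eq_true (List.all_eq_true.1 (h.first e he) i (List.mem_range.2 hi))
    · simpa using of_decide_eq_true (List.all_eq_true.1 (h.step e f hef) i (List.mem_range.2 hi))
    · simpa using of_decide_eq_true (List.all_eq_true.1 (h.int e he) i (List.mem_range.2 hi))
    · simpa using of_decide_eq_true (List.all_eq_true.1 (h.msg e f hef) i (List.mem_range.2 hi))
    · rw [hlast]
      exact of_decide_eq_true (List.all_eq_true.1 h.fin i (List.mem_range.2 hi))
  · rintro ⟨h1, h2, h3⟩
    refine ⟨h1, h2, fun e he => List.all_eq_true.2 fun i hi => decide_eq_true ?_,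
      fun e f hef => List.all_eq_true.2 fun i hi => decide_eq_true ?_,
      fun e he => List.all_eq_true.2 fun i hi => decide_eq_true ?_,
      fun e f hef => List.all_eq_true.2 fun i hi => decide_eq_true ?_,
      List.all_eq_true.2 fun i hi => decide_eq_true ?_⟩
    all_goals have h3 := h3 i (List.mem_range.1 hi)
    · simpa using h3.first e he
    · simpa using h3.step e f hef
    · simpa using h3.int e he
    · simpa using h3.msg e f hef
    · rw [← hlast]
      exact h3.fin

/-- The blueprint of a sentence has an accepted labelling if and only if the MSC satisfies the
sentence. The truth values in an accepted labelling provide the sets for the set variables. -/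
theorem exists_accepts_iff {T : Tiling P (Fin (N + 1))} {xb : Fin (N + 1) → Bool}
    {yb : Fin (N + 1) → Fin 8 → Bool}
    (hT : ∀ c, T.Holds M c → ∀ e r, yb (c e) r = true ↔ ∃ f, M.Kind r e f ∧ xb (c f) = true)
    (hT' : ∀ X : M.E → Bool, ∃ c, T.Holds M c ∧ ∀ e, xb (c e) = X e)
    (numP : P ≃ Fin k) (numA : A ≃ Fin l) (φ : FO2 P A n) (hφ : φ.freeVars = ∅) :
    (∃ c, (blueprint T xb yb numP l (n, φ.toSymbols numP numA)).Accepts numP numA M c) ↔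
      ∃ X : Fin n → Set M.E, ∀ v, φ.Sat M X v := by
  classical
  set S := φ.toSymbols numP numA with hS
  have htop : ∀ X c, Consistent numP numA X S c →
      ∀ e, (eval n (c e) (c e) 0 S).2.headD false = decide (φ.Sat M X fun _ => e) := by
    intro X c hc e
    have := eval_toSymbols hc φ [] (by simp [hS]) (fun _ => e) 0 rfl
    rw [List.append_nil] at this
    rw [hS, this]
    rfl
  set L := letters k l n S.length with hL
  constructor
  · rintro ⟨c, hc⟩
    obtain ⟨hmem, hnode, hH⟩ := accepts_iff.1 hc
    set x : M.E → Letter k l := fun e => (numP e.1, numA (M.label e), (c e).1) with hx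
    have hxL : ∀ e, x e ∈ L := by
      intro e
      have := hmem e
      simp only [blueprint, List.mem_flatMap, List.mem_map, mem_allLists] at this
      obtain ⟨m, ⟨hm, -⟩, cs, -, h⟩ := this
      rw [hL, mem_letters]
      change (c e).1.length = _
      rw [← h]
      exact hm
    simp only [blueprint, Bool.and_eq_true, List.all_eq_true, List.mem_range, Bool.or_eq_true,
      decide_eq_true_iff, Bool.not_eq_true', decide_eq_false_iff_not] at hnode
    have hsearch := fun u S' e => search_iff (n := n) hT hxL hH
      (fun i hi e => by rw [(hnode e).1 i hi, decide_eq_true_iff]) u S' e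
    refine ⟨fun i => {e | (c e).1.getD i false = true}, fun v => ?_⟩
    have hcons : Consistent numP numA (fun i : Fin n => {e | (c e).1.getD i false = true}) S x :=
      { proc := fun _ => rfl
        label := fun _ => rfl
        set := fun _ _ => Iff.rfl
        ex := by
          rintro u w S' ⟨R, hR⟩ e
          have hlt : R.length < S.length := by
            rw [← hR, List.length_append, List.length_cons]
            omega
          have hget : S.getD R.length (0, 0, 0) = (9, u, w) := by
            rw [← hR, List.getD_append_right _ _ _ _ le_rfl, Nat.sub_self, List.getD_cons_zero]
          have hdrop : S.drop (R.length + 1) = S' := by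
            rw [← hR, ← List.singleton_append, ← List.append_assoc]
            exact List.drop_left' (by simp)
          rw [← hsearch]
          have := (hnode e).2.1 _ hlt
          rw [hget, hdrop] at this
          exact Bool.eq_iff_iff.1 (this.resolve_left (by simp)) }
    have h := htop _ x hcons (v 0)
    rw [← (φ.sat_congr (by simp [hφ]) : φ.Sat M _ (fun _ => v 0) ↔ φ.Sat M _ v)]
    exact of_decide_eq_true (h.symm.trans (hnode (v 0)).2.2)
  · rintro ⟨X, hX⟩
    set x : M.E → Letter k l := letter numP numA X S with hx
    choose cp hcp hcx using fun i => hT' fun e => decide (L.getD i (x e) = x e)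
    set c : M.E → Mark N := fun e => ((x e).2.2, (List.range L.length).map fun i => cp i e) with hc
    have hcopy : ∀ i < L.length, ∀ e, copy i (c e) = cp i e := by
      intro i hi e
      simp [copy, hc, hi]
    have hH : ∀ i < L.length, T.Holds M fun e => copy i (c e) := by
      intro i hi
      rw [funext (hcopy i hi)]
      exact hcp i
    have hxb : ∀ i < L.length, ∀ e, xb (copy i (c e)) = decide (L.getD i (x e) = x e) :=
      fun i hi e => by rw [hcopy i hi, hcx]
    have hxL : ∀ e, x e ∈ L := letter_mem numP numA X S
    have hsearch := fun u S' e => search_iff (n := n) hT hxL hH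
      (fun i hi e => by rw [hxb i hi, decide_eq_true_iff]) u S' e
    have hcons := letter_consistent numP numA X S
    refine ⟨c, accepts_iff.2 ⟨fun e => ?_, fun e => ?_, hH⟩⟩
    · simp only [blueprint, List.mem_flatMap, List.mem_map, mem_allLists]
      exact ⟨_, ⟨mem_letters.1 (hxL e), by simp⟩, _, ⟨by simp [hL, hS], by simp⟩, rfl⟩
    · simp only [blueprint, Bool.and_eq_true, List.all_eq_true, List.mem_range, Bool.or_eq_true,
        decide_eq_true_iff, Bool.not_eq_true', decide_eq_false_iff_not]
      refine ⟨fun i hi => hxb i hi e, fun d hd => ?_, ?_⟩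
      · rcases hs : S.getD d (0, 0, 0) with ⟨b, u, w⟩
        by_cases hb : b = 9
        · refine Or.inr (Bool.eq_iff_iff.2 ?_)
          have hsuf : (9, u, w) :: S.drop (d + 1) <:+ S := by
            rw [← hb, ← hs, List.getD_eq_getElem _ _ hd, ← List.drop_eq_getElem_cons]
            exact List.drop_suffix d S
          exact (hcons.ex u w _ hsuf e).trans (hsearch u _ e).symm
        · exact Or.inl hb
      · exact (htop X x hcons e).trans (decide_eq_true (hX _))

end Polish

/-! ### Building formulas in Polish notation -/

namespace Polish

/-- Strings of symbols. -/
abbrev Str : Type := List (ℕ × ℕ × ℕ)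

/-- The atomic formula saying that the variable `u` is on process `i`. -/
def atProc (i : ℕ) (u : Fin 2) : Str := [(0, i, (u : ℕ))]

/-- The atomic formula saying that the variable `u` has label `a`. -/
def atLabel (a : ℕ) (u : Fin 2) : Str := [(1, a, (u : ℕ))]

/-- The atomic formula saying that the variable `u` belongs to the `j`-th set. -/
def atMem (u : Fin 2) (j : ℕ) : Str := [(2, (u : ℕ), j)]

/-- The atomic formula for a process edge. -/
def atEdge (u w : Fin 2) : Str := [(4, (u : ℕ), (w : ℕ))]

/-- The atomic formula for a message edge. -/
def atMsg (u w : Fin 2) : Str := [(5, (u : ℕ), (w : ℕ))]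

/-- The negation of a string. -/
def neg (s : Str) : Str := (8, 0, 0) :: s

/-- The disjunction of two strings. -/
def disj (s t : Str) : Str := (7, 0, 0) :: (s ++ t)

/-- The existential quantification of a string. -/
def exs (u : Fin 2) (s : Str) : Str := (9, (u : ℕ), 0) :: s

/-- The conjunction of two strings. -/
def conj (s t : Str) : Str := neg (disj (neg s) (neg t))

/-- The disjunction of a list of strings. The empty disjunction says that some event differs from
itself. -/
def bigDisj (L : List Str) : Str := L.foldr (fun s t => disj s t) (exs 0 (neg [(3, 0, 0)]))

/-- The conjunction of a list of strings. -/
def bigConj (L : List Str) : Str := neg (bigDisj (L.map fun s => neg s))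

/-- The universal quantification of a string. -/
def alls (u : Fin 2) (s : Str) : Str := neg (exs u (neg s))

section Primrec

variable {α : Type*} [Primcodable α]

@[fun_prop] theorem primrec_atProc {i : α → ℕ} (u : Fin 2) (hi : Primrec i) :
    Primrec fun a => atProc (i a) u := by
  unfold atProc
  fun_prop

@[fun_prop] theorem primrec_atLabel {i : α → ℕ} (u : Fin 2) (hi : Primrec i) :
    Primrec fun a => atLabel (i a) u := by
  unfold atLabel
  fun_prop

@[fun_prop] theorem primrec_atMem {i : α → ℕ} (u : Fin 2) (hi : Primrec i) :
    Primrec fun a => atMem u (i a) := by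
  unfold atMem
  fun_prop

@[fun_prop] theorem primrec_neg {s : α → Str} (hs : Primrec s) : Primrec fun a => neg (s a) := by
  unfold neg
  fun_prop

@[fun_prop] theorem primrec_disj {s t : α → Str} (hs : Primrec s) (ht : Primrec t) :
    Primrec fun a => disj (s a) (t a) := by
  unfold disj
  fun_prop

@[fun_prop] theorem primrec_exs {s : α → Str} (u : Fin 2) (hs : Primrec s) :
    Primrec fun a => exs u (s a) := by
  unfold exs
  fun_prop

@[fun_prop] theorem primrec_conj {s t : α → Str} (hs : Primrec s) (ht : Primrec t) :
    Primrec fun a => conj (s a) (t a) := by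
  unfold conj
  fun_prop

@[fun_prop] theorem primrec_bigDisj {L : α → List Str} (hL : Primrec L) :
    Primrec fun a => bigDisj (L a) := by
  unfold bigDisj
  fun_prop

@[fun_prop] theorem primrec_bigConj {L : α → List Str} (hL : Primrec L) :
    Primrec fun a => bigConj (L a) := by
  unfold bigConj
  fun_prop

@[fun_prop] theorem primrec_alls {s : α → Str} (u : Fin 2) (hs : Primrec s) :
    Primrec fun a => alls u (s a) := by
  unfold alls
  fun_prop

end Primrec

/-- The string `s` is a formula with `n` set variables whose free variables belong to `fv`, and its
meaning is `sem`. Here the set variables are interpreted by sets for all natural numbers, those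
from `n` on by the empty set. -/
def Codes {k l : ℕ} (numP : P ≃ Fin k) (numA : A ≃ Fin l) (n : ℕ) (fv : Finset (Fin 2)) (s : Str)
    (sem : ∀ M : MSC P A, (ℕ → Set M.E) → (Fin 2 → M.E) → Prop) : Prop :=
  ∃ ψ : FO2 P A n, ψ.toSymbols numP numA = s ∧ ψ.freeVars ⊆ fv ∧
    ∀ (M : MSC P A) (X : Fin n → Set M.E) (v : Fin 2 → M.E),
      ψ.Sat M X v ↔ sem M (fun j => {e | ∃ h : j < n, e ∈ X ⟨j, h⟩}) v

namespace Codes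

variable {k l : ℕ} {numP : P ≃ Fin k} {numA : A ≃ Fin l} {n : ℕ} {fv : Finset (Fin 2)} {s t : Str}
  {sem sem' : ∀ M : MSC P A, (ℕ → Set M.E) → (Fin 2 → M.E) → Prop}

theorem proc (i : Fin k) (u : Fin 2) : Codes numP numA n {u} (atProc i u)
    fun _ _ v => numP (v u).1 = i :=
  ⟨.proc (numP.symm i) u, by simp [FO2.toSymbols, atProc], subset_rfl,
    fun _ _ _ => numP.eq_symm_apply⟩

theorem label (a : Fin l) (u : Fin 2) : Codes numP numA n {u} (atLabel a u)
    fun M _ v => numA (M.label (v u)) = a :=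
  ⟨.label (numA.symm a) u, by simp [FO2.toSymbols, atLabel], subset_rfl,
    fun _ _ _ => numA.eq_symm_apply⟩

theorem mem {j : ℕ} (hj : j < n) (u : Fin 2) : Codes numP numA n {u} (atMem u j)
    fun _ X v => v u ∈ X j :=
  ⟨.mem u ⟨j, hj⟩, rfl, subset_rfl, fun _ _ _ => ⟨fun h => ⟨hj, h⟩, fun ⟨_, h⟩ => h⟩⟩

theorem procEdge (u w : Fin 2) : Codes numP numA n Finset.univ (atEdge u w)
    fun _ _ v => ProcEdge (v u) (v w) :=
  ⟨.procEdge u w, rfl, Finset.subset_univ _, fun _ _ _ => Iff.rfl⟩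

theorem msg (u w : Fin 2) : Codes numP numA n Finset.univ (atMsg u w)
    fun M _ v => M.msg (v u) (v w) :=
  ⟨.msg u w, rfl, Finset.subset_univ _, fun _ _ _ => Iff.rfl⟩

theorem mono {fv' : Finset (Fin 2)} (h : Codes numP numA n fv s sem) (hfv : fv ⊆ fv') :
    Codes numP numA n fv' s sem := by
  obtain ⟨ψ, h1, h2, h3⟩ := h
  exact ⟨ψ, h1, h2.trans hfv, h3⟩

theorem neg (h : Codes numP numA n fv s sem) :
    Codes numP numA n fv (Polish.neg s) fun M X v => ¬ sem M X v := by
  obtain ⟨ψ, rfl, h2, h3⟩ := h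
  exact ⟨.not ψ, rfl, h2, fun M X v => not_congr (h3 M X v)⟩

theorem disj (h : Codes numP numA n fv s sem) (h' : Codes numP numA n fv t sem') :
    Codes numP numA n fv (Polish.disj s t) fun M X v => sem M X v ∨ sem' M X v := by
  obtain ⟨ψ, rfl, h2, h3⟩ := h
  obtain ⟨ψ', rfl, h2', h3'⟩ := h'
  exact ⟨.or ψ ψ', rfl, Finset.union_subset h2 h2', fun M X v => or_congr (h3 M X v) (h3' M X v)⟩

theorem exs {fv' : Finset (Fin 2)} (u : Fin 2) (h : Codes numP numA n fv s sem)
    (hfv : fv.erase u ⊆ fv') : Codes numP numA n fv' (Polish.exs u s)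
      fun M X v => ∃ e, sem M X (Function.update v u e) := by
  obtain ⟨ψ, rfl, h2, h3⟩ := h
  exact ⟨.ex u ψ, rfl, (Finset.erase_subset_erase u h2).trans hfv,
    fun M X v => exists_congr fun e => h3 M X _⟩

theorem congr (h : Codes numP numA n fv s sem) (H : ∀ M X v, sem' M X v ↔ sem M X v) :
    Codes numP numA n fv s sem' := by
  obtain ⟨ψ, h1, h2, h3⟩ := h
  exact ⟨ψ, h1, h2, fun M X v => (h3 M X v).trans (H M _ v).symm⟩

theorem conj (h : Codes numP numA n fv s sem) (h' : Codes numP numA n fv t sem') :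
    Codes numP numA n fv (Polish.conj s t) fun M X v => sem M X v ∧ sem' M X v :=
  (h.neg.disj h'.neg).neg.congr fun _ _ _ => by tauto

theorem alls {fv' : Finset (Fin 2)} (u : Fin 2) (h : Codes numP numA n fv s sem)
    (hfv : fv.erase u ⊆ fv') : Codes numP numA n fv' (Polish.alls u s)
      fun M X v => ∀ e, sem M X (Function.update v u e) :=
  (h.neg.exs u hfv).neg.congr fun _ _ _ => not_exists_not.symm

theorem bigDisj {ι : Type*} {L : List ι} {s : ι → Str}
    {sem : ι → ∀ M : MSC P A, (ℕ → Set M.E) → (Fin 2 → M.E) → Prop}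
    (h : ∀ i ∈ L, Codes numP numA n fv (s i) (sem i)) :
    Codes numP numA n fv (Polish.bigDisj (L.map s)) fun M X v => ∃ i ∈ L, sem i M X v := by
  induction L with
  | nil =>
    refine (exs (fv := {0}) (sem := fun M _ v => ¬ v 0 = v 0) 0 ?_ (by simp)).congr
      fun M X v => by simp
    exact ⟨.not (.eq 0 0), rfl, by simp [FO2.freeVars], fun _ _ _ => Iff.rfl⟩
  | cons i L ih =>
    exact ((h i (by simp)).disj (ih fun j hj => h j (by simp [hj]))).congr fun M X v => by simp

theorem bigConj {ι : Type*} {L : List ι} {s : ι → Str}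
    {sem : ι → ∀ M : MSC P A, (ℕ → Set M.E) → (Fin 2 → M.E) → Prop}
    (h : ∀ i ∈ L, Codes numP numA n fv (s i) (sem i)) :
    Codes numP numA n fv (Polish.bigConj (L.map s)) fun M X v => ∀ i ∈ L, sem i M X v := by
  have := (bigDisj fun i hi => (h i hi).neg).neg
  unfold Polish.bigConj
  rw [List.map_map]
  exact this.congr fun M X v => by simp

end Codes

end Polish

/-! ### Runs of described machines -/

namespace CFMCode

variable {k l : ℕ}

/-- A process together with the description of one of its transitions. -/
abbrev Tr (k l : ℕ) : Type := Fin k × ℕ × ActCode k l × ℕ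

/-- The label of an action. -/
def letter (α : ActCode k l) : Fin l := α.elim (fun a => a) fun x => x.1

/-- Whether an action is internal. -/
def internal (α : ActCode k l) : Bool := α.elim (fun _ => true) fun _ => false

/-- Whether the first transition sends a message which the second one receives. -/
def fits (t t' : Tr k l) : Bool :=
  t.2.2.1.elim (fun _ => false) fun x => t'.2.2.1.elim (fun _ => false) fun x' =>
    (x.2.1 && ! x'.2.1) && (decide (x.2.2.1 = x'.2.2.1) &&
      (decide (x.2.2.2 = t'.1) && decide (x'.2.2.2 = t.1)))

/-- Application of a function on `Fin k`, as a definition of its own so that `fun_prop` finds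
`primrec_entry`. -/
def entry {α : Type*} (f : Fin k → α) (i : Fin k) : α := f i

/-- Whether a transition is one of the described machine: its states and its message have to be in
range, and the other end of the message has to be a different process. -/
def valid (c : CFMCode k l) (t : Tr k l) : Bool :=
  decide (t.2.1 < entry c.1 t.1 + 1) && (decide (t.2.2.2 < entry c.1 t.1 + 1) &&
    t.2.2.1.elim (fun _ => true) fun x => decide (x.2.2.1 < c.2.1) && ! decide (x.2.2.2 = t.1))

/-- The transitions of the described machine. -/
def trs (c : CFMCode k l) : List (Tr k l) :=
  ((List.finRange k).flatMap fun i => (entry c.2.2.1 i).map fun t => (i, t)).filter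
    fun t => valid c t

theorem mem_trs {c : CFMCode k l} {t : Tr k l} :
    t ∈ trs c ↔ t.2 ∈ c.2.2.1 t.1 ∧ valid c t = true := by
  rcases t with ⟨i, t⟩
  simp [trs, entry]

/-- A run of the described machine on `M`, given by descriptions of transitions. -/
structure IsCodedRun (c : CFMCode k l) (numP : P ≃ Fin k) (numA : A ≃ Fin l) (M : MSC P A)
    (τ : M.E → Tr k l) : Prop where
  mem : ∀ e, τ e ∈ trs c
  proc : ∀ e, (τ e).1 = numP e.1
  label : ∀ e, letter (τ e).2.2.1 = numA (M.label e)
  init : ∀ e, (∀ f, ¬ ProcEdge f e) → (τ e).2.1 = 0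
  step : ∀ e f : M.E, ProcEdge e f → (τ e).2.2.2 = (τ f).2.1
  internal : ∀ e, M.IsInternal e → internal (τ e).2.2.1 = true
  message : ∀ e f, M.msg e f → fits (τ e) (τ f) = true
  acc : ∃ g ∈ c.2.2.2, ∀ i, (∃ e : M.E, numP e.1 = i ∧ (∀ f, ¬ ProcEdge e f) ∧ (τ e).2.2.2 = g i) ∨
    g i = 0 ∧ ∀ e : M.E, numP e.1 ≠ i

/-- The description of a transition. -/
def trCode {m : ℕ} {B : P → ℕ} (numP : P ≃ Fin k) (numA : A ≃ Fin l) {p : P}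
    (t : CFMTrans P A (Fin m) (Fin (B p)) p) : Tr k l :=
  (numP p, t.source, t.act.code numP numA, t.target)

section code

variable {numP : P ≃ Fin k} {numA : A ≃ Fin l} {m : ℕ} {p q : P}

theorem letter_code (α : Act P A (Fin m) p) : letter (α.code numP numA) = numA α.label := by
  cases α <;> rfl

theorem internal_code (α : Act P A (Fin m) p) :
    internal (α.code numP numA) = true ↔ α.IsInternal := by
  cases α <;> simp [internal, Act.code, Act.IsInternal]

theorem fits_code {s s' r r' : ℕ} (α : Act P A (Fin m) p) (β : Act P A (Fin m) q) :
    fits (numP p, s, α.code numP numA, s') (numP q, r, β.code numP numA, r') = true ↔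
      ∃ m, α.IsSend m q ∧ β.IsRecv m p := by
  cases α <;> cases β <;> simp [fits, Act.code, Act.IsSend, Act.IsRecv, Fin.val_inj]
  grind

/-- A description of an action with its message in range and another process at the other end
comes from an action. -/
theorem exists_act {α : ActCode k l} (h : (α.elim (fun _ => true) fun x => decide (x.2.2.1 < m) &&
    ! decide (x.2.2.2 = numP p)) = true) : ∃ β : Act P A (Fin m) p, β.code numP numA = α := by
  rcases α with a | ⟨a, b, j, q⟩
  · exact ⟨.internal (numA.symm a), by simp [Act.code]⟩
  · simp only [Sum.elim_inr, Bool.and_eq_true, decide_eq_true_eq, Bool.not_eq_true',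
      decide_eq_false_iff_not] at h
    have hq : numP.symm q ≠ p := fun hq => h.2 (by simp [← hq])
    cases b
    · exact ⟨.recv (numA.symm a) ⟨j, h.1⟩ ⟨numP.symm q, hq⟩, by simp [Act.code]⟩
    · exact ⟨.send (numA.symm a) ⟨j, h.1⟩ ⟨numP.symm q, hq⟩, by simp [Act.code]⟩

theorem act_valid (α : Act P A (Fin m) p) : ((α.code numP numA).elim (fun _ => true) fun x =>
    decide (x.2.2.1 < m) && ! decide (x.2.2.2 = numP p)) = true := by
  rcases α with a | ⟨a, j, q⟩ | ⟨a, j, q⟩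
  · rfl
  · simpa [Act.code] using q.2
  · simpa [Act.code] using q.2

end code

/-- The last state of a process in terms of its last event. -/
theorem lastState_eq_iff {C : CFM P A} {M : MSC P A}
    {ρ : ∀ e : M.E, CFMTrans P A C.Msg (C.S e.1) e.1} {p : P} {s : C.S p} :
    C.lastState M ρ p = s ↔ (∃ i : Fin (M.word p).length, (∀ f, ¬ ProcEdge (⟨p, i⟩ : M.E) f) ∧
      (ρ ⟨p, i⟩).target = s) ∨ C.init p = s ∧ (M.word p).length = 0 := by
  unfold CFM.lastState
  split_ifs with h
  · constructor
    · intro hs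
      refine Or.inl ⟨_, fun f hf => ?_, hs⟩
      rcases f with ⟨q, j⟩
      obtain rfl : p = q := hf.1
      have h1 : (M.word p).length - 1 + 1 = j := hf.2
      omega
    · rintro (⟨i, hi, rfl⟩ | ⟨-, h0⟩)
      · congr
        by_contra hne
        have hlt : (i : ℕ) + 1 < (M.word p).length := by
          have := i.2
          omega
        exact hi ⟨p, ⟨_, hlt⟩⟩ ⟨rfl, rfl⟩
      · omega
  · constructor
    · exact fun hs => Or.inr ⟨hs, by omega⟩
    · rintro (⟨i, -⟩ | ⟨hs, -⟩)
      · exact absurd i.pos h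
      · exact hs

/-- Accepting runs of a described machine are the same as runs given by descriptions. -/
theorem isCodedRun_iff {c : CFMCode k l} {numP : P ≃ Fin k} {numA : A ≃ Fin l} {M : MSC P A}
    {ρ : ∀ e : M.E, CFMTrans P A (Fin c.2.1) (Fin (c.1 (numP e.1) + 1)) e.1} :
    ((c.toCFM numP numA).IsRun M ρ ∧
      (c.toCFM numP numA).lastState M ρ ∈ (c.toCFM numP numA).Acc) ↔
    IsCodedRun c numP numA M
      (fun e => trCode (B := fun p => c.1 (numP p) + 1) numP numA (ρ e)) := by
  have hacc : (c.toCFM numP numA).lastState M ρ ∈ (c.toCFM numP numA).Acc ↔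
      ∃ g ∈ c.2.2.2, ∀ i, (∃ e : M.E, numP e.1 = i ∧ (∀ f, ¬ ProcEdge e f) ∧
        ((ρ e).target : ℕ) = g i) ∨ g i = 0 ∧ ∀ e : M.E, numP e.1 ≠ i := by
    refine exists_congr fun g => and_congr_right fun _ => ?_
    rw [numP.forall_congr_left]
    refine forall_congr' fun i => ?_
    obtain ⟨p, rfl⟩ := numP.surjective i
    rw [numP.symm_apply_apply]
    constructor
    · intro h
      rcases lastState_eq_iff.1 (Eq.refl ((c.toCFM numP numA).lastState M ρ p)) with
        ⟨i, hi, hs⟩ | ⟨hs, h0⟩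
      · exact Or.inl ⟨⟨p, i⟩, rfl, hi, by rw [← h, ← hs]⟩
      · refine Or.inr ⟨by rw [← h, ← hs]; rfl, fun e he => ?_⟩
        have := numP.injective he ▸ e.2.pos
        omega
    · rintro (⟨⟨q, i⟩, he, hi, hs⟩ | ⟨h0, h⟩)
      · obtain rfl := numP.injective he
        rw [← hs]
        exact congrArg Fin.val (lastState_eq_iff.2 (Or.inl ⟨i, hi, rfl⟩))
      · rw [h0]
        refine congrArg Fin.val (lastState_eq_iff.2 (Or.inr ⟨rfl, ?_⟩) :
          (c.toCFM numP numA).lastState M ρ p = (c.toCFM numP numA).init p)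
        by_contra hne
        exact h ⟨p, ⟨0, Nat.pos_of_ne_zero hne⟩⟩ rfl
  have hprev : ∀ e : M.E, (∀ f, ¬ ProcEdge f e) ↔ (e.2 : ℕ) = 0 := fun e => by
    rw [← MSC.prev_eq_none, Option.eq_none_iff_forall_ne_some]
    simp only [ne_eq, MSC.prev_eq_some]
  rw [hacc]
  constructor
  · rintro ⟨h, h'⟩
    refine ⟨fun e => mem_trs.2 ⟨h.mem e, ?_⟩, fun _ => rfl,
      fun e => (letter_code _).trans (congrArg numA (h.label e)), fun e he => ?_, fun e f hef => ?_,
      fun e he => (internal_code _).2 (h.internal e he),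
      fun e f hef => (fits_code _ _).2 (h.message e f hef), h'⟩
    · simp only [valid, Bool.and_eq_true]
      exact ⟨decide_eq_true (ρ e).source.2, decide_eq_true (ρ e).target.2, act_valid _⟩
    · exact congrArg Fin.val (h.init e.1 e.2 ((hprev e).1 he))
    · rcases e with ⟨p, i⟩
      rcases f with ⟨q, j⟩
      obtain rfl : p = q := hef.1
      exact congrArg Fin.val (h.step p i j hef)
  · intro h
    refine ⟨⟨fun e => (mem_trs.1 (h.mem e)).1,
      fun e => numA.injective ((letter_code _).symm.trans (h.label e)),
      fun p i hi => Fin.ext (h.init ⟨p, i⟩ ((hprev ⟨p, i⟩).2 hi)),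
      fun p i j hij => Fin.ext (h.step _ _ hij),
      fun e he => (internal_code _).1 (h.internal e he),
      fun e f hef => (fits_code _ _).1 (h.message e f hef)⟩, h.acc⟩

/-- A described machine accepts precisely the MSCs on which it has a run given by descriptions. -/
theorem mem_language_iff {c : CFMCode k l} {numP : P ≃ Fin k} {numA : A ≃ Fin l} {M : MSC P A} :
    M ∈ (c.toCFM numP numA).language ↔ ∃ τ, IsCodedRun c numP numA M τ := by
  constructor
  · rintro ⟨ρ, h⟩
    exact ⟨_, isCodedRun_iff.1 h⟩
  · rintro ⟨τ, hτ⟩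
    have : ∀ e, ∃ t : CFMTrans P A (Fin c.2.1) (Fin (c.1 (numP e.1) + 1)) e.1,
        trCode (B := fun p => c.1 (numP p) + 1) numP numA t = τ e := by
      intro e
      have h := (mem_trs.1 (hτ.mem e)).2
      have hp := hτ.proc e
      rcases hte : τ e with ⟨i, s, α, s'⟩
      rw [hte] at h hp
      obtain rfl : i = numP e.1 := hp
      simp only [valid, entry, Bool.and_eq_true] at h
      obtain ⟨h1, h2, h3⟩ := h
      obtain ⟨β, rfl⟩ := exists_act (p := e.1) (m := c.2.1) (numA := numA) (by simpa using h3)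
      exact ⟨⟨⟨s, of_decide_eq_true h1⟩, β, ⟨s', of_decide_eq_true h2⟩⟩, rfl⟩
    choose ρ hρ using this
    refine ⟨ρ, isCodedRun_iff.2 ?_⟩
    rwa [funext hρ]

end CFMCode

/-! ### From described machines to sentences -/

namespace CFMCode

open Polish

variable {k l : ℕ}

/-- The number of set variables of the sentence: the set with the number of the code of a transition
consists of the events that take this transition. -/
def numVars (T : List (Tr k l)) : ℕ :=
  (T.map fun t => Encodable.encode t + 1).foldr (fun a b => max a b) 0

/-- The formula which says that `u` takes the transition `t`. -/
def takes (u : Fin 2) (t : Tr k l) : Str := atMem u (Encodable.encode t)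

/-- Every event takes precisely one transition, with the right process and label. -/
def uniqueStr (T : List (Tr k l)) : Str :=
  alls 0 (bigDisj (T.map fun t => conj (takes 0 t) (conj (atProc t.1 0)
    (conj (atLabel (letter t.2.2.1) 0)
      (bigConj ((T.filter fun t' =>
        ! decide (Encodable.encode t' = Encodable.encode t)).map fun t' => neg (takes 0 t')))))))

/-- First events take transitions from the initial state. -/
def initStr (T : List (Tr k l)) : Str :=
  alls 0 (disj (exs 1 (atEdge 1 0))
    (bigDisj ((T.filter fun t => decide (t.2.1 = 0)).map fun t => takes 0 t)))

/-- All pairs of entries of a list. -/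
def pairs {α : Type*} (T : List α) : List (α × α) := T.flatMap fun t => T.map fun t' => (t, t')

/-- Along process edges, the target of a transition is the source of the following one. -/
def stepStr (T : List (Tr k l)) : Str :=
  alls 0 (alls 1 (disj (neg (atEdge 0 1)) (bigDisj (((pairs T).filter fun z =>
    decide (z.1.2.2.2 = z.2.2.1)).map fun z => conj (takes 0 z.1) (takes 1 z.2)))))

/-- Along message edges, the transitions send and receive the same message. -/
def messageStr (T : List (Tr k l)) : Str :=
  alls 0 (alls 1 (disj (neg (atMsg 0 1)) (bigDisj (((pairs T).filter fun z =>
    fits z.1 z.2).map fun z => conj (takes 0 z.1) (takes 1 z.2)))))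

/-- Internal events take internal transitions. -/
def internalStr (T : List (Tr k l)) : Str :=
  alls 0 (disj (exs 1 (disj (atMsg 0 1) (atMsg 1 0)))
    (bigDisj ((T.filter fun t => internal t.2.2.1).map fun t => takes 0 t)))

/-- The last state of process `i` is `s`. -/
def lastStr (T : List (Tr k l)) (i s : ℕ) : Str :=
  disj (exs 0 (conj (atProc i 0) (conj (neg (exs 1 (atEdge 0 1)))
    (bigDisj ((T.filter fun t => decide (t.2.2.2 = s)).map fun t => takes 0 t)))))
  (bigDisj (([0].filter fun j => decide (s = j)).map fun _ => neg (exs 0 (atProc i 0))))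

/-- The tuple of last states is accepting. -/
def accStr (T : List (Tr k l)) (F : List (Fin k → ℕ)) : Str :=
  bigDisj (F.map fun g => bigConj ((List.finRange k).map fun i : Fin k => lastStr T i (entry g i)))

/-- The first-order kernel of the sentence for a described machine. -/
def kernelStr (c : CFMCode k l) : Str :=
  conj (uniqueStr (trs c)) (conj (initStr (trs c)) (conj (stepStr (trs c))
    (conj (messageStr (trs c)) (conj (internalStr (trs c)) (accStr (trs c) c.2.2.2)))))

section Primrec

variable {α σ : Type*} [Primcodable α] [Primcodable σ]

@[fun_prop] theorem primrec_entry {f : α → Fin k → σ} {i : α → Fin k} (hf : Primrec f)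
    (hi : Primrec i) : Primrec fun a => entry (f a) (i a) := PrimrecAuto.finApp hf hi

@[fun_prop] theorem primrec_letter {f : α → ActCode k l} (hf : Primrec f) :
    Primrec fun a => letter (f a) := by
  unfold letter
  fun_prop

@[fun_prop] theorem primrec_internal {f : α → ActCode k l} (hf : Primrec f) :
    Primrec fun a => internal (f a) := by
  unfold internal
  fun_prop

@[fun_prop] theorem primrec_fits {f g : α → Tr k l} (hf : Primrec f) (hg : Primrec g) :
    Primrec fun a => fits (f a) (g a) := by
  unfold fits
  fun_prop

@[fun_prop] theorem primrec_valid {c : α → CFMCode k l} {f : α → Tr k l} (hc : Primrec c)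
    (hf : Primrec f) : Primrec fun a => valid (c a) (f a) := by
  unfold valid
  fun_prop

@[fun_prop] theorem primrec_trs {c : α → CFMCode k l} (hc : Primrec c) :
    Primrec fun a => trs (c a) := by
  unfold trs
  fun_prop

@[fun_prop] theorem primrec_pairs {f : α → List σ} (hf : Primrec f) :
    Primrec fun a => pairs (f a) := by
  unfold pairs
  fun_prop

@[fun_prop] theorem primrec_takes {f : α → Tr k l} (u : Fin 2) (hf : Primrec f) :
    Primrec fun a => takes u (f a) := by
  unfold takes
  fun_prop

@[fun_prop] theorem primrec_lastStr {T : α → List (Tr k l)} {i s : α → ℕ} (hT : Primrec T)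
    (hi : Primrec i) (hs : Primrec s) : Primrec fun a => lastStr (T a) (i a) (s a) := by
  unfold lastStr
  fun_prop

theorem primrec_sentence :
    Primrec fun c : CFMCode k l => (numVars (trs c), kernelStr c) := by
  have h1 : Primrec fun T : List (Tr k l) => uniqueStr T := by
    unfold uniqueStr
    fun_prop
  have h2 : Primrec fun T : List (Tr k l) => initStr T := by
    unfold initStr
    fun_prop
  have h3 : Primrec fun T : List (Tr k l) => stepStr T := by
    unfold stepStr
    fun_prop
  have h4 : Primrec fun T : List (Tr k l) => messageStr T := by
    unfold messageStr
    fun_prop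
  have h5 : Primrec fun T : List (Tr k l) => internalStr T := by
    unfold internalStr
    fun_prop
  have h6 : Primrec fun z : List (Tr k l) × List (Fin k → ℕ) => accStr z.1 z.2 := by
    unfold accStr
    fun_prop
  have h7 : Primrec fun T : List (Tr k l) => numVars T := by
    unfold numVars
    fun_prop
  unfold kernelStr
  have h6' : Primrec fun c : CFMCode k l => accStr (trs c) c.2.2.2 :=
    h6.comp (g := fun c : CFMCode k l => (trs c, c.2.2.2)) (by fun_prop)
  fun_prop

end Primrec

section codes

variable {numP : P ≃ Fin k} {numA : A ≃ Fin l} {T : List (Tr k l)}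

theorem codes_takes {t : Tr k l} (ht : t ∈ T) (u : Fin 2) :
    Codes numP numA (numVars T) {u} (takes u t) fun _ X v => v u ∈ X (Encodable.encode t) :=
  Codes.mem (le_foldr_max (List.mem_map.2 ⟨t, ht, rfl⟩)) u

theorem codes_unique : Codes numP numA (numVars T) ∅ (uniqueStr T) fun M X _ =>
    ∀ e, ∃ t ∈ T, e ∈ X (Encodable.encode t) ∧ numP e.1 = t.1 ∧
      numA (M.label e) = letter t.2.2.1 ∧ ∀ t' ∈ T, t' ≠ t → e ∉ X (Encodable.encode t') := by
  have h1 : ∀ t, Codes numP numA (numVars T) {0}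
      (bigConj ((T.filter fun t' => ! decide (Encodable.encode t' = Encodable.encode t)).map
        fun t' => neg (takes 0 t')))
      fun M X v => ∀ t' ∈ T, t' ≠ t → v 0 ∉ X (Encodable.encode t') := by
    intro t
    refine (Codes.bigConj fun t' ht' => (codes_takes (List.mem_filter.1 ht').1 0).neg).congr
      fun M X v => ?_
    simp only [List.mem_filter, Bool.not_eq_true', decide_eq_false_iff_not, Encodable.encode_inj,
      and_imp, ne_eq]
  have h2 := Codes.bigDisj fun t (ht : t ∈ T) => (codes_takes ht 0).conj
    ((Codes.proc (numP := numP) (numA := numA) t.1 0).conj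
      ((Codes.label (letter t.2.2.1) 0).conj (h1 t)))
  exact (Codes.alls 0 h2 (by simp)).congr fun M X v => by simp only [Function.update_self]

theorem codes_filter (p : Tr k l → Bool) (u : Fin 2) : Codes numP numA (numVars T) {u}
    (bigDisj ((T.filter fun t => p t).map fun t => takes u t))
    fun _ X v => ∃ t ∈ T, p t = true ∧ v u ∈ X (Encodable.encode t) := by
  refine (Codes.bigDisj fun t ht => codes_takes (List.mem_filter.1 ht).1 u).congr fun M X v => ?_
  simp only [List.mem_filter, and_assoc]

theorem codes_pairs (p : Tr k l × Tr k l → Bool) : Codes numP numA (numVars T) Finset.univ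
    (bigDisj (((pairs T).filter fun z => p z).map fun z => conj (takes 0 z.1) (takes 1 z.2)))
    fun _ X v => ∃ t ∈ T, ∃ t' ∈ T, p (t, t') = true ∧ v 0 ∈ X (Encodable.encode t) ∧
      v 1 ∈ X (Encodable.encode t') := by
  have hz : ∀ z ∈ (pairs T).filter fun z => p z, z.1 ∈ T ∧ z.2 ∈ T := by
    intro z hz
    obtain ⟨t, ht, hz⟩ := List.mem_flatMap.1 (List.mem_filter.1 hz).1
    obtain ⟨t', ht', rfl⟩ := List.mem_map.1 hz
    exact ⟨ht, ht'⟩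
  refine (Codes.bigDisj fun z h => ((codes_takes (hz z h).1 0).mono (Finset.subset_univ _)).conj
    ((codes_takes (hz z h).2 1).mono (Finset.subset_univ _))).congr fun M X v => ?_
  constructor
  · rintro ⟨t, ht, t', ht', hp, h⟩
    exact ⟨(t, t'), List.mem_filter.2 ⟨List.mem_flatMap.2 ⟨t, ht, List.mem_map.2 ⟨t', ht', rfl⟩⟩,
      hp⟩, h⟩
  · rintro ⟨z, h, hX⟩
    exact ⟨z.1, (hz z h).1, z.2, (hz z h).2, (List.mem_filter.1 h).2, hX⟩

theorem codes_init : Codes numP numA (numVars T) ∅ (initStr T) fun M X _ =>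
    ∀ e : M.E, (∃ f, ProcEdge f e) ∨
      ∃ t ∈ T, t.2.1 = 0 ∧ e ∈ X (Encodable.encode t) := by
  have h := (Codes.exs (fv' := {0}) 1 (Codes.procEdge (numP := numP) (numA := numA) (n := numVars T)
    1 0) (by decide)).disj (codes_filter (fun t : Tr k l => decide (t.2.1 = 0)) 0)
  exact (Codes.alls 0 h (by simp)).congr fun M X v => by
    simp only [Function.update_self, ne_eq, zero_ne_one, not_false_eq_true, Function.update_of_ne,
      decide_eq_true_eq]

theorem codes_edge {s : Str} {R : ∀ M : MSC P A, M.E → M.E → Prop}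
    (hs : Codes numP numA (numVars T) Finset.univ s fun M _ v => R M (v 0) (v 1))
    (p : Tr k l × Tr k l → Bool) : Codes numP numA (numVars T) ∅
      (alls 0 (alls 1 (disj (neg s) (bigDisj (((pairs T).filter fun z => p z).map
        fun z => conj (takes 0 z.1) (takes 1 z.2))))))
      fun M X _ => ∀ e f : M.E, R M e f → ∃ t ∈ T, ∃ t' ∈ T, p (t, t') = true ∧
        e ∈ X (Encodable.encode t) ∧ f ∈ X (Encodable.encode t') :=
  (Codes.alls 0 (Codes.alls (fv' := {0}) 1 (hs.neg.disj (codes_pairs p)) (by decide))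
    (by simp)).congr fun M X v => by
      simp only [Function.update_self, ne_eq, zero_ne_one, not_false_eq_true,
        Function.update_of_ne, ← imp_iff_not_or]

theorem codes_internal : Codes numP numA (numVars T) ∅ (internalStr T) fun M X _ =>
    ∀ e : M.E, (∃ f, M.msg e f ∨ M.msg f e) ∨
      ∃ t ∈ T, internal t.2.2.1 = true ∧ e ∈ X (Encodable.encode t) := by
  have h := (Codes.exs (fv' := {0}) 1 ((Codes.msg (numP := numP) (numA := numA) (n := numVars T)
    0 1).disj (Codes.msg 1 0)) (by decide)).disj (codes_filter (fun t : Tr k l => internal t.2.2.1) 0)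
  exact (Codes.alls 0 h (by simp)).congr fun M X v => by
    simp only [Function.update_self, ne_eq, zero_ne_one, not_false_eq_true, Function.update_of_ne]

theorem codes_last (i : Fin k) (s : ℕ) : Codes numP numA (numVars T) ∅ (lastStr T i s) fun M X _ =>
    (∃ e : M.E, numP e.1 = i ∧ (¬ ∃ f, ProcEdge e f) ∧
      ∃ t ∈ T, t.2.2.2 = s ∧ e ∈ X (Encodable.encode t)) ∨
    s = 0 ∧ ¬ ∃ e : M.E, numP e.1 = i := by
  have h1 := (Codes.exs (fv' := {0}) 1 (Codes.procEdge (numP := numP) (numA := numA)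
    (n := numVars T) 0 1) (by decide)).neg
  have h2 := Codes.exs (fv' := ∅) 0 ((Codes.proc i 0).conj (h1.conj
    (codes_filter (fun t : Tr k l => decide (t.2.2.2 = s)) 0))) (by simp)
  have h3 := (Codes.exs (fv' := ∅) 0 (Codes.proc (numP := numP) (numA := numA) (n := numVars T) i 0)
    (by simp)).neg
  refine (h2.disj (Codes.bigDisj fun (j : ℕ) (_ : j ∈ [0].filter fun j => decide (s = j)) =>
    h3)).congr fun M X v => ?_
  simp only [Function.update_self, ne_eq, zero_ne_one, not_false_eq_true,
    Function.update_of_ne, decide_eq_true_eq]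
  refine or_congr_right ?_
  by_cases hs : s = 0 <;> simp [hs]

theorem codes_acc (F : List (Fin k → ℕ)) : Codes numP numA (numVars T) ∅ (accStr T F) fun M X _ =>
    ∃ g ∈ F, ∀ i, (∃ e : M.E, numP e.1 = i ∧ (¬ ∃ f, ProcEdge e f) ∧
      ∃ t ∈ T, t.2.2.2 = g i ∧ e ∈ X (Encodable.encode t)) ∨
    g i = 0 ∧ ¬ ∃ e : M.E, numP e.1 = i :=
  (Codes.bigDisj fun g (_ : g ∈ F) => Codes.bigConj fun i (_ : i ∈ List.finRange k) =>
    codes_last (numP := numP) (numA := numA) (T := T) i (entry g i)).congr fun M X v => by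
      simp only [List.mem_finRange, forall_const, entry]

end codes

/-- A labelling of the events by transitions is a run if and only if the sets of events that take
the same transition satisfy the conditions of the sentence. -/
theorem isCodedRun_iff_sets {c : CFMCode k l} {numP : P ≃ Fin k} {numA : A ≃ Fin l} {M : MSC P A}
    {τ : M.E → Tr k l} {X : ℕ → Set M.E} (hτ : ∀ e, τ e ∈ trs c)
    (hX : ∀ t ∈ trs c, ∀ e, e ∈ X (Encodable.encode t) ↔ τ e = t) :
    IsCodedRun c numP numA M τ ↔
      (∀ e, ∃ t ∈ trs c, e ∈ X (Encodable.encode t) ∧ numP e.1 = t.1 ∧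
        numA (M.label e) = letter t.2.2.1 ∧ ∀ t' ∈ trs c, t' ≠ t → e ∉ X (Encodable.encode t')) ∧
      (∀ e : M.E, (∃ f, ProcEdge f e) ∨
        ∃ t ∈ trs c, t.2.1 = 0 ∧ e ∈ X (Encodable.encode t)) ∧
      (∀ e f : M.E, ProcEdge e f → ∃ t ∈ trs c, ∃ t' ∈ trs c, t.2.2.2 = t'.2.1 ∧
        e ∈ X (Encodable.encode t) ∧ f ∈ X (Encodable.encode t')) ∧
      (∀ e f : M.E, M.msg e f → ∃ t ∈ trs c, ∃ t' ∈ trs c, fits t t' = true ∧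
        e ∈ X (Encodable.encode t) ∧ f ∈ X (Encodable.encode t')) ∧
      (∀ e : M.E, (∃ f, M.msg e f ∨ M.msg f e) ∨
        ∃ t ∈ trs c, internal t.2.2.1 = true ∧ e ∈ X (Encodable.encode t)) ∧
      ∃ g ∈ c.2.2.2, ∀ i, (∃ e : M.E, numP e.1 = i ∧ (¬ ∃ f, ProcEdge e f) ∧
        ∃ t ∈ trs c, t.2.2.2 = g i ∧ e ∈ X (Encodable.encode t)) ∨
        g i = 0 ∧ ¬ ∃ e : M.E, numP e.1 = i := by
  have h1 : ∀ (p : Tr k l → Prop) e, (∃ t ∈ trs c, p t ∧ e ∈ X (Encodable.encode t)) ↔ p (τ e) := by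
    intro p e
    constructor
    · rintro ⟨t, ht, hp, he⟩
      rwa [(hX t ht e).1 he]
    · exact fun hp => ⟨τ e, hτ e, hp, (hX _ (hτ e) e).2 rfl⟩
  have h2 : ∀ (p : Tr k l → Tr k l → Prop) e f, (∃ t ∈ trs c, ∃ t' ∈ trs c, p t t' ∧
      e ∈ X (Encodable.encode t) ∧ f ∈ X (Encodable.encode t')) ↔ p (τ e) (τ f) := by
    intro p e f
    constructor
    · rintro ⟨t, ht, t', ht', hp, he, hf⟩
      rwa [(hX t ht e).1 he, (hX t' ht' f).1 hf]
    · exact fun hp => ⟨τ e, hτ e, τ f, hτ f, hp, (hX _ (hτ e) e).2 rfl, (hX _ (hτ f) f).2 rfl⟩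
  have h4 : ∀ s e, (∃ t ∈ trs c, t.2.2.2 = s ∧ e ∈ X (Encodable.encode t)) ↔ (τ e).2.2.2 = s :=
    fun s e => h1 (fun t => t.2.2.2 = s) e
  simp only [h1 fun t => t.2.1 = 0, h1 fun t => internal t.2.2.1 = true, h4,
    h2 fun t t' => t.2.2.2 = t'.2.1, h2 fun t t' => fits t t' = true]
  have h3 : (∀ e, ∃ t ∈ trs c, e ∈ X (Encodable.encode t) ∧ numP e.1 = t.1 ∧
      numA (M.label e) = letter t.2.2.1 ∧ ∀ t' ∈ trs c, t' ≠ t → e ∉ X (Encodable.encode t')) ↔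
      ∀ e, numP e.1 = (τ e).1 ∧ numA (M.label e) = letter (τ e).2.2.1 := by
    refine forall_congr' fun e => ⟨?_, fun h => ⟨τ e, hτ e, (hX _ (hτ e) e).2 rfl, h.1, h.2,
      fun t' ht' hne he => hne ((hX t' ht' e).1 he).symm⟩⟩
    rintro ⟨t, ht, he, h, h', -⟩
    rw [(hX t ht e).1 he]
    exact ⟨h, h'⟩
  rw [h3]
  constructor
  · intro h
    refine ⟨fun e => ⟨(h.proc e).symm, (h.label e).symm⟩, fun e => ?_, h.step, h.message,
      fun e => ?_, ?_⟩
    · exact or_iff_not_imp_left.2 fun he => h.init e (not_exists.1 he)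
    · refine or_iff_not_imp_left.2 fun he => h.internal e fun f => ?_
      exact not_or.1 (not_exists.1 he f)
    · simpa only [not_exists] using h.acc
  · rintro ⟨h1, h2, h3, h4, h5, h6⟩
    refine ⟨hτ, fun e => (h1 e).1.symm, fun e => (h1 e).2.symm,
      fun e he => (h2 e).resolve_left (not_exists.2 he), h3, fun e he => (h5 e).resolve_left ?_, h4,
      by simpa only [not_exists] using h6⟩
    rintro ⟨f, hf⟩
    exact (not_or.2 (he f)) hf

/-- The sentence built from a described machine defines its language. -/
theorem exists_sentence (numP : P ≃ Fin k) (numA : A ≃ Fin l) (c : CFMCode k l) :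
    ∃ φ : EMSO2 P A, (numVars (trs c), kernelStr c) = φ.code numP numA ∧
      (c.toCFM numP numA).language = φ.language := by
  have h := (codes_unique (numP := numP) (numA := numA) (T := trs c)).conj (codes_init.conj
    ((codes_edge (Codes.procEdge 0 1) fun z => decide (z.1.2.2.2 = z.2.2.1)).conj
      ((codes_edge (Codes.msg 0 1) fun z => fits z.1 z.2).conj
        (codes_internal.conj (codes_acc c.2.2.2)))))
  obtain ⟨ψ, h1, h2, h3⟩ := h
  refine ⟨⟨numVars (trs c), ψ, Finset.subset_empty.1 h2⟩, Prod.ext rfl h1.symm, ?_⟩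
  ext M
  rw [mem_language_iff]
  simp only [EMSO2.language, Set.mem_ofPred_eq, h3, decide_eq_true_eq]
  constructor
  · rintro ⟨τ, hτ⟩
    refine ⟨fun j => {e | Encodable.encode (τ e) = j}, fun _ =>
      (isCodedRun_iff_sets (X := fun j => {e | ∃ _ : j < numVars (trs c),
        Encodable.encode (τ e) = j})
        hτ.mem fun t ht e => ?_).1 hτ⟩
    have hlt : Encodable.encode t < numVars (trs c) :=
      le_foldr_max (List.mem_map.2 ⟨t, ht, rfl⟩)
    simp [hlt, Encodable.encode_inj]
  · rintro ⟨X, hX⟩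
    obtain ⟨p, hp⟩ := M.word_ne
    have hX := hX fun _ => ⟨p, ⟨0, List.length_pos_iff.2 hp⟩⟩
    choose τ h1 h2 h3 h4 h5 using hX.1
    refine ⟨τ, (isCodedRun_iff_sets
      (X := fun j => {e | ∃ h : j < numVars (trs c), e ∈ X ⟨j, h⟩}) h1 fun t ht e =>
        ⟨fun he => ?_, fun he => he ▸ h2 e⟩).2 hX⟩
    by_contra hne
    exact h5 e t ht (Ne.symm hne) he

end CFMCode

/-! ### Descriptions of arbitrary machines -/

namespace Act

variable {Msg Msg' : Type} {p : P}

/-- The renaming of messages in an action. -/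
def map (f : Msg → Msg') : Act P A Msg p → Act P A Msg' p
  | internal a => internal a
  | send a m q => send a (f m) q
  | recv a m q => recv a (f m) q

theorem map_map {Msg'' : Type} (f : Msg → Msg') (g : Msg' → Msg'') (α : Act P A Msg p) :
    (α.map f).map g = α.map (g ∘ f) := by
  cases α <;> rfl

theorem map_id (α : Act P A Msg p) : α.map id = α := by
  cases α <;> rfl

theorem code_injective {k l m : ℕ} (numP : P ≃ Fin k) (numA : A ≃ Fin l) :
    Function.Injective (Act.code (p := p) (m := m) numP numA) := by
  intro α β h
  cases α <;> cases β <;> simp_all [Act.code, Fin.val_inj, Subtype.ext_iff]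

instance [Finite P] [Finite A] [Finite Msg] : Finite (Act P A Msg p) := by
  let f : Act P A Msg p → A ⊕ (A × Msg × P) ⊕ (A × Msg × P) := fun α =>
    match α with
    | internal a => .inl a
    | send a m q => .inr (.inl (a, m, q))
    | recv a m q => .inr (.inr (a, m, q))
  refine Finite.of_injective f fun α β h => ?_
  cases α <;> cases β <;> simp_all [f, Subtype.ext_iff]

end Act

namespace CFMTrans

variable {Msg Msg' S S' : Type} {p : P}

/-- The renaming of states and messages in a transition. -/
def map (f : S → S') (g : Msg → Msg') (t : CFMTrans P A Msg S p) : CFMTrans P A Msg' S' p :=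
  ⟨f t.source, t.act.map g, f t.target⟩

instance [Finite P] [Finite A] [Finite Msg] [Finite S] : Finite (CFMTrans P A Msg S p) :=
  Finite.of_injective (fun t => (t.source, t.act, t.target)) fun t t' h => by
    cases t; cases t'; simp_all

end CFMTrans

namespace CFM

/-- If one machine simulates another by means of a renaming of states and messages, it accepts
every MSC which the other accepts. -/
theorem language_subset {C D : CFM P A} (f : ∀ p, C.S p → D.S p) (g : C.Msg → D.Msg)
    (hinit : ∀ p, f p (C.init p) = D.init p) (hΔ : ∀ p, ∀ t ∈ C.Δ p, t.map (f p) g ∈ D.Δ p)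
    (hAcc : ∀ s ∈ C.Acc, (fun p => f p (s p)) ∈ D.Acc) : C.language ⊆ D.language := by
  have hlabel : ∀ {p} (α : Act P A C.Msg p), (α.map g).label = α.label := by
    rintro p (_ | _ | _) <;> rfl
  have hsend : ∀ {p} (α : Act P A C.Msg p) m q, α.IsSend m q → (α.map g).IsSend (g m) q := by
    rintro p (_ | _ | _) m q h
    exacts [h, ⟨congrArg g h.1, h.2⟩, h]
  have hrecv : ∀ {p} (α : Act P A C.Msg p) m q, α.IsRecv m q → (α.map g).IsRecv (g m) q := by
    rintro p (_ | _ | _) m q h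
    exacts [h, h, ⟨congrArg g h.1, h.2⟩]
  have hint : ∀ {p} (α : Act P A C.Msg p), α.IsInternal → (α.map g).IsInternal := by
    rintro p (_ | _ | _) h <;> exact h
  rintro M ⟨ρ, hρ, hacc⟩
  refine ⟨fun e => (ρ e).map (f e.1) g, ⟨fun e => hΔ _ _ (hρ.mem e),
    fun e => (hlabel _).trans (hρ.label e),
    fun p i hi => (congrArg (f p) (hρ.init p i hi)).trans (hinit p),
    fun p i j hij => congrArg (f p) (hρ.step p i j hij), fun e he => hint _ (hρ.internal e he),
    fun e f hef => ?_⟩, ?_⟩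
  · obtain ⟨m, hs, hr⟩ := hρ.message e f hef
    exact ⟨g m, hsend _ _ _ hs, hrecv _ _ _ hr⟩
  · convert hAcc _ hacc using 1
    funext p
    unfold lastState
    split_ifs
    · rfl
    · exact (hinit p).symm

/-- Every machine has a description. -/
theorem exists_code [Finite P] [Finite A] {k l : ℕ} (numP : P ≃ Fin k) (numA : A ≃ Fin l)
    (C : CFM P A) : ∃ c : CFMCode k l, C.language = (c.toCFM numP numA).language := by
  classical
  have := C.finite_msg
  have := C.finite_state
  obtain ⟨m, ⟨μ⟩⟩ := Finite.exists_equiv_fin C.Msg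
  have hσ : ∀ p, ∃ (n : ℕ) (σ : C.S p ≃ Fin (n + 1)), σ (C.init p) = 0 := by
    intro p
    obtain ⟨n, ⟨σ⟩⟩ := Finite.exists_equiv_fin (C.S p)
    obtain ⟨n, rfl⟩ : ∃ n', n = n' + 1 :=
      Nat.exists_eq_succ_of_ne_zero fun h => (h ▸ σ (C.init p)).elim0
    exact ⟨n, σ.trans (Equiv.swap (σ (C.init p)) 0), by simp⟩
  choose n σ hσ using hσ
  have hfinΔ : ∀ i : Fin k, {x : ℕ × ActCode k l × ℕ | ∃ p, numP p = i ∧ ∃ t ∈ C.Δ p,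
      x = ((σ p t.source : ℕ), (t.act.map μ).code numP numA, (σ p t.target : ℕ))}.Finite := by
    intro i
    refine (Set.finite_range fun z : (p : P) × CFMTrans P A C.Msg (C.S p) p =>
      ((σ z.1 z.2.source : ℕ), (z.2.act.map μ).code numP numA, (σ z.1 z.2.target : ℕ))).subset ?_
    rintro x ⟨p, -, t, -, rfl⟩
    exact ⟨⟨p, t⟩, rfl⟩
  have hfinF : {x : Fin k → ℕ | ∃ s ∈ C.Acc, x = fun i =>
      (σ (numP.symm i) (s (numP.symm i)) : ℕ)}.Finite := by
    refine (Set.finite_range fun s : (p : P) → C.S p => fun i : Fin k =>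
      (σ (numP.symm i) (s (numP.symm i)) : ℕ)).subset ?_
    rintro x ⟨s, -, rfl⟩
    exact ⟨s, rfl⟩
  set c : CFMCode k l := (fun i => n (numP.symm i), m, fun i => (hfinΔ i).toFinset.toList,
    hfinF.toFinset.toList) with hc
  have hn : ∀ p, n p + 1 = c.1 (numP p) + 1 := fun p => by
    simp only [hc, Equiv.symm_apply_apply]
  -- The renaming of states, with a cast since `p` and `numP.symm (numP p)` differ as expressions.
  let τ : ∀ p, C.S p ≃ Fin (c.1 (numP p) + 1) := fun p => (σ p).trans (finCongr (hn p))
  have hτ : ∀ p s, (τ p s : ℕ) = σ p s := fun p s => rfl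
  have hΔ : ∀ p (t : CFMTrans P A C.Msg (C.S p) p),
      t.map (τ p) μ ∈ (c.toCFM numP numA).Δ p ↔ t ∈ C.Δ p := by
    intro p t
    simp only [CFMCode.toCFM, Set.mem_ofPred_eq, hc, Finset.mem_toList, Set.Finite.mem_toFinset]
    constructor
    · rintro ⟨q, hq, t', ht', h⟩
      obtain rfl := numP.injective hq
      rcases t with ⟨s, α, s'⟩
      rcases t' with ⟨r, β, r'⟩
      simp only [Prod.mk.injEq, CFMTrans.map] at h
      obtain ⟨h1, h2, h3⟩ := h
      obtain rfl := (σ q).injective (Fin.ext h1)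
      obtain rfl := (σ q).injective (Fin.ext h3)
      have h4 := congrArg (Act.map μ.symm) (Act.code_injective numP numA h2)
      simp only [Act.map_map, Equiv.symm_comp_self, Act.map_id] at h4
      exact h4 ▸ ht'
    · exact fun ht => ⟨p, rfl, t, ht, rfl⟩
  have hs : ∀ (s : (p : P) → C.S p) (p q : P), q = p → (σ q (s q) : ℕ) = σ p (s p) := by
    rintro s p q rfl
    rfl
  have hAcc : ∀ s : (p : P) → C.S p,
      (fun p => τ p (s p)) ∈ (c.toCFM numP numA).Acc ↔ s ∈ C.Acc := by
    intro s
    simp only [CFMCode.toCFM, Set.mem_ofPred_eq, hc, Finset.mem_toList, Set.Finite.mem_toFinset]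
    constructor
    · rintro ⟨g, ⟨s', hs', rfl⟩, h⟩
      convert hs'
      funext p
      exact (σ p).injective (Fin.ext ((h p).trans (hs s' p _ (numP.symm_apply_apply p))))
    · exact fun h => ⟨_, ⟨s, h, rfl⟩, fun p => (hs s p _ (numP.symm_apply_apply p)).symm⟩
  have hinit : ∀ p, τ p (C.init p) = (c.toCFM numP numA).init p := fun p =>
    Fin.ext ((hτ p _).trans (congrArg Fin.val (hσ p)))
  refine ⟨c, (language_subset (fun p => τ p) μ hinit (fun p t ht => (hΔ p t).2 ht)
    fun s hs => (hAcc s).2 hs).antisymm (language_subset (fun p => (τ p).symm) μ.symm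
    (fun p => ((τ p).symm_apply_eq).2 (hinit p).symm) (fun p t ht => (hΔ p _).1 ?_)
    fun s hs => (hAcc _).1 ?_)⟩
  · have h : (t.map (τ p).symm μ.symm).map (τ p) μ = t := by
      rcases t with ⟨s, α, s'⟩
      refine CFMTrans.mk.injEq .. ▸ ⟨(τ p).apply_symm_apply s, ?_, (τ p).apply_symm_apply s'⟩
      exact (Act.map_map _ _ α).trans ((congrArg (fun f => Act.map f α) μ.self_comp_symm).trans
        (Act.map_id α))
    exact h.symm ▸ ht
  · have h : (fun p => τ p ((τ p).symm (s p))) = s := funext fun p => (τ p).apply_symm_apply (s p)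
    exact h.symm ▸ hs

end CFM

/-- Sentences are translated to descriptions of machines by a computable function. The tiling of
relative positions is fixed, and the description is primitive recursive in the sentence. -/
theorem exists_machine {k l : ℕ} (numP : P ≃ Fin k) (numA : A ≃ Fin l) :
    ∃ g : ℕ × List (ℕ × ℕ × ℕ) → CFMCode k l, Computable g ∧ ∀ φ : EMSO2 P A,
      ((g (φ.code numP numA)).toCFM numP numA).language = φ.language := by
  have : Finite P := Finite.of_equiv _ numP.symm
  obtain ⟨N, T, xb, yb, hT, hT'⟩ := exists_kindTiling (P := P) (A := A)
  refine ⟨_, (Polish.primrec_blueprint_code T xb yb numP l).to_comp, fun φ => ?_⟩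
  ext M
  rw [Blueprint.mem_language_code]
  exact Polish.exists_accepts_iff (hT M) (hT' M) numP numA φ.kernel φ.closed

theorem mainTheorem1 {P : Type u} {A : Type v} [Finite P] [Finite A] :
    (∀ C : CFM P A, ∃ φ : EMSO2 P A, C.language = φ.language) ∧
    (∀ φ : EMSO2 P A, ∃ C : CFM P A, C.language = φ.language) ∧
    (∀ (k l : ℕ) (numP : P ≃ Fin k) (numA : A ≃ Fin l),
      (∃ f : CFMCode k l → ℕ × List (ℕ × ℕ × ℕ), Computable f ∧
        ∀ c : CFMCode k l, ∃ φ : EMSO2 P A,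
          f c = φ.code numP numA ∧ (c.toCFM numP numA).language = φ.language) ∧
      (∃ g : ℕ × List (ℕ × ℕ × ℕ) → CFMCode k l, Computable g ∧
        ∀ φ : EMSO2 P A,
          ((g (φ.code numP numA)).toCFM numP numA).language = φ.language)) := by
  obtain ⟨k, ⟨numP⟩⟩ := Finite.exists_equiv_fin P
  obtain ⟨l, ⟨numA⟩⟩ := Finite.exists_equiv_fin A
  refine ⟨fun C => ?_, fun φ => ?_, fun k l numP numA =>
    ⟨⟨_, CFMCode.primrec_sentence.to_comp, CFMCode.exists_sentence numP numA⟩,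
      exists_machine numP numA⟩⟩
  · obtain ⟨c, hc⟩ := CFM.exists_code numP numA C
    obtain ⟨φ, -, hφ⟩ := CFMCode.exists_sentence numP numA c
    exact ⟨φ, hc.trans hφ⟩
  · obtain ⟨g, -, hg⟩ := exists_machine numP numA
    exact ⟨_, hg φ⟩
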